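/- **Setting.** Let $F$ be a totally real number field with ring of integers $\mathcal O$, and let $E/F$ be a quadratic extension with exactly one complex place $w_0$, lying over the real place $v_0$ of $F$. Let $D$ be a quaternion division algebra over $F$ ramified at every real place other than $v_0$ and split at $v_0$, and assume that $B=D\otimes_F E$ is a division algebra. Write $\iota$ for the standard involution and $\bar{\ }$ for the conjugation of $B$ over $D$. Put $\mathbf G(F)=\{\gamma\in B:\gamma\,\iota(\gamma)=1\}$ and $V=\{x\in B:\bar x=\iota(x)\}$. Fix an identification of $B\otimes_F F_{v_0}$ with $M_2(\mathbb C)$ taking $D\otimes_F F_{v_0}$ to $M_2(\mathbb R)$; it embeds $\mathbf G(F)$ into $G_0=\mathrm{SL}(2,\mathbb C)$. Let $H'$ be the normalizer of $\mathrm{SL}(2,\mathbb R)$ in $G_0$, and let $d$ be the distance of the left-invariant Riemannian metric on $G_0$ given on $\mathfrak{sl}(2,\mathbb C)$ by the norm $\left\|\begin{pmatrix}Z_1&Z_2\\Z_3&-Z_1\end{pmatrix}\right\|=(|Z_1|^2+|Z_2|^2+|Z_3|^2)^{1/2}$. For a finite place $v$ of $F$ let $F_v$ be the completion, $\mathcal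 O_v$ its ring of integers, $B_v=B\otimes_F F_v$, and $D_v$, $V_v$ likewise. Let $\mathcal O_B\subset B$ be a maximal $\mathcal O$-order, with completions $\mathcal O_{B,v}$, and let $\mathcal L_v$ be the completion of $\mathcal L=V\cap\mathcal O_B$. Let $S$ be a finite set of places of $F$ containing all infinite places and all places that ramify in $D$ or in $E$. Let $\mathscr P$ be the set of finite places $v\notin S$ that split in $E$. Let $K_v$ be a subgroup of $B_v^1=\{x\in B_v:x\,\iota(x)=1\}$ for each finite $v$, equal to $B_v^1\cap\mathcal O_{B,v}$ if $v\notin S$ and stabilizing $\mathcal O_{B,v}$ if $v\in S$. The set $S$ is so large that for every $v\in\mathscr P$ there is an $F_v$-algebra isomorphism $\alpha_v:B_v\to M_2(F_v)\times M_2(F_v)$ under which $\bar{\ }$ becomes the exchange of the two factors, and $$\alpha_v(D_v)=\{(T,T)\},\quad \alpha_v(V_v)=\{(T,\iota(T))\}\quad (T\in M_2(F_v)),$$ $$\alpha_v(K_v)=\mathrm{SL}(2,\mathcal O_v)^2,\quad \alpha_v(\mathcal L_v)=\{(T,\iota(T)):T\in M_2(\mathcal O_v)\};$$ fix such $\alpha_v$.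 With $\varpi_v$ a uniformizer, put $K_{v}(m)=\mathrm{SL}(2,\mathcal O_v)\,\mathrm{diag}(\varpi_v^m,\varpi_v^{-m})\,\mathrm{SL}(2,\mathcal O_v)$. For a nonzero ideal $\mathfrak n\subset\mathcal O$ divisible only by primes in $\mathscr P$ let $$K(\mathfrak n)=\prod_{v\in\mathscr P}\alpha_v^{-1}\bigl(K_v(\mathrm{ord}_v\mathfrak n)\times K_v(0)\bigr)\times\prod_{v\notin\mathscr P,\ v<\infty}K_v .$$ For $g\in G_0$ and $\delta\in\mathbb R$ let $$M(g,\delta,\mathfrak n)=\{\gamma\in\mathbf G(F)\cap K(\mathfrak n): d(g^{-1}\gamma g,e)\le 1,\ d(g^{-1}\gamma g,H')\le\delta\}.$$ **Proposition.** Let $\Omega\subset G_0$ be compact. There exist constants $C>0$ and $A>0$ with the following property. For all $g\in\Omega$ and $X>0$ there is a set $\mathscr P_0\subset\mathscr P$ (depending on $g$ and $X$) with $$\#(\mathscr P\setminus\mathscr P_0)\le A\max(\log X,0)$$ such that, for every $\delta<CX^{-8}$ and every nonzero ideal $\mathfrak n\ne\mathcal O$ divisible only by primes in $\mathscr P_0$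 and with $\mathrm N\mathfrak n<X$, one has $M(g,\delta,\mathfrak n)=\emptyset$. -/

import Mathlib

open scoped TensorProduct NumberField
open NumberField IsDedekindDomain

/-- A (possibly noncommutative) division ring. -/
def IsDivision (R : Type*) [Ring R] : Prop :=
  Nontrivial R ∧ ∀ x : R, x ≠ 0 → IsUnit x

/-! ### The left-invariant metric on `SL(2, ℂ)` and the group `H'` -/

section Metric

/-- `G₀ = SL(2, ℂ)`. -/
abbrev SL2C : Type := Matrix.SpecialLinearGroup (Fin 2) ℂ

/-- The norm `(|Z₁|² + |Z₂|² + |Z₃|²)^(1/2)` of the element `(Z₁, Z₂; Z₃, -Z₁)` of `𝔰𝔩(2, ℂ)`. -/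
noncomputable def slNorm (Z : Matrix (Fin 2) (Fin 2) ℂ) : ℝ :=
  Real.sqrt (‖Z 0 0‖ ^ 2 + ‖Z 0 1‖ ^ 2 + ‖Z 1 0‖ ^ 2)

/-- The entrywise derivative of a curve in `SL(2, ℂ)`. -/
noncomputable def velocity (c : ℝ → SL2C) (t : ℝ) : Matrix (Fin 2) (Fin 2) ℂ :=
  Matrix.of fun i j => deriv (fun s => (c s : Matrix (Fin 2) (Fin 2) ℂ) i j) t

/-- The length on `[0, 1]` of a curve in `SL(2, ℂ)` for the left-invariant Riemannian metric
that is given by `slNorm` on the Lie algebra, i.e. `∫ ‖c(t)⁻¹ c'(t)‖ dt`. -/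
noncomputable def curveLength (c : ℝ → SL2C) : ℝ :=
  ∫ t in (0 : ℝ)..1, slNorm (((c t)⁻¹ : SL2C) * velocity c t)

/-- The Riemannian distance: the infimum of the lengths of `C¹` curves from `g` to `h`. -/
noncomputable def dG (g h : SL2C) : ℝ :=
  sInf {l : ℝ | ∃ c : ℝ → SL2C,
    (∀ i j, ContDiff ℝ 1 fun t => (c t : Matrix (Fin 2) (Fin 2) ℂ) i j) ∧
      c 0 = g ∧ c 1 = h ∧ l = curveLength c}

/-- The distance from a point to a set. -/
noncomputable def dGSet (g : SL2C) (A : Set SL2C) : ℝ :=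
  sInf {r : ℝ | ∃ h ∈ A, r = dG g h}

/-- `H₀ = SL(2, ℝ)` inside `SL(2, ℂ)`. -/
noncomputable def H0 : Subgroup SL2C :=
  (Matrix.SpecialLinearGroup.map (n := Fin 2) (algebraMap ℝ ℂ)).range

/-- `H'`, the normalizer of `SL(2, ℝ)` in `SL(2, ℂ)`. -/
noncomputable def Hprime : Subgroup SL2C := Subgroup.normalizer (H0 : Set SL2C)

end Metric

/-! ### Quaternion algebras -/

section Quaternion

variable (F E : Type*) [Field F] [Field E] [Algebra F E] (a b : F)

/-- The quaternion algebra `D = (a, b)_F`: `i² = a`, `j² = b`, `ij = -ji = k`. -/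
abbrev QuatD : Type _ := QuaternionAlgebra F a 0 b

/-- `B = E ⊗_F D`. -/
abbrev QuatB : Type _ := E ⊗[F] QuatD F a b

/-- The standard involution of `D`. -/
noncomputable def iotaD : QuatD F a b →ₗ[F] QuatD F a b :=
  (MulOpposite.opLinearEquiv F).symm.toLinearMap ∘ₗ
    (QuaternionAlgebra.starAe (R := F) (c₁ := a) (c₂ := 0) (c₃ := b)).toLinearMap

/-- The standard involution of `B`, the `E`-linear extension of that of `D`. -/
noncomputable def iotaB : QuatB F E a b →ₗ[F] QuatB F E a b :=
  LinearMap.lTensor E (iotaD F a b)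

variable {F E} in
/-- The conjugation of `B` over `D` that an automorphism `σ` of `E` over `F` gives. -/
noncomputable def barB (σ : E ≃ₐ[F] E) : QuatB F E a b →ₐ[F] QuatB F E a b :=
  Algebra.TensorProduct.map σ.toAlgHom (AlgHom.id F (QuatD F a b))

end Quaternion

/-- A quadratic extension `E/F` of a totally real field with exactly one complex place `w₀`,
a quaternion division algebra `D` over `F` that ramifies at all real places but the one below
`w₀`, with `B = E ⊗ D` a division algebra, and an identification of `B` at `w₀` with
`M₂(ℂ)` which takes `D` into `M₂(ℝ)`. -/
structure QuatDatum (F E : Type*) [Field F] [NumberField F] [Field E] [NumberField E]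
    [Algebra F E] where
  /-- the nontrivial automorphism of `E` over `F` -/
  σ : E ≃ₐ[F] E
  σ_ne : σ ≠ AlgEquiv.refl
  /-- the unique complex place of `E` -/
  w₀ : InfinitePlace E
  w₀_isComplex : w₀.IsComplex
  w₀_unique : ∀ w : InfinitePlace E, w.IsComplex → w = w₀
  /-- `D = (a, b)_F` -/
  a : F
  b : F
  D_division : IsDivision (QuatD F a b)
  B_division : IsDivision (QuatB F E a b)
  D_ramified : ∀ v : InfinitePlace F, v ≠ w₀.comap (algebraMap F E) →
    IsDivision (v.Completion ⊗[F] QuatD F a b)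
  /-- The map `B → M₂(ℂ)` that is linear over the embedding `w₀` of `E`. It is the restriction
  of a unique isomorphism `B ⊗_E E_{w₀} ≃ M₂(ℂ)`, and takes `D ⊗_F F_{v₀}` to `M₂(ℝ)`, where
  `v₀` is the place of `F` below `w₀`. -/
  θ : QuatB F E a b →+* Matrix (Fin 2) (Fin 2) ℂ
  θ_E : ∀ e : E, θ (e ⊗ₜ[F] (1 : QuatD F a b)) = Matrix.scalar (Fin 2) (w₀.embedding e)
  θ_D : ∀ (d : QuatD F a b) (i j : Fin 2), (θ ((1 : E) ⊗ₜ[F] d) i j).im = 0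

namespace QuatDatum

variable {F E : Type*} [Field F] [NumberField F] [Field E] [NumberField E] [Algebra F E]

section Global

variable (Q : QuatDatum F E)

/-- `D` -/
abbrev D : Type _ := QuatD F Q.a Q.b

/-- `B` -/
abbrev B : Type _ := QuatB F E Q.a Q.b

/-- The involution `ι` of `B`. -/
noncomputable abbrev iota : Q.B →ₗ[F] Q.B := iotaB F E Q.a Q.b

/-- The conjugation of `B` over `D`. -/
noncomputable abbrev bar : Q.B →ₐ[F] Q.B := barB Q.a Q.b Q.σ

/-- The `F`-space `V = {x ∈ B | bar x = ι x}`. -/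
def V : Set Q.B := {x | Q.bar x = Q.iota x}

/-- The group `G(F) = B¹` of elements of reduced norm `1`. -/
def GF : Set (Q.B)ˣ := {γ | (γ : Q.B) * Q.iota γ = 1}

/-- An `𝓞 F`-order in `B`. -/
def IsOrder (O : Subalgebra (𝓞 F) Q.B) : Prop :=
  Module.Finite (𝓞 F) O ∧ Submodule.span F (O : Set Q.B) = ⊤

theorem a_ne_zero : Q.a ≠ 0 := by
  intro h
  have hx : (⟨0, 1, 0, 0⟩ : Q.D) ≠ 0 := fun h0 => one_ne_zero (congrArg QuaternionAlgebra.imI h0)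
  have hu := Q.D_division.2 _ hx
  have hz : (⟨0, 1, 0, 0⟩ : Q.D) * ⟨0, 1, 0, 0⟩ = 0 := by
    ext <;> simp [h]
  exact hx (hu.mul_left_eq_zero.mp hz)

theorem b_ne_zero : Q.b ≠ 0 := by
  intro h
  have hx : (⟨0, 0, 1, 0⟩ : Q.D) ≠ 0 := fun h0 => one_ne_zero (congrArg QuaternionAlgebra.imJ h0)
  have hu := Q.D_division.2 _ hx
  have hz : (⟨0, 0, 1, 0⟩ : Q.D) * ⟨0, 0, 1, 0⟩ = 0 := by
    ext <;> simp [h]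
  exact hx (hu.mul_left_eq_zero.mp hz)

theorem trace_eq_zero_of_anticomm {S T : Matrix (Fin 2) (Fin 2) ℂ} {c : ℂ} (hc : c ≠ 0)
    (hT : T * T = c • (1 : Matrix (Fin 2) (Fin 2) ℂ)) (hST : S * T = -(T * S)) :
    S.trace = 0 := by
  have h1 : (S * T * T).trace = c * S.trace := by
    rw [mul_assoc, hT]; simp
  have h2 : (S * T * T).trace = -(c * S.trace) := by
    rw [hST, neg_mul, Matrix.trace_neg, mul_assoc, Matrix.trace_mul_comm, mul_assoc, hT]; simp
  have h3 : c * S.trace = 0 := by linear_combination (h2 - h1) / 2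
  exact (mul_eq_zero.mp h3).resolve_left hc

/-- The map `θ` takes the involution `ι` to the adjugate. -/
theorem θ_iota (x : Q.B) : Q.θ (Q.iota x) = (Q.θ x).adjugate := by
  have hadd : ∀ S T : Matrix (Fin 2) (Fin 2) ℂ, (S + T).adjugate = S.adjugate + T.adjugate := by
    intro S T
    ext i j
    fin_cases i <;> fin_cases j <;> simp [Matrix.adjugate_fin_two] <;> ring
  have hsmul : ∀ (c : ℂ) (T : Matrix (Fin 2) (Fin 2) ℂ), (c • T).adjugate = c • T.adjugate := by
    intro c T
    ext i j
    fin_cases i <;> fin_cases j <;> simp [Matrix.adjugate_fin_two]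
  have hpure : ∀ (e : E) (d : Q.D),
      Q.θ (e ⊗ₜ[F] d) = Q.w₀.embedding e • Q.θ ((1 : E) ⊗ₜ[F] d) := by
    intro e d
    have : (e ⊗ₜ[F] d : Q.B) = (e ⊗ₜ[F] (1 : Q.D)) * ((1 : E) ⊗ₜ[F] d) := by
      simp [Algebra.TensorProduct.tmul_mul_tmul]
    rw [this, map_mul, Q.θ_E]
    simp [Matrix.smul_eq_diagonal_mul, Matrix.scalar_apply]
  let f : F →+* ℂ := Q.w₀.embedding.comp (algebraMap F E)
  let t : Q.D →+* Matrix (Fin 2) (Fin 2) ℂ :=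
    Q.θ.comp (Algebra.TensorProduct.includeRight : Q.D →ₐ[F] Q.B).toRingHom
  have ht : ∀ d, t d = Q.θ ((1 : E) ⊗ₜ[F] d) := fun d => rfl
  have htsmul : ∀ (r : F) (d : Q.D), t (r • d) = f r • t d := by
    intro r d
    rw [ht, ht]
    have : ((1 : E) ⊗ₜ[F] (r • d) : Q.B) = (algebraMap F E r) ⊗ₜ[F] d := by
      rw [← TensorProduct.smul_tmul, Algebra.algebraMap_eq_smul_one]
    rw [this, hpure]; rfl
  let I : Q.D := ⟨0, 1, 0, 0⟩
  let J : Q.D := ⟨0, 0, 1, 0⟩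
  let K : Q.D := ⟨0, 0, 0, 1⟩
  have hII : I * I = Q.a • (1 : Q.D) := by ext <;> simp [I]
  have hJJ : J * J = Q.b • (1 : Q.D) := by ext <;> simp [J]
  have hIJ : I * J = -(J * I) := by ext <;> simp [I, J]
  have hJI : J * I = -(I * J) := by ext <;> simp [I, J]
  have hK : K * J = -(J * K) := by ext <;> simp [K, J]
  have tJJ : t J * t J = f Q.b • (1 : Matrix (Fin 2) (Fin 2) ℂ) := by
    rw [← map_mul, hJJ, htsmul, map_one]
  have tII : t I * t I = f Q.a • (1 : Matrix (Fin 2) (Fin 2) ℂ) := by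
    rw [← map_mul, hII, htsmul, map_one]
  have ha : f Q.a ≠ 0 := (map_ne_zero f).mpr Q.a_ne_zero
  have hb : f Q.b ≠ 0 := (map_ne_zero f).mpr Q.b_ne_zero
  have trI : (t I).trace = 0 := trace_eq_zero_of_anticomm hb tJJ (by
    rw [← map_mul, hIJ, map_neg, map_mul])
  have trJ : (t J).trace = 0 := trace_eq_zero_of_anticomm ha tII (by
    rw [← map_mul, hJI, map_neg, map_mul])
  have trK : (t K).trace = 0 := trace_eq_zero_of_anticomm hb tJJ (by
    rw [← map_mul, hK, map_neg, map_mul])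
  have hadj : ∀ T : Matrix (Fin 2) (Fin 2) ℂ, T.trace = 0 → T.adjugate = -T := by
    intro T hT
    rw [Matrix.trace_fin_two] at hT
    ext i j
    fin_cases i <;> fin_cases j <;> simp [Matrix.adjugate_fin_two]
    · linear_combination hT
    · linear_combination hT
  have hD : ∀ d : Q.D, t (iotaD F Q.a Q.b d) = (t d).adjugate := by
    intro d
    have h1 : d = d.re • (1 : Q.D) + d.imI • I + d.imJ • J + d.imK • K := by
      ext <;> simp [I, J, K]
    have h2 : iotaD F Q.a Q.b d
        = d.re • (1 : Q.D) + d.imI • (-I) + d.imJ • (-J) + d.imK • (-K) := by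
      ext <;> simp [iotaD, I, J, K]
    rw [h2]
    conv_rhs => rw [h1]
    simp only [map_add, htsmul, map_neg, map_one, hadd, hsmul, hadj _ trI, hadj _ trJ,
      hadj _ trK, Matrix.adjugate_one]
  induction x using TensorProduct.induction_on with
  | zero =>
    have : (0 : Matrix (Fin 2) (Fin 2) ℂ).adjugate = 0 := by
      simp [Matrix.adjugate_fin_two, ← Matrix.ext_iff, Fin.forall_fin_two]
    simp [this]
  | tmul e d =>
    have h1 : Q.iota (e ⊗ₜ[F] d) = e ⊗ₜ[F] iotaD F Q.a Q.b d := rfl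
    rw [h1, hpure, hpure e d, hsmul, ← ht, ← ht, hD]
  | add x y hx hy => rw [map_add, map_add, map_add, hadd, hx, hy]

theorem det_θ (γ : (Q.B)ˣ) (h : γ ∈ Q.GF) : (Q.θ (γ : Q.B)).det = 1 := by
  have h1 : Q.θ (γ : Q.B) * (Q.θ (γ : Q.B)).adjugate = 1 := by
    rw [← Q.θ_iota, ← map_mul]
    have h2 : (γ : Q.B) * Q.iota γ = 1 := h
    rw [h2, map_one]
  rw [Matrix.mul_adjugate] at h1
  have h3 := congrFun (congrFun h1 0) 0
  simpa using h3

/-- The embedding `G(F) → G₀ = SL(2, ℂ)` at the place `v₀`. -/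
noncomputable def toSL (γ : (Q.B)ˣ) (h : γ ∈ Q.GF) : SL2C :=
  ⟨Q.θ (γ : Q.B), Q.det_θ γ h⟩

end Global

section Local

variable (Q : QuatDatum F E) (v : HeightOneSpectrum (𝓞 F))

/-- `B_v = F_v ⊗_F B` -/
abbrev Bv : Type _ := v.adicCompletion F ⊗[F] Q.B

/-- `B → B_v` -/
noncomputable abbrev toBv : Q.B →ₐ[F] Q.Bv v :=
  Algebra.TensorProduct.includeRight

/-- The involution `ι` on `B_v`. -/
noncomputable def iotav : Q.Bv v →ₗ[F] Q.Bv v :=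
  LinearMap.lTensor (v.adicCompletion F) Q.iota

/-- The conjugation of `B_v` over `D_v`. -/
noncomputable def barv : Q.Bv v →ₗ[F] Q.Bv v :=
  LinearMap.lTensor (v.adicCompletion F) Q.bar.toLinearMap

/-- `D_v = F_v ⊗_F D` as a subset of `B_v`. -/
noncomputable def Dv : Set (Q.Bv v) :=
  Set.range (LinearMap.lTensor (v.adicCompletion F)
    (Algebra.TensorProduct.includeRight : Q.D →ₐ[F] Q.B).toLinearMap)

/-- `V_v`, the `F_v`-span of `V` in `B_v`. -/
noncomputable def Vv : Submodule (v.adicCompletion F) (Q.Bv v) :=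
  Submodule.span (v.adicCompletion F) (Q.toBv v '' Q.V)

/-- The completion at `v` of an order `O` of `B`, the `𝓞_v`-span of `O` in `B_v`. -/
noncomputable def orderv (O : Subalgebra (𝓞 F) Q.B) : Submodule (v.adicCompletionIntegers F) (Q.Bv v) :=
  Submodule.span (v.adicCompletionIntegers F) (Q.toBv v '' (O : Set Q.B))

/-- `ℒ_v`, the `𝓞_v`-span of the lattice `ℒ = V ∩ O` in `B_v`. -/
noncomputable def latticev (O : Subalgebra (𝓞 F) Q.B) : Submodule (v.adicCompletionIntegers F) (Q.Bv v) :=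
  Submodule.span (v.adicCompletionIntegers F) (Q.toBv v '' (Q.V ∩ (O : Set Q.B)))

/-- The elements of `B_v¹` that lie in the completion of `O`. -/
noncomputable def normOneOrderv (O : Subalgebra (𝓞 F) Q.B) : Set (Q.Bv v) :=
  {x | x * Q.iotav v x = 1 ∧ x ∈ Q.orderv v O}

/-- `M₂(F_v)` -/
abbrev M2v (v : HeightOneSpectrum (𝓞 F)) : Type _ :=
  Matrix (Fin 2) (Fin 2) (v.adicCompletion F)

/-- `M₂(𝓞_v)` inside `M₂(F_v)`. -/
noncomputable def M2Ov (v : HeightOneSpectrum (𝓞 F)) : Set (M2v v) :=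
  {T | ∀ i j, T i j ∈ v.adicCompletionIntegers F}

/-- `SL(2, 𝓞_v)` inside `M₂(F_v)`. -/
noncomputable def SL2Ov (v : HeightOneSpectrum (𝓞 F)) : Set (M2v v) :=
  {T | T ∈ M2Ov v ∧ T.det = 1}

/-- The double coset of `diag(ϖ^m, ϖ^(-m))` for `SL(2, 𝓞_v)`, with `ϖ` a uniformizer. -/
noncomputable def doubleCoset (v : HeightOneSpectrum (𝓞 F)) (m : ℤ) : Set (M2v v) :=
  {T | ∃ ϖ : v.adicCompletionIntegers F, Irreducible ϖ ∧ ∃ k ∈ SL2Ov v, ∃ k' ∈ SL2Ov v,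
    T = k * Matrix.diagonal ![(ϖ : v.adicCompletion F) ^ m, (ϖ : v.adicCompletion F) ^ (-m)] * k'}

/-- The properties of the chosen isomorphism `α` of `B_v` with `M₂(F_v) × M₂(F_v)` at a split
place `v`; here `ι` on `M₂(F_v)` is the adjugate. -/
structure IsAdapted (O : Subalgebra (𝓞 F) Q.B)
    (α : Q.Bv v ≃ₐ[v.adicCompletion F] (M2v v × M2v v)) : Prop where
  image_D : α '' Q.Dv v = {p | ∃ T, p = (T, T)}
  image_V : α '' (Q.Vv v : Set (Q.Bv v)) = {p | ∃ T, p = (T, T.adjugate)}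
  image_K : α '' Q.normOneOrderv v O = SL2Ov v ×ˢ SL2Ov v
  image_L : α '' (Q.latticev v O : Set (Q.Bv v)) = {p | ∃ T ∈ M2Ov v, p = (T, T.adjugate)}
  bar_swap : ∀ x, α (Q.barv v x) = (α x).swap

end Local

end QuatDatum

/-- The set `𝒫` of primes of `F` outside `S` that split in the quadratic extension `E`. -/
def splitPrimes {F : Type*} (E : Type*) [Field F] [NumberField F] [Field E] [NumberField E]
    [Algebra F E] (S : Finset (HeightOneSpectrum (𝓞 F))) : Set (HeightOneSpectrum (𝓞 F)) :=
  {v | v ∉ S ∧ (v.asIdeal.primesOver (𝓞 E)).ncard = 2}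

/-- The choices of a maximal order `O_B`, of the finite places `S` (all infinite places being
understood to belong to the bad set as well), of the isomorphisms `α` at the places of `𝒫`, and of
the local groups `K_v` at the finite places. -/
structure LevelDatum {F E : Type*} [Field F] [NumberField F] [Field E] [NumberField E]
    [Algebra F E] (Q : QuatDatum F E) where
  /-- a maximal order in `B` -/
  OB : Subalgebra (𝓞 F) Q.B
  OB_maximal : Maximal Q.IsOrder OB
  /-- the finite places in the bad set -/
  S : Finset (HeightOneSpectrum (𝓞 F))
  D_ramified_mem : ∀ v : HeightOneSpectrum (𝓞 F),
    IsDivision (v.adicCompletion F ⊗[F] Q.D) → v ∈ S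
  E_ramified_mem : ∀ v : HeightOneSpectrum (𝓞 F),
    (∃ P ∈ v.asIdeal.primesOver (𝓞 E), P.ramificationIdx (𝓞 F) ≠ 1) → v ∈ S
  /-- the isomorphisms at the split places outside `S` -/
  α : ∀ v ∈ splitPrimes E S,
    Q.Bv v ≃ₐ[v.adicCompletion F] (QuatDatum.M2v v × QuatDatum.M2v v)
  α_adapted : ∀ v (hv : v ∈ splitPrimes E S), Q.IsAdapted v OB (α v hv)
  /-- the local groups -/
  K : ∀ v : HeightOneSpectrum (𝓞 F), Subgroup (Q.Bv v)ˣ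
  K_norm_one : ∀ v, ∀ u ∈ K v, (u : Q.Bv v) * Q.iotav v u = 1
  K_mem : ∀ v ∈ S, ∀ u ∈ K v, ∀ x ∈ Q.orderv v OB, (u : Q.Bv v) * x ∈ Q.orderv v OB
  K_not_mem : ∀ v ∉ S, ∀ u : (Q.Bv v)ˣ, u ∈ K v ↔ (u : Q.Bv v) ∈ Q.normOneOrderv v OB

namespace LevelDatum

variable {F E : Type*} [Field F] [NumberField F] [Field E] [NumberField E] [Algebra F E]
  {Q : QuatDatum F E} (L : LevelDatum Q)

/-- The set `𝒫` of split primes. -/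
def P : Set (HeightOneSpectrum (𝓞 F)) := splitPrimes E L.S

open Classical in
/-- The component at `v` of the set `K(𝔫) = ∏_{v ∈ 𝒫} K_v(ord_v 𝔫, 0) × ∏_{v ∉ 𝒫} K_v`, where
`K_v(m, n)` corresponds under `α` to the product of the double cosets of `diag(ϖ^m, ϖ^(-m))` and
`diag(ϖ^n, ϖ^(-n))`. -/
noncomputable def Kn (𝔫 : Ideal (𝓞 F)) (v : HeightOneSpectrum (𝓞 F)) : Set (Q.Bv v)ˣ :=
  if hv : v ∈ splitPrimes E L.S then
    {u | L.α v hv (u : Q.Bv v) ∈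
      QuatDatum.doubleCoset v (multiplicity v.asIdeal 𝔫) ×ˢ QuatDatum.doubleCoset v 0}
  else (L.K v : Set (Q.Bv v)ˣ)

/-- The set `M(g, δ, 𝔫)` of those `γ ∈ G(F) ∩ K(𝔫)` with `d(g⁻¹γg, e) ≤ 1` and
`d(g⁻¹γg, H') ≤ δ`. -/
noncomputable def M (g : SL2C) (δ : ℝ) (𝔫 : Ideal (𝓞 F)) : Set (Q.B)ˣ :=
  {γ | ∃ h : γ ∈ Q.GF,
    (∀ v : HeightOneSpectrum (𝓞 F),
      Units.map ((Q.toBv v : Q.B →ₐ[F] Q.Bv v) : Q.B →* Q.Bv v) γ ∈ L.Kn 𝔫 v) ∧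
    dG (g⁻¹ * Q.toSL γ h * g) 1 ≤ 1 ∧
    dGSet (g⁻¹ * Q.toSL γ h * g) (Hprime : Set SL2C) ≤ δ}

end LevelDatum

/-! Suppose `γ` lies in `M(g, δ, 𝔫)` and put `y = g⁻¹γg`. An element `h` of `H'` satisfies `h = ε
h̄` with `ε = ±1`, so `y` is close to `ε ȳ`. Equivalently `m = g ḡ⁻¹` nearly solves `γ m = ε m γ̄`.
The vector `m` depends on `g` alone, whatever `γ`, `δ` and `𝔫` are.

The map `q ↦ γ q - ε q γ̄` is an `E`-linear endomorphism of the four-dimensional space `B`, and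
every row of its matrix is small at `m`. The rows have bounded size at all infinite places: at `w₀`
because `γ` stays in a compact set, at the others because the norm form of `B` is positive definite
there. Their denominators come from `𝔫`, up to a fixed integer. If four of these rows, possibly from
different `γ`, were independent, their determinant would be small at `w₀`, bounded at the other
embeddings, and of denominator norm at most a constant times `X^8`: each row contributes the norm
from `E` of an element of `𝔫` of norm `O(X)`, hence `O(X²)`. For `δ < C X⁻⁸` this contradicts the
fact that a nonzero algebraic integer has norm at least `1` (`false_of_small_rows`).

So all rows have a common zero, and a cofactor vector gives a nonzero `q` in `B` with integral
coordinates of size `O(X^4)` and `γ q = ± q γ̄` for all these `γ` at once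
(`exists_integral_zero_of_small`, `LevelDatum.exists_common_twist`). Since `B` is a division
algebra, the reduced norm of `q` is nonzero. It leads to a nonzero integer `n` of `F`, divisible by
`q` in the order, of norm polynomial in `X` (`QuatDatum.exists_mul_eq_algebraMap`). Only `O(log X)`
primes divide `n`; they are removed from `𝒫`.

At a remaining prime `v` dividing `𝔫`, `q` is invertible in the local order, and the conjugation of
`B` exchanges the two factors of `M₂(F_v)²`. Hence the first component of `γ` is, up to sign, an
integral conjugate of the second, which is integral. This is impossible in the double coset of
`diag(ϖ^m, ϖ^(-m))` with `m > 0` (`LevelDatum.false_of_mul_eq`). -/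

section Metric

/-! ### The left-invariant metric, and closeness to `H'` in terms of matrix entries. -/

/-- The upper and lower unipotent elements of `SL(2, ℂ)`. -/
noncomputable def upperUnip (x : ℂ) : SL2C := ⟨!![1, x; 0, 1], by simp [Matrix.det_fin_two]⟩

/-- The lower unipotent elements of `SL(2, ℂ)`. -/
noncomputable def lowerUnip (x : ℂ) : SL2C := ⟨!![1, 0; x, 1], by simp [Matrix.det_fin_two]⟩

@[simp]
theorem coe_upperUnip (x : ℂ) :
    (upperUnip x : Matrix (Fin 2) (Fin 2) ℂ) = !![1, x; 0, 1] := rfl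

@[simp]
theorem coe_lowerUnip (x : ℂ) :
    (lowerUnip x : Matrix (Fin 2) (Fin 2) ℂ) = !![1, 0; x, 1] := rfl

/-- Elementary factorization: three unipotent factors suffice when the lower left entry is nonzero,
and a fourth covers the remaining case. It serves to join points by polynomial curves. -/
theorem exists_eq_unip_mul (g : SL2C) :
    ∃ x y z w : ℂ, g = upperUnip x * lowerUnip y * upperUnip z * lowerUnip w := by
  have key : ∀ g : SL2C, (g : Matrix (Fin 2) (Fin 2) ℂ) 1 0 ≠ 0 →
      ∃ x y z : ℂ, g = upperUnip x * lowerUnip y * upperUnip z := by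
    intro g hr
    have hd := g.2
    rw [Matrix.det_fin_two] at hd
    refine ⟨(g.1 0 0 - 1) / g.1 1 0, g.1 1 0, (g.1 1 1 - 1) / g.1 1 0, ?_⟩
    ext i j
    fin_cases i <;> fin_cases j <;>
      simp [Matrix.mul_apply, Fin.sum_univ_two] <;> field_simp
    · ring
    · linear_combination -hd
    · ring
  by_cases hr : (g : Matrix (Fin 2) (Fin 2) ℂ) 1 0 = 0
  · have hd := g.2
    rw [Matrix.det_fin_two, hr] at hd
    have hs : g.1 1 1 ≠ 0 := by rintro h; simp [h] at hd
    obtain ⟨x, y, z, h⟩ := key (g * lowerUnip 1) (by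
      simpa [Matrix.mul_apply, Fin.sum_univ_two, hr] using hs)
    refine ⟨x, y, z, -1, ?_⟩
    rw [← h, mul_assoc]
    have : lowerUnip 1 * lowerUnip (-1) = 1 := by
      ext i j
      fin_cases i <;> fin_cases j <;> simp [Matrix.mul_apply, Fin.sum_univ_two]
    rw [this, mul_one]
  · obtain ⟨x, y, z, h⟩ := key g hr
    refine ⟨x, y, z, 0, ?_⟩
    have : lowerUnip 0 = 1 := by
      ext i j
      fin_cases i <;> fin_cases j <;> simp
    rw [this, mul_one, h]

/-- Any two points of `SL(2, ℂ)` are joined by a `C¹` curve. -/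
theorem exists_curve (g h : SL2C) : ∃ c : ℝ → SL2C,
    (∀ i j, ContDiff ℝ 1 fun t => (c t : Matrix (Fin 2) (Fin 2) ℂ) i j) ∧ c 0 = g ∧ c 1 = h := by
  obtain ⟨x, y, z, w, hc⟩ := exists_eq_unip_mul (g⁻¹ * h)
  have hu : upperUnip 0 = 1 := by
    ext i j
    fin_cases i <;> fin_cases j <;> simp
  have hl : lowerUnip 0 = 1 := by
    ext i j
    fin_cases i <;> fin_cases j <;> simp
  -- Scaling all unipotent parameters by `t` contracts the factorization to the identity and keeps
  -- the entries polynomial in `t`.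
  refine ⟨fun t => g * (upperUnip (t * x) * lowerUnip (t * y) * upperUnip (t * z) *
    lowerUnip (t * w)), ?_, ?_, ?_⟩
  · intro i j
    have ht : ContDiff ℝ 1 fun t : ℝ => (t : ℂ) := Complex.ofRealCLM.contDiff
    fin_cases i <;> fin_cases j <;>
      simp [Matrix.mul_apply, Fin.sum_univ_two] <;> fun_prop
  · simp [hu, hl]
  · simp [← hc]

theorem hasDerivAt_entry {c : ℝ → SL2C}
    (hc : ∀ i j, ContDiff ℝ 1 fun t => (c t : Matrix (Fin 2) (Fin 2) ℂ) i j) (t : ℝ) (i j : Fin 2) :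
    HasDerivAt (fun s => (c s : Matrix (Fin 2) (Fin 2) ℂ) i j) (velocity c t i j) t :=
  ((hc i j).differentiable one_ne_zero t).hasDerivAt

theorem continuous_velocity {c : ℝ → SL2C}
    (hc : ∀ i j, ContDiff ℝ 1 fun t => (c t : Matrix (Fin 2) (Fin 2) ℂ) i j) (i j : Fin 2) :
    Continuous fun t => velocity c t i j :=
  (hc i j).continuous_deriv le_rfl

/-- The speed of a curve for the left-invariant metric. -/
noncomputable def speed (c : ℝ → SL2C) (t : ℝ) : ℝ := slNorm (((c t)⁻¹ : SL2C) * velocity c t)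

theorem speed_nonneg (c : ℝ → SL2C) (t : ℝ) : 0 ≤ speed c t := Real.sqrt_nonneg _

theorem curveLength_nonneg (c : ℝ → SL2C) : 0 ≤ curveLength c :=
  intervalIntegral.integral_nonneg zero_le_one fun t _ => speed_nonneg c t

theorem continuous_speed {c : ℝ → SL2C}
    (hc : ∀ i j, ContDiff ℝ 1 fun t => (c t : Matrix (Fin 2) (Fin 2) ℂ) i j) :
    Continuous (speed c) := by
  have h1 := fun i j => (hc i j).continuous
  have h2 := fun i j => continuous_velocity hc i j
  unfold speed slNorm
  simp only [Matrix.SpecialLinearGroup.coe_inv, Matrix.adjugate_fin_two, Matrix.mul_apply,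
    Fin.sum_univ_two, Matrix.of_apply, Matrix.cons_val', Matrix.cons_val_zero, Matrix.cons_val_one,
    Matrix.cons_val_fin_one]
  fun_prop

theorem trace_inv_mul_velocity {c : ℝ → SL2C}
    (hc : ∀ i j, ContDiff ℝ 1 fun t => (c t : Matrix (Fin 2) (Fin 2) ℂ) i j) (t : ℝ) :
    ((((c t)⁻¹ : SL2C) : Matrix (Fin 2) (Fin 2) ℂ) * velocity c t).trace = 0 := by
  have h := fun i j => hasDerivAt_entry hc t i j
  have h1 := ((h 0 0).mul (h 1 1)).sub ((h 0 1).mul (h 1 0))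
  have h2 : ((fun s => (c s).1 0 0) * (fun s => (c s).1 1 1) -
      (fun s => (c s).1 0 1) * fun s => (c s).1 1 0) = fun _ => (1 : ℂ) := by
    funext s
    have := (c s).2
    rw [Matrix.det_fin_two] at this
    simpa using this
  rw [h2] at h1
  have h3 := h1.unique (hasDerivAt_const t (1 : ℂ))
  simp only [Matrix.SpecialLinearGroup.coe_inv, Matrix.adjugate_fin_two, Matrix.mul_apply,
    Fin.sum_univ_two, Matrix.of_apply, Matrix.cons_val', Matrix.cons_val_zero, Matrix.cons_val_one,
    Matrix.cons_val_fin_one, Matrix.trace_fin_two]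
  linear_combination h3

theorem norm_le_slNorm {Z : Matrix (Fin 2) (Fin 2) ℂ} (hZ : Z.trace = 0) (i j : Fin 2) :
    ‖Z i j‖ ≤ slNorm Z := by
  have h : ‖Z 1 1‖ = ‖Z 0 0‖ := by
    rw [Matrix.trace_fin_two] at hZ
    rw [← norm_neg, ← eq_neg_of_add_eq_zero_left hZ]
  have := sq_nonneg ‖Z 0 0‖
  have := sq_nonneg ‖Z 0 1‖
  have := sq_nonneg ‖Z 1 0‖
  apply Real.le_sqrt_of_sq_le
  fin_cases i <;> fin_cases j <;> simp [h] <;> linarith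

/-- Write `c' = c Z` with `Z = c⁻¹ c'`. As `Z` has trace zero, all four of its entries are bounded
by the speed. -/
theorem norm_velocity_le {c : ℝ → SL2C}
    (hc : ∀ i j, ContDiff ℝ 1 fun t => (c t : Matrix (Fin 2) (Fin 2) ℂ) i j) (t : ℝ) (i j : Fin 2) :
    ‖velocity c t i j‖ ≤ speed c t * (‖(c t).1 i 0‖ + ‖(c t).1 i 1‖) := by
  set Z := (((c t)⁻¹ : SL2C) : Matrix (Fin 2) (Fin 2) ℂ) * velocity c t with hZ
  have hV : velocity c t = (c t).1 * Z := by
    rw [hZ, ← mul_assoc, ← Matrix.SpecialLinearGroup.coe_mul, mul_inv_cancel]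
    simp
  have hn := norm_le_slNorm (trace_inv_mul_velocity hc t)
  rw [hV, Matrix.mul_apply, Fin.sum_univ_two]
  refine (norm_add_le _ _).trans ?_
  rw [norm_mul, norm_mul, mul_add, mul_comm (speed c t), mul_comm (speed c t)]
  exact add_le_add (mul_le_mul_of_nonneg_left (hn 0 j) (norm_nonneg _))
    (mul_le_mul_of_nonneg_left (hn 1 j) (norm_nonneg _))

/-- The square of the Frobenius norm. -/
noncomputable def frobSq (M : Matrix (Fin 2) (Fin 2) ℂ) : ℝ :=
  ‖M 0 0‖ ^ 2 + ‖M 0 1‖ ^ 2 + ‖M 1 0‖ ^ 2 + ‖M 1 1‖ ^ 2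

theorem frobSq_nonneg (M : Matrix (Fin 2) (Fin 2) ℂ) : 0 ≤ frobSq M := by
  unfold frobSq; positivity

theorem norm_sq_le_frobSq (M : Matrix (Fin 2) (Fin 2) ℂ) (i j : Fin 2) :
    ‖M i j‖ ^ 2 ≤ frobSq M := by
  have := sq_nonneg ‖M 0 0‖
  have := sq_nonneg ‖M 0 1‖
  have := sq_nonneg ‖M 1 0‖
  have := sq_nonneg ‖M 1 1‖
  unfold frobSq
  fin_cases i <;> fin_cases j <;> simp <;> linarith

theorem exists_hasDerivAt_frobSq {c : ℝ → SL2C}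
    (hc : ∀ i j, ContDiff ℝ 1 fun t => (c t : Matrix (Fin 2) (Fin 2) ℂ) i j) (t : ℝ) :
    ∃ d : ℝ, HasDerivAt (fun s => frobSq (c s).1) d t ∧ |d| ≤ 4 * speed c t * frobSq (c t).1 := by
  have h := fun i j => (hasDerivAt_entry hc t i j).norm_sq
  refine ⟨_, (((h 0 0).add (h 0 1)).add (h 1 0)).add (h 1 1), ?_⟩
  have hb : ∀ i j, |2 * inner ℝ ((c t).1 i j) (velocity c t i j)| ≤
      2 * (‖(c t).1 i j‖ * (speed c t * (‖(c t).1 i 0‖ + ‖(c t).1 i 1‖))) := by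
    intro i j
    rw [abs_mul, abs_two]
    gcongr
    exact (abs_real_inner_le_norm _ _).trans
      (mul_le_mul_of_nonneg_left (norm_velocity_le hc t i j) (norm_nonneg _))
  have hs := speed_nonneg c t
  refine (abs_add_le _ _).trans ?_
  refine (add_le_add ((abs_add_le _ _).trans (add_le_add (abs_add_le _ _) le_rfl)) le_rfl).trans ?_
  refine (add_le_add (add_le_add (add_le_add (hb 0 0) (hb 0 1)) (hb 1 0)) (hb 1 1)).trans ?_
  unfold frobSq
  -- The factor `4` comes from `(x + y)² ≤ 2(x² + y²)`, applied to each row.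
  have h1 : 0 ≤ speed c t * (‖(c t).1 0 0‖ - ‖(c t).1 0 1‖) ^ 2 := by positivity
  have h2 : 0 ≤ speed c t * (‖(c t).1 1 0‖ - ‖(c t).1 1 1‖) ^ 2 := by positivity
  nlinarith [h1, h2]

/-- Grönwall's inequality: the logarithmic derivative of `frobSq` along the curve is at most four
times the speed in absolute value. A curve of bounded length therefore stays in a bounded set. -/
theorem frobSq_growth {c : ℝ → SL2C}
    (hc : ∀ i j, ContDiff ℝ 1 fun t => (c t : Matrix (Fin 2) (Fin 2) ℂ) i j) {t u : ℝ}
    (ht : 0 ≤ t) (htu : t ≤ u) (hu : u ≤ 1) :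
    frobSq (c u).1 ≤ frobSq (c t).1 * Real.exp (4 * curveLength c) ∧
      frobSq (c t).1 ≤ frobSq (c u).1 * Real.exp (4 * curveLength c) := by
  have hcont := continuous_speed hc
  set L : ℝ → ℝ := fun t => ∫ s in (0 : ℝ)..t, speed c s with hL
  have hLd : ∀ t, HasDerivAt L (speed c t) t := fun t =>
    intervalIntegral.integral_hasDerivAt_right (hcont.intervalIntegrable _ _)
      (hcont.stronglyMeasurableAtFilter _ _) hcont.continuousAt
  have hLmono : Monotone L := monotone_of_hasDerivAt_nonneg hLd (speed_nonneg c)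
  have hL1 : L 1 = curveLength c := rfl
  have hL0 : L 0 = 0 := by simp [hL]
  have hlu : L u - L t ≤ curveLength c := by
    rw [← hL1]
    have h1 := hLmono hu
    have h2 := hLmono ht
    rw [hL0] at h2
    linarith
  choose d hd hdb using exists_hasDerivAt_frobSq hc
  have hanti : Antitone fun t => frobSq (c t).1 * Real.exp (-4 * L t) := by
    have hder : ∀ t, HasDerivAt (fun t => frobSq (c t).1 * Real.exp (-4 * L t))
        (d t * Real.exp (-4 * L t) +
          frobSq (c t).1 * (Real.exp (-4 * L t) * (-4 * speed c t))) t := fun t =>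
      (hd t).mul ((hLd t).const_mul (-4)).exp
    refine antitone_of_hasDerivAt_nonpos hder fun t => ?_
    have := (abs_le.mp (hdb t)).2
    have he := Real.exp_pos (-4 * L t)
    simp only [Pi.zero_apply]
    nlinarith
  have hmono : Monotone fun t => frobSq (c t).1 * Real.exp (4 * L t) := by
    have hder : ∀ t, HasDerivAt (fun t => frobSq (c t).1 * Real.exp (4 * L t))
        (d t * Real.exp (4 * L t) +
          frobSq (c t).1 * (Real.exp (4 * L t) * (4 * speed c t))) t := fun t =>
      (hd t).mul ((hLd t).const_mul 4).exp
    refine monotone_of_hasDerivAt_nonneg hder fun t => ?_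
    have := (abs_le.mp (hdb t)).1
    have he := Real.exp_pos (4 * L t)
    simp only [Pi.zero_apply]
    nlinarith
  have hexp : Real.exp (4 * (L u - L t)) ≤ Real.exp (4 * curveLength c) :=
    Real.exp_le_exp.mpr (by linarith)
  constructor
  · have h1 : frobSq (c u).1 * Real.exp (-4 * L u) ≤ frobSq (c t).1 * Real.exp (-4 * L t) :=
      hanti htu
    have h2 := mul_le_mul_of_nonneg_right h1 (Real.exp_pos (4 * L u)).le
    rw [mul_assoc, mul_assoc, ← Real.exp_add, ← Real.exp_add] at h2
    have e1 : -4 * L u + 4 * L u = 0 := by ring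
    have e2 : -4 * L t + 4 * L u = 4 * (L u - L t) := by ring
    rw [e1, e2, Real.exp_zero, mul_one] at h2
    exact h2.trans (mul_le_mul_of_nonneg_left hexp (frobSq_nonneg _))
  · have h1 : frobSq (c t).1 * Real.exp (4 * L t) ≤ frobSq (c u).1 * Real.exp (4 * L u) :=
      hmono htu
    have h2 := mul_le_mul_of_nonneg_right h1 (Real.exp_pos (-4 * L t)).le
    rw [mul_assoc, mul_assoc, ← Real.exp_add, ← Real.exp_add] at h2
    have e1 : 4 * L t + -4 * L t = 0 := by ring
    have e2 : 4 * L u + -4 * L t = 4 * (L u - L t) := by ring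
    rw [e1, e2, Real.exp_zero, mul_one] at h2
    exact h2.trans (mul_le_mul_of_nonneg_left hexp (frobSq_nonneg _))

theorem norm_sub_le_curveLength {c : ℝ → SL2C}
    (hc : ∀ i j, ContDiff ℝ 1 fun t => (c t : Matrix (Fin 2) (Fin 2) ℂ) i j) {G : ℝ} (hG : 0 ≤ G)
    (hcG : frobSq (c 0).1 * Real.exp (4 * curveLength c) ≤ G ^ 2) (i j : Fin 2) :
    ‖(c 1).1 i j - (c 0).1 i j‖ ≤ 2 * G * curveLength c := by
  have hint : ∫ t in (0 : ℝ)..1, velocity c t i j = (c 1).1 i j - (c 0).1 i j :=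
    intervalIntegral.integral_eq_sub_of_hasDerivAt (fun t _ => hasDerivAt_entry hc t i j)
      ((continuous_velocity hc i j).intervalIntegrable _ _)
  have hle : ‖∫ t in (0 : ℝ)..1, velocity c t i j‖ ≤ ∫ t in (0 : ℝ)..1, 2 * G * speed c t := by
    refine intervalIntegral.norm_integral_le_of_norm_le zero_le_one ?_
      (((continuous_speed hc).const_mul _).intervalIntegrable _ _)
    refine Filter.Eventually.of_forall fun t ht => ?_
    have hb : ∀ k, ‖(c t).1 i k‖ ≤ G := fun k =>
      abs_le_of_sq_le_sq' ((norm_sq_le_frobSq _ i k).trans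
        ((frobSq_growth hc le_rfl ht.1.le ht.2).1.trans hcG)) hG |>.2
    calc ‖velocity c t i j‖ ≤ speed c t * (‖(c t).1 i 0‖ + ‖(c t).1 i 1‖) := norm_velocity_le hc t i j
      _ ≤ speed c t * (G + G) := by
        gcongr
        · exact speed_nonneg c t
        · exact hb 0
        · exact hb 1
      _ = 2 * G * speed c t := by ring
  rw [hint, intervalIntegral.integral_const_mul] at hle
  exact hle

/-- By `exists_curve` the infimum in `dG` runs over a nonempty set, so it is not the default value
`0` and can be approached by actual curves. -/
theorem exists_curve_of_dG_lt {g h : SL2C} {r : ℝ} (hr : dG g h < r) : ∃ c : ℝ → SL2C,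
    (∀ i j, ContDiff ℝ 1 fun t => (c t : Matrix (Fin 2) (Fin 2) ℂ) i j) ∧
      c 0 = g ∧ c 1 = h ∧ curveLength c < r := by
  obtain ⟨c, h1, h2, h3⟩ := exists_curve g h
  obtain ⟨l, ⟨c, h1, h2, h3, rfl⟩, hl⟩ := exists_lt_of_csInf_lt (by exact ⟨_, c, h1, h2, h3, rfl⟩) hr
  exact ⟨c, h1, h2, h3, hl⟩

theorem frobSq_le_of_dG_one {y : SL2C} (hy : dG y 1 ≤ 1) : frobSq y.1 ≤ 2 * Real.exp 8 := by
  -- The infimum need not be attained, so a curve of length below `2` is used; hence the exponent `8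
  -- = 4 · 2`.
  obtain ⟨c, hc, h0, h1, hl⟩ := exists_curve_of_dG_lt (lt_of_le_of_lt hy one_lt_two)
  have h := (frobSq_growth hc le_rfl zero_le_one le_rfl).2
  rw [h0, h1] at h
  have h2 : frobSq (1 : SL2C).1 = 2 := by
    simp [frobSq]
    norm_num
  rw [h2] at h
  refine h.trans ?_
  gcongr
  linarith

/-- The entrywise complex conjugation of `SL(2, ℂ)`. -/
noncomputable def conjSL : SL2C →* SL2C := Matrix.SpecialLinearGroup.map (starRingEnd ℂ)

theorem conjSL_of_mem_H0 {h : SL2C} (hh : h ∈ H0) : conjSL h = h := by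
  obtain ⟨s, rfl⟩ := hh
  ext i j
  simp [conjSL, Matrix.SpecialLinearGroup.map_apply_coe]

/-- If `h` normalizes `SL(2, ℝ)`, applying complex conjugation to `h s h⁻¹` shows that `z = h̄⁻¹ h`
centralizes `SL(2, ℝ)`. Commuting with an upper and a lower unipotent already makes `z` scalar, and
its determinant makes it `±1`. -/
theorem eq_or_eq_neg_conj_of_mem_Hprime {h : SL2C} (hh : h ∈ Hprime) :
    (∀ i j, h.1 i j = (starRingEnd ℂ) (h.1 i j)) ∨
      ∀ i j, h.1 i j = -(starRingEnd ℂ) (h.1 i j) := by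
  have hcomm : ∀ s ∈ H0, Commute ((conjSL h)⁻¹ * h) s := by
    intro s hs
    have h1 : h * s * h⁻¹ ∈ H0 := (Subgroup.mem_normalizer_iff.mp hh s).mp hs
    have h2 := conjSL_of_mem_H0 h1
    rw [map_mul, map_mul, map_inv, conjSL_of_mem_H0 hs] at h2
    have h3 : (conjSL h)⁻¹ * (conjSL h * s * (conjSL h)⁻¹) * h =
      (conjSL h)⁻¹ * (h * s * h⁻¹) * h := by rw [h2]
    have h4 : s * ((conjSL h)⁻¹ * h) = (conjSL h)⁻¹ * h * s := by
      simpa [mul_assoc] using h3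
    exact h4.symm
  have hu : upperUnip 1 ∈ H0 := ⟨⟨!![1, 1; 0, 1], by simp [Matrix.det_fin_two]⟩, by
    ext i j
    change (algebraMap ℝ ℂ) ((!![1, 1; 0, 1] : Matrix (Fin 2) (Fin 2) ℝ) i j) = _
    fin_cases i <;> fin_cases j <;> simp⟩
  have hl : lowerUnip 1 ∈ H0 := ⟨⟨!![1, 0; 1, 1], by simp [Matrix.det_fin_two]⟩, by
    ext i j
    change (algebraMap ℝ ℂ) ((!![1, 0; 1, 1] : Matrix (Fin 2) (Fin 2) ℝ) i j) = _
    fin_cases i <;> fin_cases j <;> simp⟩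
  set z := (conjSL h)⁻¹ * h with hz
  have c1 := congrArg (fun m : SL2C => m.1) (hcomm _ hu).eq
  have c2 := congrArg (fun m : SL2C => m.1) (hcomm _ hl).eq
  have d1 := congrFun (congrFun c1 0) 0
  have d2 := congrFun (congrFun c1 0) 1
  have d3 := congrFun (congrFun c2 0) 0
  simp [Matrix.mul_apply, Fin.sum_univ_two] at d1 d2 d3
  have hdet := z.2
  rw [Matrix.det_fin_two] at hdet
  have d4 : z.1 0 0 = z.1 1 1 := by linear_combination d2
  have hsq : z.1 1 1 = 1 ∨ z.1 1 1 = -1 := by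
    rw [d1, d4] at hdet
    exact mul_self_eq_one_iff.mp (by linear_combination hdet)
  have hh' : h = conjSL h * z := by rw [hz]; group
  have hent : ∀ i j, h.1 i j = (starRingEnd ℂ) (h.1 i j) * z.1 1 1 := by
    intro i j
    conv_lhs => rw [hh']
    fin_cases j <;>
      simp [Matrix.mul_apply, Fin.sum_univ_two, d1, d3, d4, conjSL,
        Matrix.SpecialLinearGroup.map_apply_coe]
  rcases hsq with h1 | h1
  · left; intro i j; simpa [h1] using hent i j
  · right; intro i j; simpa [h1] using hent i j

/-- An element near `e` and within `η` of `H'` is within a multiple of `η` of plus or minus its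
complex conjugate. -/
theorem exists_sign_of_dGSet_lt : ∃ K > (0 : ℝ), ∀ (y : SL2C) (η : ℝ), η ≤ 1 → dG y 1 ≤ 1 →
    dGSet y (Hprime : Set SL2C) < η → ∃ ε : ℤ, (ε = 1 ∨ ε = -1) ∧
      ∀ i j, ‖y.1 i j - ε * (starRingEnd ℂ) (y.1 i j)‖ ≤ K * η := by
  refine ⟨4 * (2 * Real.exp 12), by positivity, fun y η hη1 hy hyH => ?_⟩
  obtain ⟨r, ⟨h, hh, rfl⟩, hr⟩ := exists_lt_of_csInf_lt
    (by exact ⟨_, 1, Subgroup.one_mem Hprime, rfl⟩) hyH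
  obtain ⟨c, hc, h0, h1, hl⟩ := exists_curve_of_dG_lt hr
  have hl0 := curveLength_nonneg c
  -- The exponent is `8`, from `y` being within `1` of the identity, plus `4`, from a curve of
  -- length less than `η ≤ 1`.
  have hG : frobSq (c 0).1 * Real.exp (4 * curveLength c) ≤ (2 * Real.exp 12) ^ 2 := by
    have h2 : frobSq (c 0).1 * Real.exp (4 * curveLength c) ≤ 2 * Real.exp 8 * Real.exp 4 := by
      rw [h0]
      gcongr
      · exact frobSq_le_of_dG_one hy
      · linarith
    rw [mul_assoc, ← Real.exp_add] at h2
    norm_num at h2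
    have h3 : 1 ≤ Real.exp 12 := Real.one_le_exp (by norm_num)
    nlinarith
  have hd : ∀ i j, ‖h.1 i j - y.1 i j‖ ≤ 2 * (2 * Real.exp 12) * η := by
    intro i j
    have := norm_sub_le_curveLength hc (by positivity) hG i j
    rw [h0, h1] at this
    refine this.trans ?_
    gcongr
  have hfin : ∀ ε : ℤ, (ε = 1 ∨ ε = -1) → (∀ i j, h.1 i j = ε * (starRingEnd ℂ) (h.1 i j)) →
      ∀ i j, ‖y.1 i j - ε * (starRingEnd ℂ) (y.1 i j)‖ ≤ 4 * (2 * Real.exp 12) * η := by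
    intro ε hε he i j
    -- Since `h = ε h̄`, the defect of `y` is made of two copies of `h - y`; this doubles the
    -- constant.
    have h4 : y.1 i j - ε * (starRingEnd ℂ) (y.1 i j) =
        -(h.1 i j - y.1 i j) + ε * (starRingEnd ℂ) (h.1 i j - y.1 i j) := by
      rw [map_sub]
      linear_combination he i j
    have h5 : ‖(ε : ℂ)‖ = 1 := by rcases hε with rfl | rfl <;> simp
    rw [h4]
    refine (norm_add_le _ _).trans ?_
    rw [norm_neg, norm_mul, h5, one_mul, RCLike.norm_conj]
    linarith [hd i j]
  rcases eq_or_eq_neg_conj_of_mem_Hprime hh with h4 | h4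
  · exact ⟨1, Or.inl rfl, hfin 1 (Or.inl rfl) (by simpa using h4)⟩
  · exact ⟨-1, Or.inr rfl, hfin (-1) (Or.inr rfl) (by simpa using h4)⟩

end Metric

/-! ### Identification of `B` with a quaternion algebra over `E`. -/

section QuaternionCoordinates

variable (F E : Type*) [Field F] [Field E] [Algebra F E] (a b : F)

/-- The quaternion algebra `(a, b)_E`. -/
abbrev QuatE : Type _ := QuaternionAlgebra E (algebraMap F E a) 0 (algebraMap F E b)

/-- The standard generators of `(a, b)_E`, as a quaternion basis over `F`. -/
def quatEBasis : QuaternionAlgebra.Basis (QuatE F E a b) a 0 b where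
  i := ⟨0, 1, 0, 0⟩
  j := ⟨0, 0, 1, 0⟩
  k := ⟨0, 0, 0, 1⟩
  i_mul_i := by ext <;> simp [Algebra.algebraMap_eq_smul_one]
  j_mul_j := by ext <;> simp [Algebra.algebraMap_eq_smul_one]
  i_mul_j := by ext <;> simp
  j_mul_i := by ext <;> simp

/-- The standard generators of `E ⊗ (a, b)_F`, as a quaternion basis over `E`. -/
noncomputable def quatBBasis :
    QuaternionAlgebra.Basis (QuatB F E a b) (algebraMap F E a) 0 (algebraMap F E b) where
  i := 1 ⊗ₜ ⟨0, 1, 0, 0⟩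
  j := 1 ⊗ₜ ⟨0, 0, 1, 0⟩
  k := 1 ⊗ₜ ⟨0, 0, 0, 1⟩
  i_mul_i := by
    have h : (⟨0, 1, 0, 0⟩ : QuatD F a b) * ⟨0, 1, 0, 0⟩ = a • 1 := by ext <;> simp
    rw [Algebra.TensorProduct.tmul_mul_tmul, h, ← TensorProduct.smul_tmul,
      Algebra.TensorProduct.one_def, TensorProduct.smul_tmul']
    simp [Algebra.smul_def]
  j_mul_j := by
    have h : (⟨0, 0, 1, 0⟩ : QuatD F a b) * ⟨0, 0, 1, 0⟩ = b • 1 := by ext <;> simp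
    rw [Algebra.TensorProduct.tmul_mul_tmul, h, ← TensorProduct.smul_tmul,
      Algebra.TensorProduct.one_def, TensorProduct.smul_tmul']
    simp [Algebra.smul_def]
  i_mul_j := by
    rw [Algebra.TensorProduct.tmul_mul_tmul, one_mul]
    congr 1
    ext <;> simp
  j_mul_i := by
    rw [Algebra.TensorProduct.tmul_mul_tmul, one_mul, zero_smul, zero_sub,
      ← TensorProduct.tmul_neg]
    congr 1
    ext <;> simp

/-- `E ⊗ (a, b)_F = (a, b)_E`. -/
noncomputable def quatEquiv : QuatB F E a b ≃ₐ[E] QuatE F E a b :=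
  AlgEquiv.ofAlgHom
    (Algebra.TensorProduct.lift (Algebra.ofId E (QuatE F E a b))
      (QuaternionAlgebra.lift (quatEBasis F E a b)) fun _ _ => Algebra.commutes _ _)
    (QuaternionAlgebra.lift (quatBBasis F E a b))
    (by
      apply QuaternionAlgebra.hom_ext <;> ext <;>
        simp [quatBBasis, quatEBasis, QuaternionAlgebra.Basis.lift])
    (by
      apply Algebra.TensorProduct.ext
      · ext
      · apply QuaternionAlgebra.hom_ext <;>
        simp [quatBBasis, quatEBasis, QuaternionAlgebra.Basis.lift])

theorem quatEquiv_tmul (e : E) (d : QuatD F a b) :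
    quatEquiv F E a b (e ⊗ₜ d) = ⟨e * algebraMap F E d.re, e * algebraMap F E d.imI,
      e * algebraMap F E d.imJ, e * algebraMap F E d.imK⟩ := by
  have h : quatEquiv F E a b (e ⊗ₜ d) = Algebra.ofId E (QuatE F E a b) e *
      QuaternionAlgebra.lift (quatEBasis F E a b) d := rfl
  rw [h]
  ext <;> simp [Algebra.ofId_apply, QuaternionAlgebra.Basis.lift, quatEBasis,
    Algebra.algebraMap_eq_smul_one]

theorem quatEquiv_iotaB (x : QuatB F E a b) :
    quatEquiv F E a b (iotaB F E a b x) = star (quatEquiv F E a b x) := by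
  induction x using TensorProduct.induction_on with
  | zero => simp
  | tmul e d =>
    have h1 : iotaB F E a b (e ⊗ₜ[F] d) = e ⊗ₜ[F] iotaD F a b d := rfl
    rw [h1, quatEquiv_tmul, quatEquiv_tmul]
    ext <;> simp [iotaD]
  | add x y hx hy => rw [map_add, map_add, map_add, hx, hy, star_add]

theorem quatEquiv_barB (σ : E ≃ₐ[F] E) (x : QuatB F E a b) :
    quatEquiv F E a b (barB a b σ x) = ⟨σ (quatEquiv F E a b x).re, σ (quatEquiv F E a b x).imI,
      σ (quatEquiv F E a b x).imJ, σ (quatEquiv F E a b x).imK⟩ := by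
  induction x using TensorProduct.induction_on with
  | zero => ext <;> simp
  | tmul e d =>
    have h1 : barB a b σ (e ⊗ₜ[F] d) = σ e ⊗ₜ[F] d := rfl
    rw [h1, quatEquiv_tmul, quatEquiv_tmul]
    ext <;> simp
  | add x y hx hy => rw [map_add, map_add, map_add, hx, hy]; ext <;> simp

end QuaternionCoordinates

/-! ### Quadratic extensions, and generators of division quaternion algebras. -/

theorem exists_sqrt_generator {F E : Type*} [Field F] [CharZero F] [Field E] [Algebra F E]
    (hE : Module.finrank F E = 2) {σ : E ≃ₐ[F] E} (hσ : σ ≠ AlgEquiv.refl) :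
    ∃ (e : E) (d : F), e ^ 2 = algebraMap F E d ∧ σ e = -e ∧ e ≠ 0 ∧
      ∀ z : E, ∃ x y : F, z = algebraMap F E x + algebraMap F E y * e := by
  obtain ⟨t, ht⟩ : ∃ t, σ t ≠ t := by
    by_contra! h
    exact hσ (AlgEquiv.ext h)
  have hspan : ∀ t : E, σ t ≠ t → ∀ z : E,
      ∃ x y : F, z = algebraMap F E x + algebraMap F E y * t := by
    intro t ht z
    have hli : LinearIndependent F ![(1 : E), t] := by
      rw [LinearIndependent.pair_iff]
      intro x y hxy
      have hy : y = 0 := by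
        by_contra hy
        apply ht
        have h1 : t = algebraMap F E (-x / y) := by
          have hy' : algebraMap F E y ≠ 0 := by simpa using hy
          simp only [Algebra.smul_def, mul_one] at hxy
          rw [map_div₀, eq_div_iff hy', map_neg]
          linear_combination hxy
        rw [h1, AlgEquiv.commutes]
      subst hy
      simpa using hxy
    have htop := hli.span_eq_top_of_card_eq_finrank (by simp [hE])
    have hz : z ∈ Submodule.span F (Set.range ![(1 : E), t]) := by rw [htop]; trivial
    rw [Matrix.range_cons, Matrix.range_cons, Matrix.range_empty, Set.union_empty,
      Set.singleton_union, Submodule.mem_span_pair] at hz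
    obtain ⟨x, y, rfl⟩ := hz
    exact ⟨x, y, by simp [Algebra.smul_def]⟩
  obtain ⟨q, p, hq⟩ := hspan t ht (t ^ 2)
  -- Completing the square in `t² = q + p t`.
  set e := t - algebraMap F E (p / 2) with he
  have h2 : (2 : E) ≠ 0 := by
    have := (map_ne_zero (algebraMap F E)).mpr (two_ne_zero (α := F))
    rwa [map_ofNat] at this
  have hsq : e ^ 2 = algebraMap F E (q + (p / 2) ^ 2) := by
    rw [he, map_add, map_pow, map_div₀, map_ofNat, sub_sq, hq]
    field_simp
    ring
  have hσe : σ e ≠ e := by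
    rw [he, map_sub, AlgEquiv.commutes]
    exact fun h => ht (sub_left_injective h)
  have hσe' : σ e = -e := by
    have h : σ e ^ 2 = e ^ 2 := by rw [← map_pow, hsq, AlgEquiv.commutes]
    exact (sq_eq_sq_iff_eq_or_eq_neg.mp h).resolve_left hσe
  exact ⟨e, _, hsq, hσe', by rintro h; simp [h] at hσe, hspan e hσe⟩

theorem exists_algebraMap_eq_of_fixed {F E : Type*} [Field F] [CharZero F] [Field E] [Algebra F E]
    (hE : Module.finrank F E = 2) {σ : E ≃ₐ[F] E} (hσ : σ ≠ AlgEquiv.refl) {z : E}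
    (hz : σ z = z) : ∃ x : F, algebraMap F E x = z := by
  obtain ⟨e, d, -, he, he0, h⟩ := exists_sqrt_generator hE hσ
  obtain ⟨x, y, rfl⟩ := h z
  refine ⟨x, ?_⟩
  rw [map_add, map_mul, AlgEquiv.commutes, AlgEquiv.commutes, he] at hz
  have h2 : (2 : E) ≠ 0 := by
    have := (map_ne_zero (algebraMap F E)).mpr (two_ne_zero (α := F))
    rwa [map_ofNat] at this
  have h3 : 2 * (algebraMap F E y * e) = 0 := by linear_combination -hz
  rw [(mul_eq_zero.mp h3).resolve_left h2, add_zero]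

theorem involutive_of_finrank_eq_two {F E : Type*} [Field F] [CharZero F] [Field E] [Algebra F E]
    (hE : Module.finrank F E = 2) {σ : E ≃ₐ[F] E} (hσ : σ ≠ AlgEquiv.refl) (z : E) :
    σ (σ z) = z := by
  obtain ⟨e, d, -, he, -, h⟩ := exists_sqrt_generator hE hσ
  obtain ⟨x, y, rfl⟩ := h z
  simp [he]

/-- A generator of a division quaternion algebra is not a square. -/
theorem sq_ne_of_isDivision {F K : Type*} [Field F] [Field K] [Algebra F K] {a b : F}
    (h : IsDivision (QuatB F K a b)) (s : K) :
    s ^ 2 ≠ algebraMap F K a ∧ s ^ 2 ≠ algebraMap F K b := by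
  have key : ∀ x y : QuatE F K a b, x ≠ 0 → x * y = 0 → y = 0 := by
    intro x y hx hxy
    have hu := h.2 ((quatEquiv F K a b).symm x) (by simpa using hx)
    have := hu.map (quatEquiv F K a b)
    rw [AlgEquiv.apply_symm_apply] at this
    exact this.mul_right_eq_zero.mp hxy
  constructor
  · intro hs
    -- If `s² = a = i²`, then `(s + i)(-s + i) = 0` gives zero divisors.
    have h1 := key ⟨s, 1, 0, 0⟩ ⟨-s, 1, 0, 0⟩ (fun h0 => by
      simpa using congrArg QuaternionAlgebra.imI h0) (by
        ext <;> simp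
        rw [← hs]; ring)
    simpa using congrArg QuaternionAlgebra.imI h1
  · intro hs
    have h1 := key ⟨s, 0, 1, 0⟩ ⟨-s, 0, 1, 0⟩ (fun h0 => by
      simpa using congrArg QuaternionAlgebra.imJ h0) (by
        ext <;> simp
        rw [← hs]; ring)
    simpa using congrArg QuaternionAlgebra.imJ h1

theorem conj_algebraMap {F E : Type*} [Field F] [IsTotallyReal F] [Field E] [Algebra F E]
    (ψ : E →+* ℂ) (x : F) :
    (starRingEnd ℂ) (ψ (algebraMap F E x)) = ψ (algebraMap F E x) := by
  have h := ComplexEmbedding.isReal_iff.mp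
    (IsTotallyReal.complexEmbedding_isReal (ψ.comp (algebraMap F E)))
  exact RingHom.congr_fun h x

/-! ### Coordinates on `B` and their size at the infinite places. -/

namespace QuatDatum

variable {F E : Type*} [Field F] [NumberField F] [Field E] [NumberField E] [Algebra F E]
variable (Q : QuatDatum F E)

/-- The coordinates of an element of `B` in the `E`-basis `1, i, j, k`. -/
noncomputable def coord : Q.B ≃ₗ[E] (Fin 4 → E) :=
  (quatEquiv F E Q.a Q.b).toLinearEquiv ≪≫ₗ QuaternionAlgebra.linearEquivTuple _ _ _

/-- The `E`-basis `1, i, j, k` of `B`. -/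
noncomputable def basisB (k : Fin 4) : Q.B := Q.coord.symm (Pi.single k 1)

theorem coord_apply (x : Q.B) : Q.coord x = ![(quatEquiv F E Q.a Q.b x).re,
    (quatEquiv F E Q.a Q.b x).imI, (quatEquiv F E Q.a Q.b x).imJ,
    (quatEquiv F E Q.a Q.b x).imK] := rfl

theorem coord_basisB (k : Fin 4) : Q.coord (Q.basisB k) = Pi.single k 1 := by simp [basisB]

theorem sum_coord_smul (x : Q.B) : ∑ k, Q.coord x k • Q.basisB k = x := by
  apply Q.coord.injective
  rw [map_sum]
  simp_rw [map_smul, coord_basisB]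
  ext j
  simp [Pi.single_apply]

theorem coord_bar (x : Q.B) (k : Fin 4) : Q.coord (Q.bar x) k = Q.σ (Q.coord x k) := by
  rw [coord_apply, coord_apply, quatEquiv_barB]
  fin_cases k <;> simp

theorem quatEquiv_basisB : quatEquiv F E Q.a Q.b (Q.basisB 0) = ⟨1, 0, 0, 0⟩ ∧
    quatEquiv F E Q.a Q.b (Q.basisB 1) = ⟨0, 1, 0, 0⟩ ∧
    quatEquiv F E Q.a Q.b (Q.basisB 2) = ⟨0, 0, 1, 0⟩ ∧
    quatEquiv F E Q.a Q.b (Q.basisB 3) = ⟨0, 0, 0, 1⟩ := by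
  refine ⟨?_, ?_, ?_, ?_⟩
  all_goals
    have h0 := fun k => congrFun (Q.coord_basisB k)
    simp only [coord_apply] at h0
    ext
  · simpa using h0 0 0
  · simpa using h0 0 1
  · simpa using h0 0 2
  · simpa using h0 0 3
  · simpa using h0 1 0
  · simpa using h0 1 1
  · simpa using h0 1 2
  · simpa using h0 1 3
  · simpa using h0 2 0
  · simpa using h0 2 1
  · simpa using h0 2 2
  · simpa using h0 2 3
  · simpa using h0 3 0
  · simpa using h0 3 1
  · simpa using h0 3 2
  · simpa using h0 3 3

/-! ### The complex place -/

theorem θ_smul (e : E) (x : Q.B) : Q.θ (e • x) = Q.w₀.embedding e • Q.θ x := by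
  have h : e • x = (e ⊗ₜ[F] (1 : Q.D)) * x := Algebra.smul_def e x
  rw [h, map_mul, Q.θ_E, Matrix.scalar_apply, ← Matrix.smul_eq_diagonal_mul]

theorem trace_θ (x : Q.B) : (Q.θ x).trace = 2 * Q.w₀.embedding (Q.coord x 0) := by
  have h1 : x + Q.iota x = (2 * Q.coord x 0) • (1 : Q.B) := by
    apply (quatEquiv F E Q.a Q.b).injective
    rw [map_add, map_smul, map_one, quatEquiv_iotaB, coord_apply]
    ext <;> simp
    ring
  have h2 := congrArg (fun M : Matrix (Fin 2) (Fin 2) ℂ => M 0 0) (congrArg Q.θ h1)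
  rw [map_add, Q.θ_iota, θ_smul, map_one] at h2
  simp [Matrix.adjugate_fin_two] at h2
  rw [Matrix.trace_fin_two, h2, map_ofNat]

/-- The squares of the basis `1, i, j, k`. -/
noncomputable def basisSq : Fin 4 → F := ![1, Q.a, Q.b, -(Q.a * Q.b)]

theorem basisSq_ne_zero (k : Fin 4) : Q.basisSq k ≠ 0 := by
  have := Q.a_ne_zero
  have := Q.b_ne_zero
  fin_cases k <;> simp [basisSq, *]

/-- Together with `trace_θ` this recovers every coordinate from a trace, a formula that makes sense
for all complex matrices. That is needed because `g ḡ⁻¹` does not come from `B`. -/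
theorem coord_mul_basisB_zero (x : Q.B) (k : Fin 4) :
    Q.coord (x * Q.basisB k) 0 = algebraMap F E (Q.basisSq k) * Q.coord x k := by
  obtain ⟨h0, h1, h2, h3⟩ := Q.quatEquiv_basisB
  rw [coord_apply, coord_apply, map_mul]
  fin_cases k <;> simp [basisSq, h0, h1, h2, h3]

/-- The coordinates of a complex matrix in the basis of images of `1, i, j, k`. -/
noncomputable def matCoord : Matrix (Fin 2) (Fin 2) ℂ →ₗ[ℂ] (Fin 4 → ℂ) where
  toFun M k := (2 * Q.w₀.embedding (algebraMap F E (Q.basisSq k)))⁻¹ *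
    (M * Q.θ (Q.basisB k)).trace
  map_add' M N := by
    ext k
    simp [add_mul, mul_add]
  map_smul' c M := by
    ext k
    simp
    ring

theorem matCoord_apply (M : Matrix (Fin 2) (Fin 2) ℂ) (k : Fin 4) : Q.matCoord M k =
    (2 * Q.w₀.embedding (algebraMap F E (Q.basisSq k)))⁻¹ * (M * Q.θ (Q.basisB k)).trace := rfl

theorem matCoord_θ (x : Q.B) (k : Fin 4) :
    Q.matCoord (Q.θ x) k = Q.w₀.embedding (Q.coord x k) := by
  have h : Q.w₀.embedding (algebraMap F E (Q.basisSq k)) ≠ 0 := by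
    simpa using Q.basisSq_ne_zero k
  rw [matCoord_apply, ← map_mul, trace_θ, coord_mul_basisB_zero, map_mul]
  field_simp

/-- The map sends the images of `1, i, j, k` to the standard basis, so it is onto, and both sides
have dimension four. -/
theorem matCoord_injective : Function.Injective Q.matCoord := by
  have hsurj : Function.Surjective Q.matCoord := by
    intro c
    refine ⟨∑ k, c k • Q.θ (Q.basisB k), ?_⟩
    ext j
    rw [map_sum]
    simp only [map_smul, Finset.sum_apply, Pi.smul_apply, matCoord_θ, coord_basisB, smul_eq_mul]
    simp [Pi.single_apply, apply_ite]
  exact (LinearMap.injective_iff_surjective_of_finrank_eq_finrank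
    (by simp [Module.finrank_matrix])).mpr hsurj

theorem sum_matCoord_smul (M : Matrix (Fin 2) (Fin 2) ℂ) :
    ∑ k, Q.matCoord M k • Q.θ (Q.basisB k) = M := by
  apply Q.matCoord_injective
  ext j
  rw [map_sum]
  simp only [map_smul, Finset.sum_apply, Pi.smul_apply, matCoord_θ, coord_basisB, smul_eq_mul]
  simp [Pi.single_apply, apply_ite]

theorem exists_matCoord_bound : ∃ C > (0 : ℝ), ∀ (M : Matrix (Fin 2) (Fin 2) ℂ) (K : ℝ),
    (∀ i j, ‖M i j‖ ≤ K) → ∀ k, ‖Q.matCoord M k‖ ≤ C * K := by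
  set C : Fin 4 → ℝ := fun k => ∑ i, ∑ j, ‖Q.matCoord (Matrix.single i j 1) k‖ with hC
  have hC0 : ∀ k, 0 ≤ C k := fun k => by positivity
  refine ⟨1 + ∑ k, C k, by positivity, fun M K hM k => ?_⟩
  have hK : 0 ≤ K := (norm_nonneg _).trans (hM 0 0)
  have h1 : M = ∑ i, ∑ j, M i j • Matrix.single i j (1 : ℂ) := by
    conv_lhs => rw [Matrix.matrix_eq_sum_single M]
    simp [Matrix.smul_single]
  have h2 : ‖Q.matCoord M k‖ ≤ C k * K := by
    conv_lhs => rw [h1]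
    simp only [map_sum, map_smul, Finset.sum_apply, Pi.smul_apply, smul_eq_mul]
    rw [hC, Finset.sum_mul]
    refine (norm_sum_le _ _).trans (Finset.sum_le_sum fun i _ => ?_)
    rw [Finset.sum_mul]
    refine (norm_sum_le _ _).trans (Finset.sum_le_sum fun j _ => ?_)
    rw [norm_mul, mul_comm]
    exact mul_le_mul_of_nonneg_left (hM i j) (norm_nonneg _)
  refine h2.trans (mul_le_mul_of_nonneg_right ?_ hK)
  have := Finset.single_le_sum (f := C) (fun k _ => hC0 k) (Finset.mem_univ k)
  linarith

section TotallyReal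

variable [IsTotallyReal F]

/-- The image of `e²` is real, so the image of `e` is real or purely imaginary. In the first case
all of `E` would have real image, against `w₀` being complex. -/
theorem conj_embedding_sqrt {e : E} {d : F} (hd : e ^ 2 = algebraMap F E d)
    (h : ∀ z : E, ∃ x y : F, z = algebraMap F E x + algebraMap F E y * e) :
    (starRingEnd ℂ) (Q.w₀.embedding e) = -Q.w₀.embedding e := by
  have hsq : (starRingEnd ℂ) (Q.w₀.embedding e) ^ 2 = Q.w₀.embedding e ^ 2 := by
    rw [← map_pow, ← map_pow, hd, conj_algebraMap]
  refine (sq_eq_sq_iff_eq_or_eq_neg.mp hsq).resolve_left fun h1 => ?_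
  have hc := InfinitePlace.isComplex_iff.mp Q.w₀_isComplex
  apply hc
  rw [ComplexEmbedding.isReal_iff]
  ext z
  obtain ⟨x, y, rfl⟩ := h z
  simp [ComplexEmbedding.conjugate_coe_eq, conj_algebraMap, h1]

theorem embedding_σ (hE : Module.finrank F E = 2) (z : E) :
    Q.w₀.embedding (Q.σ z) = (starRingEnd ℂ) (Q.w₀.embedding z) := by
  obtain ⟨e, d, hd, he, he0, h⟩ := exists_sqrt_generator hE Q.σ_ne
  obtain ⟨x, y, rfl⟩ := h z
  simp [conj_algebraMap, Q.conj_embedding_sqrt hd h, he]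

/-- This is how complex conjugation on `SL(2, ℂ)`, which detects `H'`, is carried to the algebraic
conjugation of `B`. -/
theorem θ_bar (hE : Module.finrank F E = 2) (x : Q.B) :
    Q.θ (Q.bar x) = (Q.θ x).map (starRingEnd ℂ) := by
  induction x using TensorProduct.induction_on with
  | zero => ext; simp
  | tmul e d =>
    have h1 : Q.bar (e ⊗ₜ[F] d) = Q.σ e ⊗ₜ[F] d := rfl
    have h2 : ∀ e : E, (e ⊗ₜ[F] d : Q.B) = e • ((1 : E) ⊗ₜ[F] d) := by
      intro e
      rw [TensorProduct.smul_tmul', smul_eq_mul, mul_one]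
    rw [h1, h2, h2 e, θ_smul, θ_smul, embedding_σ Q hE]
    ext i j
    simp [Complex.conj_eq_iff_im.mpr (Q.θ_D d i j)]
  | add x y hx hy => rw [map_add, map_add, map_add, hx, hy]; ext; simp

/-! ### The real places -/

/-- Ramification of `D` at the real place below `ψ` prevents `a` and `b` from being squares there,
so both are negative. For this the place below `ψ` has to differ from `v₀`. -/
theorem re_neg_of_mk_ne (hE : Module.finrank F E = 2) {ψ : E →+* ℂ}
    (hψ : InfinitePlace.mk ψ ≠ Q.w₀) :
    ComplexEmbedding.IsReal ψ ∧ (ψ (algebraMap F E Q.a)).re < 0 ∧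
      (ψ (algebraMap F E Q.b)).re < 0 := by
  have hreal : ComplexEmbedding.IsReal ψ := by
    by_contra hc
    exact hψ (Q.w₀_unique _ (InfinitePlace.isComplex_mk_iff.mpr hc))
  have hreal' := ComplexEmbedding.isReal_iff.mp hreal
  refine ⟨hreal, ?_⟩
  set v := (InfinitePlace.mk ψ).comap (algebraMap F E) with hv
  have hvmk : v = InfinitePlace.mk (ψ.comp (algebraMap F E)) := rfl
  have hrF := IsTotallyReal.complexEmbedding_isReal (ψ.comp (algebraMap F E))
  have hv0 : v ≠ Q.w₀.comap (algebraMap F E) := by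
    intro h
    have h1 : InfinitePlace.mk (ψ.comp (algebraMap F E)) =
        InfinitePlace.mk (Q.w₀.embedding.comp (algebraMap F E)) := by
      rw [← hvmk, h, ← InfinitePlace.comap_mk, InfinitePlace.mk_embedding]
    have h2 : ψ.comp (algebraMap F E) = Q.w₀.embedding.comp (algebraMap F E) := by
      rcases InfinitePlace.mk_eq_iff.mp h1 with h2 | h2
      · exact h2
      · rwa [ComplexEmbedding.isReal_iff.mp hrF] at h2
    -- With the same place below, `ψ e` and the image of `e` at `w₀` would be equal up to sign,
    -- although one is real and the other purely imaginary and nonzero.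
    obtain ⟨e, d, hd, he, he0, hz⟩ := exists_sqrt_generator hE Q.σ_ne
    have h3 := RingHom.congr_fun h2 d
    simp only [RingHom.comp_apply, ← hd, map_pow] at h3
    have h4 := Q.conj_embedding_sqrt hd hz
    have h5 : (starRingEnd ℂ) (ψ e) = ψ e := RingHom.congr_fun hreal' e
    have h6 : (starRingEnd ℂ) (ψ e) ≠ -ψ e := by
      rw [h5]
      intro h7
      have : ψ e = 0 := by linear_combination h7 / 2
      exact he0 ((map_eq_zero ψ).mp this)
    rcases sq_eq_sq_iff_eq_or_eq_neg.mp h3 with h7 | h7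
    · exact h6 (by rw [h7, h4])
    · exact h6 (by rw [h7, map_neg, h4])
  have hdiv := Q.D_ramified v hv0
  have hvr : v.IsReal := IsTotallyReal.isReal v
  have key : ∀ x : F, (∀ s : v.Completion, s ^ 2 ≠ algebraMap F v.Completion x) →
      (ψ (algebraMap F E x)).re < 0 := by
    intro x hx
    by_contra! h0
    obtain ⟨s, hs⟩ := InfinitePlace.Completion.surjective_extensionEmbeddingOfIsReal hvr
      (Real.sqrt (ψ (algebraMap F E x)).re)
    apply hx s
    apply (InfinitePlace.Completion.bijective_extensionEmbeddingOfIsReal hvr).1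
    rw [map_pow, hs, Real.sq_sqrt h0]
    have h1 : InfinitePlace.Completion.extensionEmbeddingOfIsReal hvr
        (algebraMap F v.Completion x) = InfinitePlace.embedding_of_isReal hvr x :=
      InfinitePlace.Completion.extensionEmbeddingOfIsReal_coe hvr _
    have h2 : (InfinitePlace.embedding_of_isReal hvr x : ℂ) = ψ (algebraMap F E x) := by
      rw [InfinitePlace.embedding_of_isReal_apply]
      have := InfinitePlace.embedding_mk_eq_of_isReal hrF
      rw [← hvmk] at this
      rw [this]; rfl
    rw [h1, ← h2, Complex.ofReal_re]
  exact ⟨key _ fun s => (sq_ne_of_isDivision hdiv s).1, key _ fun s => (sq_ne_of_isDivision hdiv s).2⟩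

/-- With `a, b < 0` the reduced norm form `x₀² - a x₁² - b x₂² + ab x₃²` is positive definite, so
its level set at `1` is compact. -/
theorem exists_coord_bound_of_mk_ne (hE : Module.finrank F E = 2) {ψ : E →+* ℂ}
    (hψ : InfinitePlace.mk ψ ≠ Q.w₀) :
    ∃ C : ℝ, ∀ γ ∈ Q.GF, ∀ k, ‖ψ (Q.coord (γ : Q.B) k)‖ ≤ C := by
  obtain ⟨hr, ha, hb⟩ := Q.re_neg_of_mk_ne hE hψ
  set f := hr.embedding with hf
  have hψf : ∀ x, ψ x = (f x : ℂ) := fun x => (hr.coe_embedding_apply x).symm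
  set α := f (algebraMap F E Q.a) with hα
  set β := f (algebraMap F E Q.b) with hβ
  rw [hψf, Complex.ofReal_re, ← hα] at ha
  rw [hψf, Complex.ofReal_re, ← hβ] at hb
  have hab : 0 < α * β := mul_pos_of_neg_of_neg ha hb
  refine ⟨1 + (-α)⁻¹ + (-β)⁻¹ + (α * β)⁻¹, fun γ hγ k => ?_⟩
  have h1 : (γ : Q.B) * Q.iota γ = 1 := hγ
  have h2 := congrArg QuaternionAlgebra.re (congrArg (quatEquiv F E Q.a Q.b) h1)
  rw [map_mul, quatEquiv_iotaB, map_one] at h2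
  simp only [QuaternionAlgebra.re_mul, QuaternionAlgebra.re_star, QuaternionAlgebra.imI_star,
    QuaternionAlgebra.imJ_star, QuaternionAlgebra.imK_star, QuaternionAlgebra.re_one] at h2
  have h3 := congrArg f h2
  simp only [map_add, map_mul, map_neg, map_sub, map_zero, map_one, ← hα, ← hβ] at h3
  rw [hψf, Complex.norm_real, Real.norm_eq_abs, coord_apply]
  set x0 := f (quatEquiv F E Q.a Q.b γ).re
  set x1 := f (quatEquiv F E Q.a Q.b γ).imI
  set x2 := f (quatEquiv F E Q.a Q.b γ).imJ
  set x3 := f (quatEquiv F E Q.a Q.b γ).imK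
  have e0 := sq_nonneg x0
  have e1 : 0 ≤ -α * x1 ^ 2 := mul_nonneg (by linarith) (sq_nonneg _)
  have e2 : 0 ≤ -β * x2 ^ 2 := mul_nonneg (by linarith) (sq_nonneg _)
  have e3 : 0 ≤ (α * β) * x3 ^ 2 := mul_nonneg hab.le (sq_nonneg _)
  have i1 : 0 < (-α)⁻¹ := inv_pos.mpr (by linarith)
  have i2 : 0 < (-β)⁻¹ := inv_pos.mpr (by linarith)
  have i3 : 0 < (α * β)⁻¹ := inv_pos.mpr hab
  have key : ∀ t x : ℝ, 0 < t → t * x ^ 2 ≤ 1 → |x| ≤ 1 + t⁻¹ := by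
    intro t x ht h
    have h4 : x ^ 2 ≤ t⁻¹ := by
      rw [← one_div, le_div_iff₀ ht]; linarith
    apply abs_le_of_sq_le_sq _ (by positivity)
    have := inv_pos.mpr ht
    nlinarith
  have hsum : x0 ^ 2 + -α * x1 ^ 2 + -β * x2 ^ 2 + α * β * x3 ^ 2 = 1 := by
    linear_combination h3
  fin_cases k
  · have := key 1 x0 one_pos (by linarith)
    have h5 : |x0| ≤ 1 := by
      rw [← sq_le_one_iff_abs_le_one]; linarith
    change |x0| ≤ _
    linarith
  · have := key _ x1 (neg_pos.mpr ha) (by linarith)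
    change |x1| ≤ _
    linarith
  · have := key _ x2 (neg_pos.mpr hb) (by linarith)
    change |x2| ≤ _
    linarith
  · have := key _ x3 hab (by linarith)
    change |x3| ≤ _
    linarith

/-- The coordinates of the elements of `G(F)` in a bounded part of `SL(2, ℂ)` are bounded at all
infinite places. -/
theorem exists_coord_bound (hE : Module.finrank F E = 2) (K : ℝ) :
    ∃ C > (0 : ℝ), ∀ γ ∈ Q.GF, (∀ i j, ‖Q.θ (γ : Q.B) i j‖ ≤ K) →
      ∀ (ψ : E →+* ℂ) (k : Fin 4), ‖ψ (Q.coord (γ : Q.B) k)‖ ≤ C := by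
  have key : ∀ ψ : E →+* ℂ, ∃ C > (0 : ℝ), ∀ γ ∈ Q.GF, (∀ i j, ‖Q.θ (γ : Q.B) i j‖ ≤ K) →
      ∀ k : Fin 4, ‖ψ (Q.coord (γ : Q.B) k)‖ ≤ C := by
    intro ψ
    by_cases hψ : InfinitePlace.mk ψ = Q.w₀
    · obtain ⟨C, hC, h⟩ := Q.exists_matCoord_bound
      refine ⟨C * |K| + 1, by positivity, fun γ hγ hK k => ?_⟩
      have h1 := h _ K hK k
      rw [matCoord_θ, InfinitePlace.norm_embedding_eq, ← hψ, InfinitePlace.apply] at h1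
      have := mul_le_mul_of_nonneg_left (le_abs_self K) hC.le
      linarith
    · obtain ⟨C, h⟩ := Q.exists_coord_bound_of_mk_ne hE hψ
      exact ⟨|C| + 1, by positivity, fun γ hγ _ k =>
        (h γ hγ k).trans ((le_abs_self C).trans (by linarith))⟩
  choose C hC h using key
  refine ⟨1 + ∑ ψ, C ψ, by
    have := Finset.sum_nonneg fun ψ (_ : ψ ∈ Finset.univ) => (hC ψ).le
    linarith, fun γ hγ hK ψ k => (h ψ γ hγ hK k).trans ?_⟩
  have := Finset.single_le_sum (f := C) (fun ψ _ => (hC ψ).le) (Finset.mem_univ ψ)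
  linarith

end TotallyReal

end QuatDatum

/-! ### The completed order at a finite place and its image under an adapted isomorphism. -/

theorem Submodule.mul_mem_span_of_mul_mem {R A : Type*} [CommSemiring R] [Semiring A] [Algebra R A]
    {S : Set A} (hS : ∀ x ∈ S, ∀ y ∈ S, x * y ∈ S) {x y : A} (hx : x ∈ Submodule.span R S)
    (hy : y ∈ Submodule.span R S) : x * y ∈ Submodule.span R S := by
  have h := Submodule.mul_mem_mul hx hy
  rw [Submodule.span_mul_span] at h
  refine Submodule.span_mono ?_ h
  rintro _ ⟨x, hx, y, hy, rfl⟩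
  exact hS x hx y hy

namespace QuatDatum

variable {F E : Type*} [Field F] [NumberField F] [Field E] [NumberField E] [Algebra F E]
variable (Q : QuatDatum F E) (v : HeightOneSpectrum (𝓞 F)) (O : Subalgebra (𝓞 F) Q.B)

theorem toBv_smul_int (r : 𝓞 F) (x : Q.B) :
    Q.toBv v (r • x) = algebraMap (𝓞 F) (v.adicCompletionIntegers F) r • Q.toBv v x := by
  have h1 : r • x = (algebraMap (𝓞 F) F r) • x := (algebraMap_smul F r x).symm
  rw [h1, map_smul, ← algebraMap_smul (v.adicCompletion F) (algebraMap (𝓞 F) F r)]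
  rfl

theorem toBv_mem_orderv {x : Q.B} (hx : x ∈ O) : Q.toBv v x ∈ Q.orderv v O :=
  Submodule.subset_span ⟨x, hx, rfl⟩

theorem one_mem_orderv : (1 : Q.Bv v) ∈ Q.orderv v O := by
  exact Q.toBv_mem_orderv v O O.one_mem

theorem mul_mem_orderv {x y : Q.Bv v} (hx : x ∈ Q.orderv v O) (hy : y ∈ Q.orderv v O) :
    x * y ∈ Q.orderv v O := by
  have hS : ∀ x ∈ Q.toBv v '' (O : Set Q.B), ∀ y ∈ Q.toBv v '' (O : Set Q.B),
      x * y ∈ Q.toBv v '' (O : Set Q.B) := by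
    rintro _ ⟨x, hx, rfl⟩ _ ⟨y, hy, rfl⟩
    exact ⟨x * y, O.mul_mem hx hy, (Q.toBv v).map_mul x y⟩
  have h := Submodule.mul_mem_span_of_mul_mem (R := v.adicCompletionIntegers F) (A := Q.Bv v)
    hS (x := x) (y := y)
  exact h hx hy

variable {O} in
theorem orderv_fg (hO : Q.IsOrder O) : (Q.orderv v O).FG := by
  obtain ⟨s, hs⟩ := Module.finite_def.mp hO.1
  classical
  refine ⟨s.image fun x : O => Q.toBv v x, ?_⟩
  unfold orderv
  apply le_antisymm
  · apply Submodule.span_mono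
    intro _ h
    simp only [Finset.coe_image, Set.mem_image, Finset.mem_coe] at h
    obtain ⟨x, -, rfl⟩ := h
    exact ⟨x, x.2, rfl⟩
  · rw [Submodule.span_le]
    rintro _ ⟨x, hx, rfl⟩
    have h : ∀ y : O, y ∈ Submodule.span (𝓞 F) (s : Set O) → Q.toBv v y ∈
        Submodule.span (v.adicCompletionIntegers F)
          ((s.image fun x : O => Q.toBv v x : Finset (Q.Bv v)) : Set (Q.Bv v)) := by
      intro y hy
      induction hy using Submodule.span_induction with
      | mem y hy => exact Submodule.subset_span (Finset.mem_coe.mpr (Finset.mem_image_of_mem _ hy))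
      | zero => simp
      | add y z _ _ hy hz =>
        rw [Subalgebra.coe_add, map_add]
        exact add_mem hy hz
      | smul r y _ hy =>
        have h := Q.toBv_smul_int v r (y : Q.B)
        rw [Subalgebra.coe_smul]
        exact h ▸ Submodule.smul_mem _ _ hy
    exact h ⟨x, hx⟩ (by rw [hs]; trivial)

variable {O} in
theorem isIntegral_of_mem_orderv (hO : Q.IsOrder O) {x : Q.Bv v} (hx : x ∈ Q.orderv v O) :
    IsIntegral (v.adicCompletionIntegers F) x := by
  let S : Subalgebra (v.adicCompletionIntegers F) (Q.Bv v) :=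
    (Q.orderv v O).toSubalgebra (Q.one_mem_orderv v O) fun _ _ => Q.mul_mem_orderv v O
  refine IsIntegral.of_mem_of_fg S ?_ x hx
  have : Subalgebra.toSubmodule S = Q.orderv v O := Submodule.toSubalgebra_toSubmodule ..
  rw [this]
  exact Q.orderv_fg v hO

section Adapted

variable {Q v O}
variable {α : Q.Bv v ≃ₐ[v.adicCompletion F] (M2v v × M2v v)}

theorem IsAdapted.symm_mem_of_SL2 (hα : Q.IsAdapted v O α) {S T : M2v v} (hS : S ∈ SL2Ov v)
    (hT : T ∈ SL2Ov v) : α.symm (S, T) ∈ Q.orderv v O := by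
  have h : (S, T) ∈ α '' Q.normOneOrderv v O := by
    rw [hα.image_K]; exact ⟨hS, hT⟩
  obtain ⟨x, hx, hx'⟩ := h
  rw [← hx', AlgEquiv.symm_apply_apply]
  exact hx.2

/-- Only the norm-one elements of the order are known to correspond to `SL(2, 𝓞_v)²`. Off the
diagonal, a matrix unit is the difference of a unipotent and the identity; on the diagonal it is a
product of two off-diagonal units. -/
theorem IsAdapted.symm_single_mem (hα : Q.IsAdapted v O α) (i j : Fin 2) :
    α.symm (Matrix.single i j 1, 0) ∈ Q.orderv v O ∧
      α.symm (0, Matrix.single i j 1) ∈ Q.orderv v O := by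
  have hone : (1 : M2v v) ∈ SL2Ov v := ⟨fun i j => by
    rw [Matrix.one_apply]
    split_ifs
    · exact one_mem _
    · exact zero_mem _, Matrix.det_one⟩
  have hu : ∀ i j : Fin 2, i ≠ j → 1 + Matrix.single i j 1 ∈ SL2Ov v := by
    intro i j hij
    refine ⟨fun k l => ?_, ?_⟩
    · rw [Matrix.add_apply, Matrix.one_apply, Matrix.single_apply]
      apply add_mem
      · split_ifs
        · exact one_mem _
        · exact zero_mem _
      · split_ifs
        · exact one_mem _
        · exact zero_mem _
    · fin_cases i <;> fin_cases j <;> simp [Matrix.det_fin_two] at hij ⊢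
  have hoff : ∀ i j : Fin 2, i ≠ j → α.symm (Matrix.single i j 1, 0) ∈ Q.orderv v O ∧
      α.symm (0, Matrix.single i j 1) ∈ Q.orderv v O := by
    intro i j hij
    constructor
    · have h1 := sub_mem (hα.symm_mem_of_SL2 (hu i j hij) hone) (hα.symm_mem_of_SL2 hone hone)
      rw [← map_sub] at h1
      simpa using h1
    · have h1 := sub_mem (hα.symm_mem_of_SL2 hone (hu i j hij)) (hα.symm_mem_of_SL2 hone hone)
      rw [← map_sub] at h1
      simpa using h1
  by_cases hij : i = j
  · subst hij
    obtain ⟨k, hk⟩ : ∃ k : Fin 2, i ≠ k := ⟨1 - i, by fin_cases i <;> decide⟩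
    have h1 := Q.mul_mem_orderv v O (hoff i k hk).1 (hoff k i hk.symm).1
    have h2 := Q.mul_mem_orderv v O (hoff i k hk).2 (hoff k i hk.symm).2
    rw [← map_mul] at h1 h2
    simp only [Prod.mk_mul_mk, Matrix.single_mul_single_same, mul_one, mul_zero] at h1 h2
    exact ⟨h1, h2⟩
  · exact hoff i j hij

theorem IsAdapted.symm_mem (hα : Q.IsAdapted v O α) {S T : M2v v} (hS : S ∈ M2Ov v)
    (hT : T ∈ M2Ov v) : α.symm (S, T) ∈ Q.orderv v O := by
  have hsum : ((S, T) : M2v v × M2v v) =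
      ∑ i, ∑ j, (S i j • ((Matrix.single i j 1, 0) : M2v v × M2v v) +
        T i j • ((0, Matrix.single i j 1) : M2v v × M2v v)) := by
    rw [Prod.ext_iff]
    constructor
    · rw [Prod.fst_sum]
      simp_rw [Prod.fst_sum]
      conv_lhs => rw [Matrix.matrix_eq_sum_single S]
      simp [Matrix.smul_single]
    · rw [Prod.snd_sum]
      simp_rw [Prod.snd_sum]
      conv_lhs => rw [Matrix.matrix_eq_sum_single T]
      simp [Matrix.smul_single]
  rw [hsum, map_sum]
  refine sum_mem fun i _ => ?_
  rw [map_sum]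
  refine sum_mem fun j _ => ?_
  rw [map_add, map_smul, map_smul]
  exact add_mem (Submodule.smul_mem _ (⟨S i j, hS i j⟩ : v.adicCompletionIntegers F)
      (hα.symm_single_mem i j).1)
    (Submodule.smul_mem _ (⟨T i j, hT i j⟩ : v.adicCompletionIntegers F)
      (hα.symm_single_mem i j).2)

/-- Multiplying by matrix units on both sides isolates an entry of the first component as a scalar
lying in the completed order. That order is a finitely generated module, so the scalar is integral
over `𝓞_v`, which is integrally closed. -/
theorem IsAdapted.fst_mem (hα : Q.IsAdapted v O α) (hO : Q.IsOrder O) {x : Q.Bv v}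
    (hx : x ∈ Q.orderv v O) : (α x).1 ∈ M2Ov v := by
  intro i j
  have h1 : α.symm (Matrix.scalar (Fin 2) ((α x).1 i j), 0) ∈ Q.orderv v O := by
    have h2 : ((Matrix.scalar (Fin 2) ((α x).1 i j), 0) : M2v v × M2v v) =
        ∑ k, (Matrix.single k i 1, 0) * α x * (Matrix.single j k 1, 0) := by
      rw [Prod.ext_iff]
      constructor
      · rw [Prod.fst_sum]
        ext k l
        fin_cases k <;> fin_cases l <;>
          simp [Fin.sum_univ_two, Matrix.single_mul_mul_single]
      · rw [Prod.snd_sum]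
        simp
    rw [h2, map_sum]
    refine sum_mem fun k _ => ?_
    rw [map_mul, map_mul, AlgEquiv.symm_apply_apply]
    exact Q.mul_mem_orderv v O (Q.mul_mem_orderv v O (hα.symm_single_mem k i).1 hx)
      (hα.symm_single_mem j k).1
  have h2 := Q.isIntegral_of_mem_orderv v hO h1
  have h3 := h2.map (α.toAlgHom)
  have h4 := h3.map (AlgHom.fst (v.adicCompletion F) (M2v v) (M2v v))
  have h5 : IsIntegral (v.adicCompletionIntegers F)
      (algebraMap (v.adicCompletion F) (M2v v) ((α x).1 i j)) := by
    have h6 : α (α.symm (Matrix.scalar (Fin 2) ((α x).1 i j), 0)) =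
      (Matrix.scalar (Fin 2) ((α x).1 i j), 0) := α.apply_symm_apply _
    have h7 : (α (α.symm (Matrix.scalar (Fin 2) ((α x).1 i j), 0))).1 =
      algebraMap (v.adicCompletion F) (M2v v) ((α x).1 i j) := by rw [h6]; rfl
    rw [← h7]
    exact h4
  rw [isIntegral_algebraMap_iff (FaithfulSMul.algebraMap_injective _ _)] at h5
  obtain ⟨y, hy⟩ := IsIntegrallyClosed.isIntegral_iff.mp h5
  rw [← hy]
  exact y.2

end Adapted

end QuatDatum

/-! ### Integrality in the local double cosets. -/

namespace QuatDatum

variable {F E : Type*} [Field F] [NumberField F] [Field E] [NumberField E] [Algebra F E]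

section Matrices

variable {v : HeightOneSpectrum (𝓞 F)}

theorem mul_mem_M2Ov {S T : M2v v} (hS : S ∈ M2Ov v) (hT : T ∈ M2Ov v) : S * T ∈ M2Ov v := by
  intro i j
  rw [Matrix.mul_apply]
  exact sum_mem fun k _ => mul_mem (hS i k) (hT k j)

theorem smul_mem_M2Ov {c : v.adicCompletion F} {T : M2v v}
    (hc : c ∈ v.adicCompletionIntegers F) (hT : T ∈ M2Ov v) : c • T ∈ M2Ov v :=
  fun i j => mul_mem hc (hT i j)

theorem adjugate_mem_M2Ov {T : M2v v} (hT : T ∈ M2Ov v) : T.adjugate ∈ M2Ov v := by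
  intro i j
  rw [Matrix.adjugate_fin_two]
  fin_cases i <;> fin_cases j
  · exact hT 1 1
  · exact neg_mem (hT 0 1)
  · exact neg_mem (hT 1 0)
  · exact hT 0 0

theorem mem_M2Ov_of_mem_doubleCoset_zero {T : M2v v} (hT : T ∈ doubleCoset v 0) :
    T ∈ M2Ov v := by
  obtain ⟨ϖ, -, k, hk, k', hk', rfl⟩ := hT
  refine mul_mem_M2Ov (mul_mem_M2Ov hk.1 ?_) hk'.1
  intro i j
  fin_cases i <;> fin_cases j <;> simp

/-- The only denominator in the double coset is `ϖ^m`, and `x` is a multiple of `ϖ^m` in `𝓞_v`. -/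
theorem smul_mem_M2Ov_of_mem_doubleCoset {T : M2v v} {m : ℕ} (hT : T ∈ doubleCoset v m)
    {x : 𝓞 F} (hx : x ∈ v.asIdeal ^ m) :
    algebraMap F (v.adicCompletion F) x • T ∈ M2Ov v := by
  obtain ⟨ϖ, hϖ, k, hk, k', hk', rfl⟩ := hT
  have hle : v.asIdeal ≤ (IsLocalRing.maximalIdeal (v.adicCompletionIntegers F)).comap
      (algebraMap (𝓞 F) (v.adicCompletionIntegers F)) := by
    intro y hy
    rw [Ideal.mem_comap, IsLocalRing.mem_maximalIdeal, mem_nonunits_iff,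
      HeightOneSpectrum.adicCompletionIntegers.isUnit_iff_valued_eq_one]
    have h1 : Valued.v ((algebraMap (𝓞 F) (v.adicCompletionIntegers F) y :
        v.adicCompletion F)) = v.valuation F (algebraMap (𝓞 F) F y) :=
      HeightOneSpectrum.valuedAdicCompletion_eq_valuation v y
    rw [h1]
    exact ((v.valuation_lt_one_iff_mem (K := F) y).mpr hy).ne
  have hx' : algebraMap (𝓞 F) (v.adicCompletionIntegers F) x ∈
      IsLocalRing.maximalIdeal (v.adicCompletionIntegers F) ^ m := by
    have h1 := (Ideal.pow_right_mono hle m).trans (Ideal.le_comap_pow _ m)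
    exact h1 hx
  rw [hϖ.maximalIdeal_eq, Ideal.span_singleton_pow, Ideal.mem_span_singleton] at hx'
  obtain ⟨c, hc⟩ := hx'
  have hc' : algebraMap F (v.adicCompletion F) x = (ϖ : v.adicCompletion F) ^ m * c := by
    have h1 : ((ϖ ^ m * c : v.adicCompletionIntegers F) : v.adicCompletion F) = ϖ ^ m * c := by
      simp
    exact (congrArg Subtype.val hc).trans h1
  have hϖ0 : (ϖ : v.adicCompletion F) ≠ 0 := by
    simpa using hϖ.ne_zero
  rw [← smul_mul_assoc, ← mul_smul_comm]
  refine mul_mem_M2Ov (mul_mem_M2Ov hk.1 ?_) hk'.1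
  rw [hc']
  intro i j
  have hp : (ϖ : v.adicCompletion F) ^ m ∈ v.adicCompletionIntegers F := pow_mem ϖ.2 m
  fin_cases i <;> fin_cases j
  · simpa using mul_mem (mul_mem hp c.2) hp
  · simp
  · simp
  · have h1 : (ϖ : v.adicCompletion F) ^ m * c * ((ϖ : v.adicCompletion F) ^ m)⁻¹ = c := by
      field_simp
    simp [h1]

/-- The outer factors are invertible over `𝓞_v`, so integrality would pass to the diagonal matrix
and make `ϖ^(-m)` integral. -/
theorem notMem_M2Ov_of_mem_doubleCoset {T : M2v v} {m : ℕ} (hm : m ≠ 0)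
    (hT : T ∈ doubleCoset v m) : T ∉ M2Ov v := by
  obtain ⟨ϖ, hϖ, k, hk, k', hk', rfl⟩ := hT
  intro h
  set d := Matrix.diagonal ![(ϖ : v.adicCompletion F) ^ (m : ℤ),
    (ϖ : v.adicCompletion F) ^ (-(m : ℤ))] with hd
  have h1 : d = k.adjugate * (k * d * k') * k'.adjugate := by
    have e1 : k.adjugate * k = 1 := by rw [Matrix.adjugate_mul, hk.2, one_smul]
    have e2 : k' * k'.adjugate = 1 := by rw [Matrix.mul_adjugate, hk'.2, one_smul]
    calc d = (k.adjugate * k) * d * (k' * k'.adjugate) := by rw [e1, e2, one_mul, mul_one]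
      _ = _ := by simp only [mul_assoc]
  have h2 : d ∈ M2Ov v := by
    rw [h1]
    exact mul_mem_M2Ov (mul_mem_M2Ov (adjugate_mem_M2Ov hk.1) h) (adjugate_mem_M2Ov hk'.1)
  have h3 := h2 1 1
  have h4 : d 1 1 = ((ϖ : v.adicCompletion F) ^ m)⁻¹ := by simp [hd]
  rw [h4] at h3
  have hϖ0 : (ϖ : v.adicCompletion F) ≠ 0 := by
    simpa using hϖ.ne_zero
  have h5 : IsUnit (ϖ ^ m) := by
    refine IsUnit.of_mul_eq_one ⟨_, h3⟩ ?_
    ext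
    simp [hϖ0]
  exact hϖ.not_isUnit ((isUnit_pow_iff hm).mp h5)

end Matrices

end QuatDatum

namespace LevelDatum

open QuatDatum

variable {F E : Type*} [Field F] [NumberField F] [Field E] [NumberField E] [Algebra F E]
  {Q : QuatDatum F E} (L : LevelDatum Q)

/-- The elements of `K(𝔫)` are integral at all finite places up to multiplication by `𝔫`. -/
theorem smul_mem_orderv_of_mem_Kn {𝔫 : Ideal (𝓞 F)} {v : HeightOneSpectrum (𝓞 F)}
    {u : (Q.Bv v)ˣ} (hu : u ∈ L.Kn 𝔫 v) {x : 𝓞 F} (hx : x ∈ 𝔫) :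
    algebraMap F (v.adicCompletion F) x • (u : Q.Bv v) ∈ Q.orderv v L.OB := by
  unfold Kn at hu
  split_ifs at hu with hv
  · obtain ⟨h1, h2⟩ : (L.α v hv u).1 ∈ doubleCoset v (multiplicity v.asIdeal 𝔫) ∧
        (L.α v hv u).2 ∈ doubleCoset v 0 := hu
    -- For `𝔫 = 0` the multiplicity has the default value `1`, and the divisibility still holds.
    have hx' : x ∈ v.asIdeal ^ multiplicity v.asIdeal 𝔫 :=
      Ideal.le_of_dvd (pow_multiplicity_dvd _ _) hx
    have h3 := smul_mem_M2Ov_of_mem_doubleCoset h1 hx'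
    have h4 := smul_mem_M2Ov (v.coe_mem_adicCompletionIntegers (K := F) x)
      (mem_M2Ov_of_mem_doubleCoset_zero h2)
    have h5 := (L.α_adapted v hv).symm_mem h3 h4
    have h6 : algebraMap F (v.adicCompletion F) x • (u : Q.Bv v) =
        (L.α v hv).symm (algebraMap F (v.adicCompletion F) x • (L.α v hv u).1,
          algebraMap F (v.adicCompletion F) x • (L.α v hv u).2) := by
      apply (L.α v hv).injective
      rw [AlgEquiv.apply_symm_apply, map_smul]
      rfl
    rw [h6]
    exact h5
  · have h1 : (u : Q.Bv v) ∈ Q.orderv v L.OB := by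
      by_cases hS : v ∈ L.S
      · have h2 := L.K_mem v hS u hu 1 (Q.one_mem_orderv v L.OB)
        exact (mul_one (u : Q.Bv v)) ▸ h2
      · exact ((L.K_not_mem v hS u).mp hu).2
    exact Submodule.smul_mem _ (algebraMap (𝓞 F) (v.adicCompletionIntegers F) x) h1

end LevelDatum

/-! ### Bounded denominators, from local to global. -/

theorem NumberField.isAlgebraic_int (K : Type*) [Field K] [NumberField K] :
    Algebra.IsAlgebraic ℤ K :=
  (IsFractionRing.comap_isAlgebraic_iff (A := ℤ) (K := ℚ) (C := K)).mpr inferInstance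

theorem NumberField.exists_int_mul_isIntegral {K : Type*} [Field K] [NumberField K]
    (s : Finset K) : ∃ N : ℤ, N ≠ 0 ∧ ∀ x ∈ s, IsIntegral ℤ ((N : K) * x) := by
  have := isAlgebraic_int K
  obtain ⟨N, hN0, hN⟩ := Algebra.IsAlgebraic.exists_integral_multiples ℤ s
  exact ⟨N, hN0, fun x hx => by simpa using hN x hx⟩

namespace QuatDatum

variable {F E : Type*} [Field F] [NumberField F] [Field E] [NumberField E] [Algebra F E]
variable (Q : QuatDatum F E) {O : Subalgebra (𝓞 F) Q.B}

/-- A linear functional has bounded denominators on the elements of `B` that are integral at all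
finite places. -/
theorem exists_int_mul_functional_isIntegral (hO : Q.IsOrder O) (ℓ : Q.B →ₗ[F] F) :
    ∃ N : ℤ, N ≠ 0 ∧ ∀ x : Q.B, (∀ v, Q.toBv v x ∈ Q.orderv v O) →
      IsIntegral ℤ ((N : F) * ℓ x) := by
  obtain ⟨s, hs⟩ := Module.finite_def.mp hO.1
  classical
  obtain ⟨N, hN0, hN⟩ := exists_int_mul_isIntegral
    (s.image fun y : O => ℓ y)
  refine ⟨N, hN0, fun x hx => ?_⟩
  -- One `N` clears the values on finitely many generators, hence on the whole order. The bound
  -- passes to each completed order by `𝓞_v`-linearity, and integrality at every finite place gives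
  -- global integrality.
  have hO' : ∀ y : O, IsIntegral ℤ ((N : F) * ℓ y) := by
    intro y
    have hy : y ∈ Submodule.span (𝓞 F) (s : Set O) := by rw [hs]; trivial
    induction hy using Submodule.span_induction with
    | mem y hy =>
      exact hN _ (Finset.mem_image_of_mem _ hy)
    | zero => simp [isIntegral_zero]
    | add y z _ _ hy hz =>
      rw [Subalgebra.coe_add, map_add, mul_add]
      exact hy.add hz
    | smul r y _ hy =>
      have h1 : ((r • y : O) : Q.B) = (algebraMap (𝓞 F) F r) • (y : Q.B) :=
        (algebraMap_smul F r (y : Q.B)).symm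
      rw [h1, map_smul, smul_eq_mul, mul_left_comm]
      exact (RingOfIntegers.isIntegral_coe r).mul hy
  have hval : ∀ v : HeightOneSpectrum (𝓞 F), v.valuation F ((N : F) * ℓ x) ≤ 1 := by
    intro v
    let ℓv : Q.Bv v →ₗ[v.adicCompletion F] v.adicCompletion F :=
      (Algebra.TensorProduct.rid F (v.adicCompletion F) (v.adicCompletion F)).toLinearMap ∘ₗ
        ℓ.baseChange (v.adicCompletion F)
    have hℓ : ∀ y, ℓv (Q.toBv v y) = algebraMap F (v.adicCompletion F) (ℓ y) := by
      intro y
      change Algebra.TensorProduct.rid F (v.adicCompletion F) (v.adicCompletion F)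
        (ℓ.baseChange (v.adicCompletion F) (1 ⊗ₜ[F] y)) = _
      rw [LinearMap.baseChange_tmul, Algebra.TensorProduct.rid_tmul, Algebra.algebraMap_eq_smul_one]
    have hmem : ∀ y ∈ Q.orderv v O,
        algebraMap F (v.adicCompletion F) N * ℓv y ∈ v.adicCompletionIntegers F := by
      intro y hy
      induction hy using Submodule.span_induction with
      | mem y hy =>
        obtain ⟨y, hy, rfl⟩ := hy
        rw [hℓ, ← map_mul]
        exact v.coe_mem_adicCompletionIntegers (K := F) ⟨_, hO' ⟨y, hy⟩⟩
      | zero => rw [map_zero, mul_zero]; exact zero_mem _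
      | add y z _ _ hy hz => rw [map_add, mul_add]; exact add_mem hy hz
      | smul r y _ hy =>
        have h1 : ℓv (r • y) = (r : v.adicCompletion F) * ℓv y := ℓv.map_smul (r : _) y
        rw [h1, mul_left_comm]
        exact mul_mem r.2 hy
    have h1 := hmem _ (hx v)
    rw [hℓ, ← map_mul, HeightOneSpectrum.mem_adicCompletionIntegers] at h1
    have h2 := HeightOneSpectrum.valuedAdicCompletion_eq_valuation' v ((N : F) * ℓ x)
    exact h2 ▸ h1
  obtain ⟨z, hz⟩ := HeightOneSpectrum.mem_integers_of_valuation_le_one F _ hval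
  rw [← hz]
  exact RingOfIntegers.isIntegral_coe z

/-- The coordinates of the elements of `B` that are integral at all finite places have bounded
denominators. -/
theorem exists_int_mul_coord_isIntegral (hO : Q.IsOrder O) :
    ∃ N : ℤ, N ≠ 0 ∧ ∀ x : Q.B, (∀ v, Q.toBv v x ∈ Q.orderv v O) →
      ∀ k, IsIntegral ℤ ((N : E) * Q.coord x k) := by
  classical
  let ω := Module.finBasis F E
  obtain ⟨N', hN'0, hN'⟩ := exists_int_mul_isIntegral
    (Finset.univ.image ω)
  let ℓ : Fin 4 → Fin (Module.finrank F E) → Q.B →ₗ[F] F := fun k i =>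
    ω.coord i ∘ₗ (LinearMap.proj k : (Fin 4 → E) →ₗ[F] E) ∘ₗ
      (Q.coord.toLinearMap.restrictScalars F)
  choose N hN0 hN using fun k i => Q.exists_int_mul_functional_isIntegral hO (ℓ k i)
  refine ⟨N' * ∏ k, ∏ i, N k i, mul_ne_zero hN'0 (Finset.prod_ne_zero_iff.mpr fun k _ =>
    Finset.prod_ne_zero_iff.mpr fun i _ => hN0 k i), fun x hx k => ?_⟩
  have hsum : Q.coord x k = ∑ i, algebraMap F E (ℓ k i x) * ω i := by
    conv_lhs => rw [← ω.sum_repr (Q.coord x k)]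
    exact Finset.sum_congr rfl fun i _ => Algebra.smul_def _ _
  rw [hsum, Finset.mul_sum]
  refine IsIntegral.sum _ fun i _ => ?_
  obtain ⟨m, hm⟩ : N k i ∣ ∏ k, ∏ i, N k i :=
    (Finset.dvd_prod_of_mem _ (Finset.mem_univ i)).trans
      (Finset.dvd_prod_of_mem (fun k => ∏ i, N k i) (Finset.mem_univ k))
  rw [hm]
  have h1 : IsIntegral ℤ (algebraMap F E ((N k i : F) * ℓ k i x)) := (hN k i x hx).algebraMap
  have h2 := hN' _ (Finset.mem_image_of_mem ω (Finset.mem_univ i))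
  have h3 : IsIntegral ℤ (m : E) := isIntegral_algebraMap (R := ℤ) (x := m)
  have h4 := (h3.mul h1).mul h2
  convert h4 using 1
  rw [map_mul, map_intCast]
  push_cast
  ring

theorem exists_int_smul_mem_order (hO : Q.IsOrder O) (x : Q.B) :
    ∃ N : ℤ, N ≠ 0 ∧ N • x ∈ O := by
  have hx : x ∈ Submodule.span F (O : Set Q.B) := by rw [hO.2]; trivial
  induction hx using Submodule.span_induction with
  | mem y hy => exact ⟨1, one_ne_zero, by rwa [one_smul]⟩
  | zero => exact ⟨1, one_ne_zero, by rw [smul_zero]; exact zero_mem O⟩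
  | add y z _ _ hy hz =>
    obtain ⟨M, hM0, hM⟩ := hy
    obtain ⟨N, hN0, hN⟩ := hz
    refine ⟨M * N, mul_ne_zero hM0 hN0, ?_⟩
    rw [smul_add, mul_smul, mul_comm, mul_smul, smul_comm M N y]
    exact add_mem (zsmul_mem hM N) (by rw [smul_comm]; exact zsmul_mem hN M)
  | smul r y _ hy =>
    obtain ⟨N, hN0, hN⟩ := hy
    have := isAlgebraic_int F
    obtain ⟨M, hM0, hM⟩ := (Algebra.IsAlgebraic.isAlgebraic (R := ℤ) r).exists_integral_multiple
    refine ⟨N * M, mul_ne_zero hN0 hM0, ?_⟩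
    have h1 : (N * M) • r • y = (⟨M • r, hM⟩ : 𝓞 F) • (N • y) := by
      have h2 : (⟨M • r, hM⟩ : 𝓞 F) • (N • y) = (M • r) • (N • y) :=
        (algebraMap_smul F (⟨M • r, hM⟩ : 𝓞 F) (N • y)).symm
      rw [h2]
      simp only [← Int.cast_smul_eq_zsmul F, smul_smul, smul_eq_mul]
      congr 1
      push_cast
      ring
    rw [h1]
    exact O.smul_mem hN _

/-- The elements of `B` with integral coordinates lie in an order up to a bounded denominator. -/
theorem exists_int_smul_mem_order_of_isIntegral (hO : Q.IsOrder O) :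
    ∃ N : ℤ, N ≠ 0 ∧ ∀ x : Q.B, (∀ k, IsIntegral ℤ (Q.coord x k)) → N • x ∈ O := by
  let β := RingOfIntegers.basis E
  choose N hN0 hN using fun (k : Fin 4) i =>
    Q.exists_int_smul_mem_order hO ((β i : E) • Q.basisB k)
  refine ⟨∏ k, ∏ i, N k i, Finset.prod_ne_zero_iff.mpr fun k _ =>
    Finset.prod_ne_zero_iff.mpr fun i _ => hN0 k i, fun x hx => ?_⟩
  have hc : ∀ k, Q.coord x k = ∑ i, (β.repr ⟨Q.coord x k, hx k⟩ i) • (β i : E) := by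
    intro k
    have h1 := congrArg (fun z : 𝓞 E => (z : E)) (β.sum_repr ⟨Q.coord x k, hx k⟩)
    simp only [map_sum, zsmul_eq_mul, map_mul, map_intCast] at h1 ⊢
    exact h1.symm
  rw [← Q.sum_coord_smul x, Finset.smul_sum]
  refine sum_mem fun k _ => ?_
  rw [hc, Finset.sum_smul, Finset.smul_sum]
  refine sum_mem fun i _ => ?_
  obtain ⟨m, hm⟩ : N k i ∣ ∏ k, ∏ i, N k i :=
    (Finset.dvd_prod_of_mem _ (Finset.mem_univ i)).trans
      (Finset.dvd_prod_of_mem (fun k => ∏ i, N k i) (Finset.mem_univ k))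
  rw [hm, mul_comm, mul_smul, smul_assoc, smul_comm (N k i)]
  exact zsmul_mem (zsmul_mem (hN k i) _) _

end QuatDatum

/-! ### The obstruction at a prime dividing `𝔫`. -/

namespace LevelDatum

open QuatDatum

variable {F E : Type*} [Field F] [NumberField F] [Field E] [NumberField E] [Algebra F E]
  {Q : QuatDatum F E} (L : LevelDatum Q)

/-- An element of `K(𝔫)` cannot satisfy `γ q = ± q γ̄` with `q` invertible at a prime of `𝒫` that
divides `𝔫`. -/
theorem false_of_mul_eq {𝔫 : Ideal (𝓞 F)} {v : HeightOneSpectrum (𝓞 F)} (hv : v ∈ L.P)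
    (hdvd : v.asIdeal ∣ 𝔫) {γ : (Q.B)ˣ}
    (hγ : Units.map ((Q.toBv v : Q.B →ₐ[F] Q.Bv v) : Q.B →* Q.Bv v) γ ∈ L.Kn 𝔫 v)
    {ε : ℤ} {q y : Q.B} (hq : q ∈ L.OB) (hy : y ∈ L.OB) {n : 𝓞 F}
    (hqy : q * y = algebraMap F Q.B n) (hn : n ∉ v.asIdeal)
    (heq : (γ : Q.B) * q = ε • (q * Q.bar γ)) : False := by
  have hv' : v ∈ splitPrimes E L.S := hv
  have hγ' := hγ
  unfold Kn at hγ'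
  rw [dif_pos hv'] at hγ'
  set α := L.α v hv' with hα
  have had := L.α_adapted v hv'
  have hO : Q.IsOrder L.OB := L.OB_maximal.1
  obtain ⟨h1, h2⟩ : (α (Q.toBv v γ)).1 ∈ doubleCoset v (multiplicity v.asIdeal 𝔫) ∧
    (α (Q.toBv v γ)).2 ∈ doubleCoset v 0 := hγ'
  -- It remains to show that the first component of `γ` is integral, against
  -- `notMem_M2Ov_of_mem_doubleCoset`.
  have hm : multiplicity v.asIdeal 𝔫 ≠ 0 := by
    rwa [Ne, multiplicity_eq_zero, not_not]
  apply notMem_M2Ov_of_mem_doubleCoset hm h1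
  let f : Q.B →ₐ[F] M2v v :=
    ((AlgHom.fst (v.adicCompletion F) (M2v v) (M2v v)).comp α.toAlgHom).restrictScalars F |>.comp
      (Q.toBv v)
  have hf : ∀ x, f x = (α (Q.toBv v x)).1 := fun x => rfl
  have hbar : f (Q.bar γ) = (α (Q.toBv v γ)).2 := by
    have h3 : Q.toBv v (Q.bar γ) = Q.barv v (Q.toBv v γ) := rfl
    rw [hf, h3, had.bar_swap]
    rfl
  have e1 : f γ * f q = ε • (f q * f (Q.bar γ)) := by
    rw [← map_mul, heq, map_zsmul, map_mul]
  have e2 : f q * f y = algebraMap F (M2v v) n := by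
    rw [← map_mul, hqy, AlgHom.commutes]
  -- Here `y` replaces `q⁻¹` up to the factor `n`, a unit at `v`. By `hbar`, `f (Q.bar γ)` is the
  -- second component of `γ`, so the right side is integral.
  have e3 : algebraMap F (v.adicCompletion F) n • f γ = ε • (f q * f (Q.bar γ) * f y) := by
    have h4 : f γ * (f q * f y) = ε • (f q * f (Q.bar γ) * f y) := by
      rw [← mul_assoc, e1, smul_mul_assoc]
    rw [← h4, e2, IsScalarTower.algebraMap_apply F (v.adicCompletion F) (M2v v),
      ← Algebra.commutes, Algebra.smul_def]
  have e4 : algebraMap F (v.adicCompletion F) n • f γ ∈ M2Ov v := by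
    rw [e3]
    intro i j
    refine zsmul_mem (mul_mem_M2Ov (mul_mem_M2Ov ?_ ?_) ?_ i j) ε
    · exact had.fst_mem hO (Q.toBv_mem_orderv v L.OB hq)
    · rw [hbar]
      exact mem_M2Ov_of_mem_doubleCoset_zero h2
    · exact had.fst_mem hO (Q.toBv_mem_orderv v L.OB hy)
  have hval : Valued.v (algebraMap F (v.adicCompletion F) n) = 1 := by
    have h5 := HeightOneSpectrum.valuedAdicCompletion_eq_valuation' v (n : F)
    exact h5.trans ((v.valuation_eq_one_iff_notMem (K := F)).mpr hn)
  have hn0 : algebraMap F (v.adicCompletion F) n ≠ 0 := by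
    intro h0
    rw [h0, map_zero] at hval
    exact zero_ne_one hval
  have e5 := smul_mem_M2Ov (c := (algebraMap F (v.adicCompletion F) n)⁻¹) (by
    rw [HeightOneSpectrum.mem_adicCompletionIntegers, map_inv₀, hval, inv_one]) e4
  rw [smul_smul, inv_mul_cancel₀ hn0, one_smul] at e5
  exact e5

end LevelDatum

/-! ### Norms of algebraic integers, and the number of their prime divisors. -/

section Heights

variable {K : Type*} [Field K] [NumberField K]

theorem NumberField.prod_norm_embedding (x : K) :
    ∏ ψ : K →+* ℂ, ‖ψ x‖ = |((Algebra.norm ℚ x : ℚ) : ℝ)| := by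
  have h := congrArg norm (Algebra.norm_eq_prod_embeddings ℚ ℂ x)
  rw [norm_prod] at h
  rw [Fintype.prod_equiv (RingHom.equivRatAlgHom K ℂ) (fun ψ : K →+* ℂ => ‖ψ x‖)
    (fun ψ : K →ₐ[ℚ] ℂ => ‖ψ x‖) fun _ => by simp [RingHom.equivRatAlgHom_apply], ← h]
  simp

theorem NumberField.one_le_prod_norm_embedding {x : K} (hx : x ≠ 0) (hint : IsIntegral ℤ x) :
    1 ≤ ∏ ψ : K →+* ℂ, ‖ψ x‖ := by
  rw [prod_norm_embedding]
  have h1 : IsIntegral ℤ (Algebra.norm ℚ x) := Algebra.isIntegral_norm ℚ hint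
  obtain ⟨n, hn⟩ := IsIntegrallyClosed.isIntegral_iff.mp h1
  have h2 : Algebra.norm ℚ x ≠ 0 := Algebra.norm_ne_zero_iff.mpr hx
  rw [← hn] at h2 ⊢
  have h3 : n ≠ 0 := by rintro rfl; simp at h2
  have h4 := Int.one_le_abs h3
  simpa using (by exact_mod_cast h4 : (1 : ℝ) ≤ |(n : ℝ)|)

/-- A nonzero ideal contains a nonzero element whose norm is bounded by a multiple of the norm of
the ideal. -/
theorem NumberField.exists_mem_ideal_norm_le (K : Type*) [Field K] [NumberField K] :
    ∃ C > (0 : ℝ), ∀ I : Ideal (𝓞 K), I ≠ ⊥ → ∃ x ∈ I, x ≠ 0 ∧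
      |((Algebra.norm ℚ (x : K) : ℚ) : ℝ)| ≤ C * Ideal.absNorm I := by
  -- Minkowski's bound; the added `1` makes the constant visibly positive.
  refine ⟨(4 / Real.pi) ^ InfinitePlace.nrComplexPlaces K *
    (Module.finrank ℚ K).factorial / (Module.finrank ℚ K) ^ (Module.finrank ℚ K) *
      Real.sqrt |discr K| + 1, ?_, fun I hI => ?_⟩
  · have := Real.pi_pos
    positivity
  · obtain ⟨_, ⟨a, ha, rfl⟩, h0, hle⟩ := exists_ne_zero_mem_ideal_of_norm_le_mul_sqrt_discr K
      (FractionalIdeal.mk0 K ⟨I, mem_nonZeroDivisors_of_ne_zero hI⟩)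
    refine ⟨a, ha, fun h => h0 (by rw [h, map_zero]), ?_⟩
    rw [FractionalIdeal.coe_mk0, FractionalIdeal.coeIdeal_absNorm] at hle
    have h1 : (0 : ℝ) ≤ Ideal.absNorm I := Nat.cast_nonneg _
    rw [add_mul, one_mul]
    simp only [Rat.cast_natCast] at hle
    refine (le_of_eq_of_le ?_ hle).trans ?_
    · simp
    · apply le_add_of_le_of_nonneg _ h1
      apply le_of_eq
      ring

/-- A nonzero algebraic integer has few prime divisors. -/
theorem NumberField.two_pow_ncard_le {n : 𝓞 K} (hn : n ≠ 0) :
    {v : HeightOneSpectrum (𝓞 K) | n ∈ v.asIdeal}.Finite ∧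
      (2 : ℝ) ^ {v : HeightOneSpectrum (𝓞 K) | n ∈ v.asIdeal}.ncard ≤
        ∏ ψ : K →+* ℂ, ‖ψ n‖ := by
  classical
  have hspan : Ideal.span {n} ≠ 0 := by
    rwa [Ne, Ideal.zero_eq_bot, Ideal.span_singleton_eq_bot]
  have hset : {v : HeightOneSpectrum (𝓞 K) | n ∈ v.asIdeal} =
      {v : HeightOneSpectrum (𝓞 K) | v.asIdeal ∣ Ideal.span {n}} := by
    ext v
    simp [Ideal.dvd_span_singleton]
  have hfin : {v : HeightOneSpectrum (𝓞 K) | n ∈ v.asIdeal}.Finite := by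
    rw [hset]
    exact Ideal.finite_factors hspan
  refine ⟨hfin, ?_⟩
  rw [Set.ncard_eq_toFinset_card _ hfin]
  set T := hfin.toFinset with hT
  have hTmem : ∀ v ∈ T, n ∈ v.asIdeal := fun v hv => by simpa [hT] using hv
  have hdvd : ∏ v ∈ T, v.asIdeal ∣ Ideal.span {n} := by
    apply Finset.prod_dvd_of_coprime
    · intro v _ w _ hvw
      exact Ideal.isCoprime_iff_sup_eq.mpr
        (v.isMaximal.coprime_of_ne w.isMaximal fun h => hvw (HeightOneSpectrum.ext h))
    · intro v hv
      exact Ideal.dvd_span_singleton.mpr (hTmem v hv)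
  have hle : Ideal.absNorm (∏ v ∈ T, v.asIdeal) ≤ Ideal.absNorm (Ideal.span {n}) := by
    refine Nat.le_of_dvd (Nat.pos_of_ne_zero ?_) (map_dvd Ideal.absNorm hdvd)
    rwa [Ne, Ideal.absNorm_eq_zero_iff]
  -- Each prime has norm at least `2`, and the product of the distinct primes containing `n` divides
  -- `(n)`.
  have h2 : 2 ^ T.card ≤ Ideal.absNorm (∏ v ∈ T, v.asIdeal) := by
    rw [map_prod]
    apply Finset.pow_card_le_prod
    intro v _
    have h3 : Ideal.absNorm v.asIdeal ≠ 0 := by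
      rw [Ne, Ideal.absNorm_eq_zero_iff]; exact v.ne_bot
    have h4 : Ideal.absNorm v.asIdeal ≠ 1 := by
      rw [Ne, Ideal.absNorm_eq_one_iff]; exact v.isPrime.ne_top
    omega
  have h5 : ((Ideal.absNorm (Ideal.span {n}) : ℕ) : ℝ) = ∏ ψ : K →+* ℂ, ‖ψ n‖ := by
    rw [prod_norm_embedding, Ideal.absNorm_span_singleton, ← Algebra.coe_norm_int]
    simp
  rw [← h5]
  exact_mod_cast h2.trans hle

end Heights

/-! ### Choosing independent rows, and size of determinants and cofactors. -/

section LinearAlgebra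

variable {K : Type*} [Field K]

/-- A linearly independent spanning set of vectors is the set of rows of an invertible matrix. -/
theorem exists_matrix_of_basis {n : ℕ} {b : Set (Fin n → K)}
    (hli : LinearIndependent K ((↑) : b → Fin n → K)) (hspan : Submodule.span K b = ⊤) :
    ∃ M : Matrix (Fin n) (Fin n) K, M.det ≠ 0 ∧ Set.range M = b := by
  let B : Module.Basis b K (Fin n → K) := Module.Basis.mk hli (by simp [hspan])
  have : Fintype b := FiniteDimensional.fintypeBasisIndex B
  have hcard : Fintype.card b = n := by
    rw [← Module.finrank_eq_card_basis B, Module.finrank_fin_fun]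
  let e : Fin n ≃ b := (Fintype.equivFinOfCardEq hcard).symm
  refine ⟨fun i => (e i : Fin n → K), ?_, ?_⟩
  · have h1 : LinearIndependent K (fun i => (e i : Fin n → K)) := hli.comp e e.injective
    have h2 := Matrix.linearIndependent_rows_iff_isUnit
      (A := (fun i => (e i : Fin n → K) : Matrix (Fin n) (Fin n) K)) |>.mp h1
    exact ((Matrix.isUnit_iff_isUnit_det _).mp h2).ne_zero
  · ext x
    constructor
    · rintro ⟨i, rfl⟩
      exact (e i).2
    · intro hx
      exact ⟨e.symm ⟨x, hx⟩, by simp⟩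

/-- Either a set of vectors contains the rows of an invertible matrix, or there is an invertible
matrix with rows in this set or the standard basis, the orthogonal of all rows but one of which is
orthogonal to the set. -/
theorem exists_matrix_or {n : ℕ} (R : Set (Fin n → K)) :
    (∃ M : Matrix (Fin n) (Fin n) K, M.det ≠ 0 ∧ ∀ i, M i ∈ R) ∨
      ∃ (M : Matrix (Fin n) (Fin n) K) (i₀ : Fin n), M.det ≠ 0 ∧
        (∀ i, M i ∈ R ∨ ∃ j, M i = Pi.single j 1) ∧
        ∀ x : Fin n → K, (∀ i ≠ i₀, M i ⬝ᵥ x = 0) → ∀ r ∈ R, r ⬝ᵥ x = 0 := by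
  obtain ⟨b, hbR, hbspan, hbli⟩ := exists_linearIndependent K R
  have hbli' : LinearIndepOn K id b := hbli
  -- Completing by standard basis vectors keeps sizes and denominators of the rows under control.
  obtain ⟨b', hb't, hbb', hb'span, hb'li⟩ := exists_linearIndepOn_extension hbli'
    (Set.subset_union_left (s := b) (t := Set.range fun j : Fin n => (Pi.single j 1 : Fin n → K)))
  have htop : Submodule.span K b' = ⊤ := by
    rw [Set.image_id, Set.image_id] at hb'span
    rw [eq_top_iff, ← (Pi.basisFun K (Fin n)).span_eq, Submodule.span_le]
    rintro _ ⟨j, rfl⟩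
    exact hb'span (Or.inr ⟨j, by simp⟩)
  obtain ⟨M, hM, hMb⟩ := exists_matrix_of_basis hb'li htop
  by_cases hR : b' ⊆ b
  · left
    refine ⟨M, hM, fun i => hbR (hR ?_)⟩
    rw [← hMb]
    exact ⟨i, rfl⟩
  · right
    obtain ⟨s, hs, hsb⟩ := Set.not_subset.mp hR
    rw [← hMb] at hs
    obtain ⟨i₀, rfl⟩ := hs
    refine ⟨M, i₀, hM, fun i => ?_, fun x hx r hr => ?_⟩
    · have h1 : M i ∈ b' := by rw [← hMb]; exact ⟨i, rfl⟩
      rcases hb't h1 with h2 | ⟨j, hj⟩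
      · exact Or.inl (hbR h2)
      · exact Or.inr ⟨j, hj.symm⟩
    -- The row `M i₀` is outside `b`, so the other rows include all of `b`, which spans the same
    -- space as `R`.
    · have hr' : r ∈ Submodule.span K b := by
        rw [hbspan]; exact Submodule.subset_span hr
      clear hr
      induction hr' using Submodule.span_induction with
      | mem r hr =>
        have h1 := hbb' hr
        rw [← hMb] at h1
        obtain ⟨i, rfl⟩ := h1
        exact hx i (by rintro rfl; exact hsb hr)
      | zero => exact zero_dotProduct x
      | add y z _ _ hy hz => rw [add_dotProduct, hy, hz, add_zero]
      | smul c y _ hy => rw [smul_dotProduct, hy, smul_zero]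

theorem norm_det_le {n : ℕ} {M : Matrix (Fin n) (Fin n) ℂ} {C : ℝ} (hM : ∀ i j, ‖M i j‖ ≤ C) :
    ‖M.det‖ ≤ n.factorial * C ^ n := by
  have h := Matrix.det_le (abv := NormedField.toAbsoluteValue ℂ) (A := M) (x := C) hM
  rw [nsmul_eq_mul, Fintype.card_fin] at h
  exact h

theorem norm_adjugate_le {n : ℕ} {M : Matrix (Fin n) (Fin n) ℂ} {C : ℝ} (hC : 1 ≤ C)
    (hM : ∀ i j, ‖M i j‖ ≤ C) (i j : Fin n) : ‖M.adjugate i j‖ ≤ n.factorial * C ^ n := by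
  rw [Matrix.adjugate_apply]
  apply norm_det_le
  intro k l
  rw [Matrix.updateRow_apply]
  split_ifs
  · rw [Pi.single_apply]
    split_ifs
    · simpa using hC
    · simpa using zero_le_one.trans hC
  · exact hM k l

theorem isIntegral_adjugate {n : ℕ} {M : Matrix (Fin n) (Fin n) K}
    (hM : ∀ i j, IsIntegral ℤ (M i j)) (i j : Fin n) : IsIntegral ℤ (M.adjugate i j) := by
  rw [Matrix.adjugate_apply]
  apply IsIntegral.det
  intro k l
  rw [Matrix.updateRow_apply]
  split_ifs
  · rw [Pi.single_apply]
    split_ifs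
    · exact isIntegral_one
    · exact isIntegral_zero
  · exact hM k l

end LinearAlgebra

/-! ### Small linear forms: independence is impossible, and a small common zero exists. -/

section Siegel

variable {K : Type*} [Field K] [NumberField K]

/-- Linear forms of bounded height that are all small at a common vector do not contain a basis of
the dual space. -/
theorem false_of_small_rows (φ : K →+* ℂ) {C₁ C₂ C₄ c₀ : ℝ} (hC₁ : 1 ≤ C₁) (hC₂ : 0 < C₂)
    (hC₄ : 0 < C₄) (hc₀ : 0 < c₀) :
    ∃ C₅ > (0 : ℝ), ∀ X η : ℝ, 0 < X → 0 < η → C₅ * X ^ 8 * η < 1 →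
      ∀ M : Matrix (Fin 4) (Fin 4) K, M.det ≠ 0 →
        (∀ i j (ψ : K →+* ℂ), ‖ψ (M i j)‖ ≤ C₁) →
        (∀ i, ∃ a : K, a ≠ 0 ∧ (∀ j, IsIntegral ℤ (a * M i j)) ∧
          ∏ ψ : K →+* ℂ, ‖ψ a‖ ≤ C₂ * X ^ 2) →
        ∀ c : Fin 4 → ℂ, (∃ k, c₀ ≤ ‖c k‖) → (∀ i, ‖∑ j, φ (M i j) * c j‖ ≤ C₄ * η) → False := by
  classical
  set D : ℝ := Nat.factorial 4 * C₁ ^ 4 with hD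
  have hD1 : 1 ≤ D := by
    have h1 : 1 ≤ C₁ ^ 4 := one_le_pow₀ hC₁
    have h2 : ((Nat.factorial 4 : ℕ) : ℝ) = 24 := by norm_num [Nat.factorial]
    rw [hD, h2]; linarith
  set m := (Finset.univ.erase φ).card with hm
  refine ⟨C₂ ^ 4 * (4 * D * C₄ / c₀ * D ^ m), by positivity,
    fun X η hX hη hsmall M hdet hbd hden c hc hrow => ?_⟩
  choose a ha0 haint hanorm using hden
  have hdetψ : ∀ ψ : K →+* ℂ, ‖ψ M.det‖ ≤ D := by
    intro ψ
    rw [RingHom.map_det]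
    exact norm_det_le fun i j => hbd i j ψ
  have hφ : ‖φ M.det‖ ≤ 4 * D * C₄ / c₀ * η := by
    obtain ⟨k, hk⟩ := hc
    -- Cramer's rule: smallness of the forms at a vector with a coordinate of size at least `c₀`
    -- makes the determinant small.
    have h1 : φ M.det * c k = ∑ i, (φ.mapMatrix M).adjugate k i * ∑ j, φ (M i j) * c j := by
      have h2 := congrFun (congrArg (fun A => A.mulVec c)
        (Matrix.adjugate_mul (φ.mapMatrix M))) k
      simp only [← Matrix.mulVec_mulVec, Matrix.smul_mulVec, Matrix.one_mulVec] at h2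
      rw [RingHom.map_det]
      exact h2.symm
    have h3 : ‖φ M.det * c k‖ ≤ ∑ i : Fin 4, D * (C₄ * η) := by
      rw [h1]
      refine (norm_sum_le _ _).trans (Finset.sum_le_sum fun i _ => ?_)
      rw [norm_mul]
      exact mul_le_mul (norm_adjugate_le hC₁ (fun i j => hbd i j φ) k i) (hrow i) (norm_nonneg _)
        (zero_le_one.trans hD1)
    rw [norm_mul, Finset.sum_const, Finset.card_univ, Fintype.card_fin, nsmul_eq_mul] at h3
    have h4 : ‖φ M.det‖ * c₀ ≤ 4 * D * C₄ * η := by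
      refine (mul_le_mul_of_nonneg_left hk (norm_nonneg _)).trans (h3.trans (le_of_eq ?_))
      push_cast
      ring
    rw [div_mul_eq_mul_div, le_div_iff₀ hc₀]
    exact h4
  have hprod : ∏ ψ : K →+* ℂ, ‖ψ M.det‖ ≤ 4 * D * C₄ / c₀ * η * D ^ m := by
    rw [← Finset.mul_prod_erase _ _ (Finset.mem_univ φ)]
    refine mul_le_mul hφ ?_ (Finset.prod_nonneg fun _ _ => norm_nonneg _) (by positivity)
    rw [hm, ← Finset.prod_const]
    exact Finset.prod_le_prod (fun _ _ => norm_nonneg _) fun ψ _ => hdetψ ψ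
  -- Four denominators of norm at most `C₂ X²` account for `X^8`; the smallness is used at the
  -- single embedding `φ`.
  have hint : IsIntegral ℤ ((∏ i, a i) * M.det) := by
    have h1 : (∏ i, a i) * M.det = (Matrix.of fun i j => a i * M i j).det := by
      rw [Matrix.det_mul_column]
    rw [h1]
    exact IsIntegral.det fun i j => haint i j
  have hne : (∏ i, a i) * M.det ≠ 0 :=
    mul_ne_zero (Finset.prod_ne_zero_iff.mpr fun i _ => ha0 i) hdet
  have h1 := one_le_prod_norm_embedding hne hint
  simp only [map_mul, norm_mul, map_prod, norm_prod, Finset.prod_mul_distrib] at h1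
  rw [Finset.prod_comm] at h1
  have h2 : ∏ i, ∏ ψ : K →+* ℂ, ‖ψ (a i)‖ ≤ (C₂ * X ^ 2) ^ 4 := by
    refine (Finset.prod_le_prod (fun _ _ => Finset.prod_nonneg fun _ _ => norm_nonneg _)
      fun i _ => hanorm i).trans (le_of_eq ?_)
    simp
  have h3 := h1.trans (mul_le_mul h2 hprod (Finset.prod_nonneg fun _ _ => norm_nonneg _)
    (by positivity))
  have h4 : (C₂ * X ^ 2) ^ 4 * (4 * D * C₄ / c₀ * η * D ^ m) =
      C₂ ^ 4 * (4 * D * C₄ / c₀ * D ^ m) * X ^ 8 * η := by ring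
  linarith

/-- Linear forms of bounded height that are all small at a common nonzero vector have a common
integral zero of bounded height. -/
theorem exists_integral_zero_of_small (φ : K →+* ℂ) {C₁ C₂ C₃ C₄ c₀ : ℝ} (hC₁ : 1 ≤ C₁)
    (hC₂ : 0 < C₂) (hC₃ : 1 ≤ C₃) (hC₄ : 0 < C₄) (hc₀ : 0 < c₀) :
    ∃ C₅ > (0 : ℝ), ∀ X η : ℝ, 1 ≤ X → 0 < η → C₅ * X ^ 8 * η < 1 → ∀ R : Set (Fin 4 → K),
      (∀ r ∈ R, ∀ j (ψ : K →+* ℂ), ‖ψ (r j)‖ ≤ C₁) →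
      (∀ r ∈ R, ∃ a : K, a ≠ 0 ∧ (∀ j, IsIntegral ℤ (a * r j)) ∧
        ∏ ψ : K →+* ℂ, ‖ψ a‖ ≤ C₂ * X ^ 2) →
      (∀ r ∈ R, ∃ n : ℤ, n ≠ 0 ∧ (∀ j, IsIntegral ℤ ((n : K) * r j)) ∧ |(n : ℝ)| ≤ C₃ * X) →
      (∃ c : Fin 4 → ℂ, (∃ k, c₀ ≤ ‖c k‖) ∧ ∀ r ∈ R, ‖∑ j, φ (r j) * c j‖ ≤ C₄ * η) →
      ∃ x : Fin 4 → K, x ≠ 0 ∧ (∀ k, IsIntegral ℤ (x k)) ∧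
        (∀ k (ψ : K →+* ℂ), ‖ψ (x k)‖ ≤ 24 * (C₃ * C₁) ^ 4 * X ^ 4) ∧
        ∀ r ∈ R, r ⬝ᵥ x = 0 := by
  obtain ⟨C₅, hC₅, h⟩ := false_of_small_rows φ hC₁ hC₂ hC₄ hc₀
  refine ⟨C₅, hC₅, fun X η hX hη hsmall R hbd hden hnum hc => ?_⟩
  rcases exists_matrix_or R with ⟨M, hM, hMR⟩ | ⟨M, i₀, hM, hMR, hMx⟩
  · obtain ⟨c, hk, hc⟩ := hc
    exact (h X η (by linarith) hη hsmall M hM (fun i => hbd _ (hMR i)) (fun i => hden _ (hMR i)) c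
      hk fun i => hc _ (hMR i)).elim
  · have hC₃X : 1 ≤ C₃ * X := one_le_mul_of_one_le_of_one_le hC₃ hX
    have hrow : ∀ i, ∃ n : ℤ, n ≠ 0 ∧ (∀ j, IsIntegral ℤ ((n : K) * M i j)) ∧
        |(n : ℝ)| ≤ C₃ * X ∧ ∀ j (ψ : K →+* ℂ), ‖ψ (M i j)‖ ≤ C₁ := by
      intro i
      rcases hMR i with hi | ⟨k, hk⟩
      · obtain ⟨n, h1, h2, h3⟩ := hnum _ hi
        exact ⟨n, h1, h2, h3, hbd _ hi⟩
      · refine ⟨1, one_ne_zero, fun j => ?_, by simpa using hC₃X, fun j ψ => ?_⟩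
        · rw [hk, Pi.single_apply]
          split_ifs
          · simpa using isIntegral_one
          · simpa using isIntegral_zero
        · rw [hk, Pi.single_apply]
          split_ifs
          · simpa using hC₁
          · simpa using zero_le_one.trans hC₁
    choose n hn0 hnint hnX hMbd using hrow
    -- The denominators are rational integers here because the zero must be bounded at every
    -- embedding. An `a` of small norm may have large conjugates, while rational integers in the
    -- determinant estimate would worsen the exponent `8`.
    set N : Matrix (Fin 4) (Fin 4) K := Matrix.of fun i j => (n i : K) * M i j with hN
    have hNdet : N.det ≠ 0 := by
      rw [hN, Matrix.det_mul_column]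
      exact mul_ne_zero (Finset.prod_ne_zero_iff.mpr fun i _ => by exact_mod_cast hn0 i) hM
    have hNadj : ∀ i, ∑ j, N i j * N.adjugate j i₀ = if i = i₀ then N.det else 0 := by
      intro i
      have h1 := congrFun (congrFun (Matrix.mul_adjugate N) i) i₀
      rw [Matrix.mul_apply] at h1
      rw [h1]
      simp [Matrix.one_apply]
    -- The cofactors of row `i₀` are orthogonal to the other rows and pair with row `i₀` to `N.det ≠
    -- 0`. The crude bound `norm_adjugate_le` gives `X^4`.
    refine ⟨fun k => N.adjugate k i₀, ?_, fun k => isIntegral_adjugate (fun i j => hnint i j) k i₀,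
      fun k ψ => ?_, hMx _ ?_⟩
    · intro h0
      apply hNdet
      have h1 := hNadj i₀
      rw [if_pos rfl] at h1
      rw [← h1]
      exact Finset.sum_eq_zero fun j _ => by rw [congrFun h0 j, Pi.zero_apply, mul_zero]
    · have h1 : ψ (N.adjugate k i₀) = (ψ.mapMatrix N).adjugate k i₀ := by
        rw [← RingHom.map_adjugate]
        rfl
      rw [h1]
      have h2 := norm_adjugate_le (M := ψ.mapMatrix N) (C := C₃ * X * C₁)
        (one_le_mul_of_one_le_of_one_le hC₃X hC₁) (fun i j => by
          have h3 : (ψ.mapMatrix N) i j = (n i : ℂ) * ψ (M i j) := by simp [hN]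
          rw [h3, norm_mul, Complex.norm_intCast]
          exact mul_le_mul (hnX i) (hMbd i j ψ) (norm_nonneg _) (zero_le_one.trans hC₃X)) k i₀
      refine h2.trans (le_of_eq ?_)
      norm_num [Nat.factorial]
      ring
    · intro i hi
      have h1 := hNadj i
      rw [if_neg hi] at h1
      have h2 : (n i : K) * (M i ⬝ᵥ fun k => N.adjugate k i₀) = 0 := by
        rw [← h1, dotProduct, Finset.mul_sum]
        exact Finset.sum_congr rfl fun j _ => by simp [hN, mul_assoc]
      exact (mul_eq_zero.mp h2).resolve_left (by exact_mod_cast hn0 i)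

end Siegel

theorem NumberField.exists_int_mul_isIntegral_family {K ι : Type*} [Field K] [NumberField K]
    [Finite ι] (f : ι → K) : ∃ N : ℤ, N ≠ 0 ∧ ∀ i, IsIntegral ℤ ((N : K) * f i) := by
  obtain ⟨N, hN, h⟩ := NumberField.exists_int_mul_isIntegral (Set.finite_range f).toFinset
  exact ⟨N, hN, fun i => h _ (by simp)⟩

namespace QuatDatum

variable {F E : Type*} [Field F] [NumberField F] [Field E] [NumberField E] [Algebra F E]
variable (Q : QuatDatum F E)

/-! ### The linear map `q ↦ γ q - ε q γ̄` -/

/-- The rows of the matrix of the `E`-linear map `q ↦ γ q - ε q γ̄` of `B`. -/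
noncomputable def twistRow (γ : Q.B) (ε : ℤ) (k : Fin 4) : Fin 4 → E :=
  fun j => Q.coord (γ * Q.basisB j - ε • (Q.basisB j * Q.bar γ)) k

theorem twistRow_dotProduct (γ q : Q.B) (ε : ℤ) (k : Fin 4) :
    Q.twistRow γ ε k ⬝ᵥ Q.coord q = Q.coord (γ * q - ε • (q * Q.bar γ)) k := by
  have h : γ * q - ε • (q * Q.bar γ) =
      ∑ j, Q.coord q j • (γ * Q.basisB j - ε • (Q.basisB j * Q.bar γ)) := by
    conv_lhs => rw [← Q.sum_coord_smul q]
    simp only [Finset.mul_sum, Finset.sum_mul, Finset.smul_sum, ← Finset.sum_sub_distrib,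
      mul_smul_comm, smul_mul_assoc, smul_sub, smul_comm ε]
  rw [h, map_sum, Finset.sum_apply, dotProduct]
  refine Finset.sum_congr rfl fun j _ => ?_
  rw [map_smul, Pi.smul_apply, smul_eq_mul, mul_comm, twistRow]

theorem twistRow_apply (γ : Q.B) (ε : ℤ) (k j : Fin 4) : Q.twistRow γ ε k j =
    ∑ i, Q.coord γ i * Q.coord (Q.basisB i * Q.basisB j) k -
      ε * ∑ i, Q.σ (Q.coord γ i) * Q.coord (Q.basisB j * Q.basisB i) k := by
  have h1 : γ * Q.basisB j = ∑ i, Q.coord γ i • (Q.basisB i * Q.basisB j) := by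
    conv_lhs => rw [← Q.sum_coord_smul γ]
    simp only [Finset.sum_mul, smul_mul_assoc]
  have h2 : Q.basisB j * Q.bar γ = ∑ i, Q.σ (Q.coord γ i) • (Q.basisB j * Q.basisB i) := by
    conv_lhs => rw [← Q.sum_coord_smul (Q.bar γ)]
    simp only [Finset.mul_sum, mul_smul_comm, coord_bar]
  rw [twistRow, map_sub, map_zsmul, h1, h2, map_sum, map_sum]
  simp [Finset.sum_apply]

/-- The rows at `w₀` compute the twist `M ↦ γ M - ε M γ̄` on all complex matrices, so they can be
evaluated at `g ḡ⁻¹`. -/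
theorem sum_embedding_twistRow [IsTotallyReal F] (hE : Module.finrank F E = 2) (γ : Q.B) (ε : ℤ)
    (k : Fin 4) (M : Matrix (Fin 2) (Fin 2) ℂ) :
    ∑ j, Q.w₀.embedding (Q.twistRow γ ε k j) * Q.matCoord M j =
      Q.matCoord (Q.θ γ * M - ε • (M * (Q.θ γ).map (starRingEnd ℂ))) k := by
  have h : Q.θ γ * M - ε • (M * (Q.θ γ).map (starRingEnd ℂ)) =
      ∑ j, Q.matCoord M j • Q.θ (γ * Q.basisB j - ε • (Q.basisB j * Q.bar γ)) := by
    conv_lhs => rw [← Q.sum_matCoord_smul M]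
    simp only [map_sub, map_mul, map_zsmul, Q.θ_bar hE, Finset.mul_sum, Finset.sum_mul,
      Finset.smul_sum, ← Finset.sum_sub_distrib, mul_smul_comm, smul_mul_assoc, smul_sub,
      smul_comm ε]
  rw [h, map_sum, Finset.sum_apply]
  refine Finset.sum_congr rfl fun j _ => ?_
  rw [map_smul, Pi.smul_apply, smul_eq_mul, mul_comm, matCoord_θ, twistRow]

theorem exists_twistRow_bound (C : ℝ) : ∃ C' ≥ (1 : ℝ), ∀ (γ : Q.B) (ε : ℤ),
    (ε = 1 ∨ ε = -1) → (∀ (ψ : E →+* ℂ) k, ‖ψ (Q.coord γ k)‖ ≤ C) →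
      ∀ k j (ψ : E →+* ℂ), ‖ψ (Q.twistRow γ ε k j)‖ ≤ C' := by
  set T : ℝ := ∑ ψ : E →+* ℂ, ∑ i, ∑ j, ∑ k, ‖ψ (Q.coord (Q.basisB i * Q.basisB j) k)‖ with hT
  have hT0 : 0 ≤ T := by positivity
  have hle : ∀ (ψ : E →+* ℂ) i j k, ‖ψ (Q.coord (Q.basisB i * Q.basisB j) k)‖ ≤ T := by
    intro ψ i j k
    calc _ ≤ ∑ k, ‖ψ (Q.coord (Q.basisB i * Q.basisB j) k)‖ := Finset.single_le_sum
          (f := fun k => ‖ψ (Q.coord (Q.basisB i * Q.basisB j) k)‖)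
          (fun _ _ => norm_nonneg _) (Finset.mem_univ k)
      _ ≤ ∑ j, ∑ k, ‖ψ (Q.coord (Q.basisB i * Q.basisB j) k)‖ := Finset.single_le_sum
          (f := fun j => ∑ k, ‖ψ (Q.coord (Q.basisB i * Q.basisB j) k)‖)
          (fun _ _ => by positivity) (Finset.mem_univ j)
      _ ≤ ∑ i, ∑ j, ∑ k, ‖ψ (Q.coord (Q.basisB i * Q.basisB j) k)‖ := Finset.single_le_sum
          (f := fun i => ∑ j, ∑ k, ‖ψ (Q.coord (Q.basisB i * Q.basisB j) k)‖)
          (fun _ _ => by positivity) (Finset.mem_univ i)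
      _ ≤ T := Finset.single_le_sum
          (f := fun ψ : E →+* ℂ => ∑ i, ∑ j, ∑ k, ‖ψ (Q.coord (Q.basisB i * Q.basisB j) k)‖)
          (fun _ _ => by positivity) (Finset.mem_univ ψ)
  refine ⟨8 * (|C| * T) + 1, by linarith [mul_nonneg (abs_nonneg C) hT0], ?_⟩
  intro γ ε hε hC k j ψ
  have hC' : ∀ (ψ : E →+* ℂ) k, ‖ψ (Q.coord γ k)‖ ≤ |C| := fun ψ k => (hC ψ k).trans (le_abs_self C)
  have hε1 : ‖(ψ (ε : E))‖ = 1 := by rcases hε with rfl | rfl <;> simp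
  have h1 : ‖ψ (∑ i, Q.coord γ i * Q.coord (Q.basisB i * Q.basisB j) k)‖ ≤ 4 * (|C| * T) := by
    rw [map_sum]
    refine (norm_sum_le_of_le (n := fun _ => |C| * T) _ fun i _ => ?_).trans (by simp)
    rw [map_mul, norm_mul]
    exact mul_le_mul (hC' ψ i) (hle ψ i j k) (norm_nonneg _) (abs_nonneg C)
  have h2 : ‖ψ (∑ i, Q.σ (Q.coord γ i) * Q.coord (Q.basisB j * Q.basisB i) k)‖ ≤
      4 * (|C| * T) := by
    rw [map_sum]
    refine (norm_sum_le_of_le (n := fun _ => |C| * T) _ fun i _ => ?_).trans (by simp)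
    rw [map_mul, norm_mul]
    exact mul_le_mul (hC' (ψ.comp Q.σ) i) (hle ψ j i k) (norm_nonneg _) (abs_nonneg C)
  rw [twistRow_apply, map_sub, map_mul]
  refine (norm_sub_le _ _).trans ?_
  rw [norm_mul, hε1, one_mul]
  linarith

theorem exists_int_mul_twistRow_isIntegral : ∃ N : ℤ, N ≠ 0 ∧ ∀ (γ : Q.B) (z : F),
    (∀ k, IsIntegral ℤ (algebraMap F E z * Q.coord γ k)) →
      ∀ ε k j, IsIntegral ℤ (((N : E) * algebraMap F E z) * Q.twistRow γ ε k j) := by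
  obtain ⟨N, hN, hm⟩ := NumberField.exists_int_mul_isIntegral_family
    fun p : Fin 4 × Fin 4 × Fin 4 => Q.coord (Q.basisB p.1 * Q.basisB p.2.1) p.2.2
  refine ⟨N, hN, fun γ z hz ε k j => ?_⟩
  have hσ : ∀ k, IsIntegral ℤ (algebraMap F E z * Q.σ (Q.coord γ k)) := by
    intro k
    have h : Q.σ (algebraMap F E z * Q.coord γ k) = algebraMap F E z * Q.σ (Q.coord γ k) := by
      rw [map_mul, AlgEquiv.commutes]
    rw [← h]
    exact (hz k).map (Q.σ.toAlgHom.restrictScalars ℤ)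
  have hrw : ((N : E) * algebraMap F E z) * Q.twistRow γ ε k j =
      ∑ i, (algebraMap F E z * Q.coord γ i) * ((N : E) * Q.coord (Q.basisB i * Q.basisB j) k) -
      ε * ∑ i, (algebraMap F E z * Q.σ (Q.coord γ i)) *
        ((N : E) * Q.coord (Q.basisB j * Q.basisB i) k) := by
    rw [twistRow_apply, mul_sub, mul_left_comm _ (ε : E), Finset.mul_sum, Finset.mul_sum]
    congr 2
    · exact funext fun i => by ring
    · congr 1
      exact funext fun i => by ring
  have hε : IsIntegral ℤ (ε : E) := by
    simpa using isIntegral_algebraMap (R := ℤ) (A := E) (x := ε)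
  rw [hrw]
  exact IsIntegral.sub (IsIntegral.sum _ fun i _ => (hz i).mul (hm (i, j, k)))
    (hε.mul (IsIntegral.sum _ fun i _ => (hσ i).mul (hm (j, i, k))))

/-- A matrix with small coordinates has small entries, hence small determinant. This supplies the
constant `c₀` of the determinant argument uniformly in `g`. -/
theorem exists_matCoord_lower_bound : ∃ c > (0 : ℝ), ∀ M : Matrix (Fin 2) (Fin 2) ℂ,
    M.det = 1 → ∃ k, c ≤ ‖Q.matCoord M k‖ := by
  set T : ℝ := 1 + ∑ k, ∑ i, ∑ j, ‖Q.θ (Q.basisB k) i j‖ with hT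
  have hT1 : 1 ≤ T := by rw [hT]; linarith [show (0:ℝ) ≤ ∑ k, ∑ i, ∑ j, ‖Q.θ (Q.basisB k) i j‖ by positivity]
  have hle : ∀ k i j, ‖Q.θ (Q.basisB k) i j‖ ≤ T := by
    intro k i j
    calc _ ≤ ∑ j, ‖Q.θ (Q.basisB k) i j‖ := Finset.single_le_sum
          (f := fun j => ‖Q.θ (Q.basisB k) i j‖) (fun _ _ => norm_nonneg _) (Finset.mem_univ j)
      _ ≤ ∑ i, ∑ j, ‖Q.θ (Q.basisB k) i j‖ := Finset.single_le_sum
          (f := fun i => ∑ j, ‖Q.θ (Q.basisB k) i j‖) (fun _ _ => by positivity)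
          (Finset.mem_univ i)
      _ ≤ ∑ k, ∑ i, ∑ j, ‖Q.θ (Q.basisB k) i j‖ := Finset.single_le_sum
          (f := fun k => ∑ i, ∑ j, ‖Q.θ (Q.basisB k) i j‖) (fun _ _ => by positivity)
          (Finset.mem_univ k)
      _ ≤ T := by rw [hT]; linarith
  -- Four terms of size `1/8` bound the entries by `1/2`, and then the determinant is at most `1/4 +
  -- 1/4 < 1`.
  refine ⟨1 / (8 * T), by positivity, fun M hM => ?_⟩
  by_contra! hlt
  have hent : ∀ i j, ‖M i j‖ ≤ 1 / 2 := by
    intro i j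
    rw [← Q.sum_matCoord_smul M, Matrix.sum_apply]
    refine (norm_sum_le_of_le (n := fun _ => 1 / (8 * T) * T) _ fun k _ => ?_).trans ?_
    · rw [Matrix.smul_apply, smul_eq_mul, norm_mul]
      exact mul_le_mul (hlt k).le (hle k i j) (norm_nonneg _) (by positivity)
    · rw [Finset.sum_const, Finset.card_univ, Fintype.card_fin]
      field_simp
      norm_num
  have h1 : ‖M.det‖ ≤ 1 / 2 := by
    rw [Matrix.det_fin_two]
    refine (norm_sub_le _ _).trans ?_
    rw [norm_mul, norm_mul]
    have := mul_le_mul (hent 0 0) (hent 1 1) (norm_nonneg _) (by norm_num)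
    have := mul_le_mul (hent 0 1) (hent 1 0) (norm_nonneg _) (by norm_num)
    linarith
  rw [hM, norm_one] at h1
  norm_num at h1

end QuatDatum

/-! ### Uniform bounds for the entries over a compact set. -/

section CompactSets

theorem exists_entry_bound {Ω : Set SL2C} (hΩ : IsCompact Ω) :
    ∃ K ≥ (1 : ℝ), ∀ g ∈ Ω, ∀ i j, ‖g.1 i j‖ ≤ K ∧ ‖(g⁻¹).1 i j‖ ≤ K := by
  have hcont : Continuous fun g : SL2C => ∑ i, ∑ j, ‖g.1 i j‖ := by
    refine continuous_finsetSum _ fun i _ => continuous_finsetSum _ fun j _ => ?_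
    exact (continuous_subtype_val.matrix_elem i j).norm
  obtain ⟨K, hK⟩ := hΩ.exists_bound_of_continuousOn hcont.continuousOn
  have key : ∀ g ∈ Ω, ∀ i j, ‖g.1 i j‖ ≤ K := by
    intro g hg i j
    calc _ ≤ ∑ j, ‖g.1 i j‖ := Finset.single_le_sum
          (f := fun j => ‖g.1 i j‖) (fun _ _ => norm_nonneg _) (Finset.mem_univ j)
      _ ≤ ∑ i, ∑ j, ‖g.1 i j‖ := Finset.single_le_sum
          (f := fun i => ∑ j, ‖g.1 i j‖) (fun _ _ => by positivity) (Finset.mem_univ i)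
      _ ≤ K := (le_abs_self _).trans (hK g hg)
  refine ⟨max K 1, le_max_right _ _, fun g hg i j => ⟨(key g hg i j).trans (le_max_left _ _), ?_⟩⟩
  refine le_trans ?_ (le_max_left _ _)
  have h := key g hg
  rw [Matrix.SpecialLinearGroup.coe_inv, Matrix.adjugate_fin_two]
  fin_cases i <;> fin_cases j <;> simp [h]

theorem norm_mul_apply_le {A B : Matrix (Fin 2) (Fin 2) ℂ} {a b : ℝ} (hA : ∀ i j, ‖A i j‖ ≤ a)
    (hB : ∀ i j, ‖B i j‖ ≤ b) (i j : Fin 2) : ‖(A * B) i j‖ ≤ 2 * (a * b) := by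
  have ha : 0 ≤ a := (norm_nonneg _).trans (hA 0 0)
  rw [Matrix.mul_apply]
  refine (norm_sum_le_of_le (n := fun _ => a * b) _ fun k _ => ?_).trans (by simp)
  rw [norm_mul]
  exact mul_le_mul (hA i k) (hB k j) (norm_nonneg _) ha

end CompactSets

theorem NumberField.prod_norm_embedding_algebraMap {F E : Type*} [Field F] [NumberField F]
    [Field E] [NumberField E] [Algebra F E] (hE : Module.finrank F E = 2) (x : F) :
    ∏ ψ : E →+* ℂ, ‖ψ (algebraMap F E x)‖ = |((Algebra.norm ℚ x : ℚ) : ℝ)| ^ 2 := by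
  rw [NumberField.prod_norm_embedding, ← Algebra.norm_norm (S := F), Algebra.norm_algebraMap, hE,
    map_pow]
  push_cast
  rw [abs_pow]

namespace QuatDatum

variable {F E : Type*} [Field F] [NumberField F] [Field E] [NumberField E] [Algebra F E]
variable (Q : QuatDatum F E)

/-! ### Elements with small reduced norm -/

theorem coord_iota (x : Q.B) : Q.coord (Q.iota x) =
    ![Q.coord x 0, -Q.coord x 1, -Q.coord x 2, -Q.coord x 3] := by
  rw [coord_apply, coord_apply, quatEquiv_iotaB]
  simp

theorem mul_iota (x : Q.B) : x * Q.iota x = algebraMap E Q.B (Q.coord x 0 ^ 2 -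
    algebraMap F E Q.a * Q.coord x 1 ^ 2 - algebraMap F E Q.b * Q.coord x 2 ^ 2 +
      algebraMap F E Q.a * algebraMap F E Q.b * Q.coord x 3 ^ 2) := by
  apply (quatEquiv F E Q.a Q.b).injective
  rw [map_mul, quatEquiv_iotaB, AlgEquiv.commutes, coord_apply]
  ext <;> simp [QuaternionAlgebra.algebraMap_eq]
  all_goals ring

/-- The norm form is anisotropic because `B` is a division algebra; this makes the integer
controlling the excluded primes nonzero. -/
theorem eq_zero_of_mul_iota_eq_zero {x : Q.B} (h : x * Q.iota x = 0) : x = 0 := by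
  by_contra hx
  have h1 : Q.iota x = 0 := (Q.B_division.2 x hx).mul_right_eq_zero.mp h
  apply hx
  apply Q.coord.injective
  have h2 := Q.coord_iota x
  rw [h1, map_zero] at h2
  have h3 := fun k => congrFun h2 k
  rw [map_zero]
  ext k
  fin_cases k
  · simpa using (h3 0).symm
  · simpa using (h3 1).symm
  · simpa using (h3 2).symm
  · simpa using (h3 3).symm

theorem exists_int_mul_norm_bound : ∃ N : ℤ, N ≠ 0 ∧ ∃ T ≥ (1 : ℝ), ∀ (x : Q.B) (H : ℝ),
    (∀ k, IsIntegral ℤ (Q.coord x k)) → (∀ k (ψ : E →+* ℂ), ‖ψ (Q.coord x k)‖ ≤ H) →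
      ∃ ν : E, x * Q.iota x = algebraMap E Q.B ν ∧ IsIntegral ℤ ((N : E) * ν) ∧
        ∀ ψ : E →+* ℂ, ‖ψ ((N : E) * ν)‖ ≤ T * H ^ 2 := by
  obtain ⟨N, hN, hint⟩ := NumberField.exists_int_mul_isIntegral_family
    ![algebraMap F E Q.a, algebraMap F E Q.b]
  have ha : IsIntegral ℤ ((N : E) * algebraMap F E Q.a) := hint 0
  have hb : IsIntegral ℤ ((N : E) * algebraMap F E Q.b) := hint 1
  have hNi : IsIntegral ℤ (N : E) := by
    simpa using isIntegral_algebraMap (R := ℤ) (A := E) (x := N)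
  set t : (E →+* ℂ) → ℝ := fun ψ => ‖ψ (algebraMap F E Q.a)‖ + ‖ψ (algebraMap F E Q.b)‖ +
    ‖ψ (algebraMap F E Q.a)‖ * ‖ψ (algebraMap F E Q.b)‖ with ht
  have ht0 : ∀ ψ, 0 ≤ t ψ := fun ψ => by positivity
  have hN1 : (1 : ℝ) ≤ (N : ℝ) ^ 2 := by
    have := Int.one_le_abs hN
    rw [← sq_abs]
    exact one_le_pow₀ (by exact_mod_cast this)
  have hs : 0 ≤ ∑ ψ, t ψ := Finset.sum_nonneg fun ψ _ => ht0 ψ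
  refine ⟨N ^ 2, pow_ne_zero 2 hN, (N : ℝ) ^ 2 * (1 + ∑ ψ, t ψ), by nlinarith,
    fun x H hx hH => ⟨_, Q.mul_iota x, ?_, fun ψ => ?_⟩⟩
  · have h : (((N ^ 2 : ℤ) : E)) * (Q.coord x 0 ^ 2 - algebraMap F E Q.a * Q.coord x 1 ^ 2 -
        algebraMap F E Q.b * Q.coord x 2 ^ 2 +
        algebraMap F E Q.a * algebraMap F E Q.b * Q.coord x 3 ^ 2) =
        (N : E) ^ 2 * Q.coord x 0 ^ 2 - N * (N * algebraMap F E Q.a) * Q.coord x 1 ^ 2 -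
        N * (N * algebraMap F E Q.b) * Q.coord x 2 ^ 2 +
        (N * algebraMap F E Q.a) * (N * algebraMap F E Q.b) * Q.coord x 3 ^ 2 := by
      push_cast; ring
    rw [h]
    exact (((hNi.pow 2).mul ((hx 0).pow 2)).sub ((hNi.mul ha).mul ((hx 1).pow 2))).sub
      ((hNi.mul hb).mul ((hx 2).pow 2)) |>.add ((ha.mul hb).mul ((hx 3).pow 2))
  · have hle : t ψ ≤ ∑ ψ, t ψ := Finset.single_le_sum (fun ψ _ => ht0 ψ) (Finset.mem_univ ψ)
    have hsq : ∀ k, ‖ψ (Q.coord x k)‖ ^ 2 ≤ H ^ 2 := fun k =>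
      pow_le_pow_left₀ (norm_nonneg _) (hH k ψ) 2
    rw [map_mul, norm_mul, map_intCast, Complex.norm_intCast]
    push_cast
    rw [abs_pow, sq_abs, mul_assoc ((N : ℝ) ^ 2)]
    refine mul_le_mul_of_nonneg_left ?_ (sq_nonneg _)
    simp only [map_add, map_sub, map_mul, map_pow]
    refine (norm_add_le _ _).trans ?_
    refine (add_le_add (norm_sub_le _ _) le_rfl).trans ?_
    refine (add_le_add (add_le_add (norm_sub_le _ _) le_rfl) le_rfl).trans ?_
    simp only [norm_mul, norm_pow]
    have h1 := mul_le_mul_of_nonneg_left (hsq 1) (norm_nonneg (ψ (algebraMap F E Q.a)))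
    have h2 := mul_le_mul_of_nonneg_left (hsq 2) (norm_nonneg (ψ (algebraMap F E Q.b)))
    have h3 := mul_le_mul_of_nonneg_left (hsq 3) (mul_nonneg
      (norm_nonneg (ψ (algebraMap F E Q.a))) (norm_nonneg (ψ (algebraMap F E Q.b))))
    have h4 := mul_le_mul_of_nonneg_right hle (sq_nonneg H)
    simp only [ht] at h4 ⊢
    linarith [hsq 0]

/-- An element of `B` with integral coordinates has a multiple in a given order that divides there
an integer of `F` whose size is controlled. -/
theorem exists_mul_eq_algebraMap (hE : Module.finrank F E = 2)
    {O : Subalgebra (𝓞 F) Q.B} (hO : Q.IsOrder O) :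
    ∃ N : ℤ, ∃ T ≥ (1 : ℝ), ∀ (x : Q.B) (H : ℝ), x ≠ 0 →
      (∀ k, IsIntegral ℤ (Q.coord x k)) → (∀ k (ψ : E →+* ℂ), ‖ψ (Q.coord x k)‖ ≤ H) →
      N • x ∈ O ∧ ∃ y ∈ O, ∃ n : 𝓞 F, n ≠ 0 ∧ (N • x) * y = algebraMap F Q.B n ∧
        ∏ ψ : F →+* ℂ, ‖ψ n‖ ≤ (T * H ^ 4) ^ Fintype.card (E →+* ℂ) := by
  obtain ⟨N, hN, hmem⟩ := Q.exists_int_smul_mem_order_of_isIntegral hO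
  obtain ⟨N', hN', T, hT, hnorm⟩ := Q.exists_int_mul_norm_bound
  have hN1 : (1 : ℝ) ≤ (N : ℝ) ^ 2 := by
    have := Int.one_le_abs hN
    rw [← sq_abs]
    exact one_le_pow₀ (by exact_mod_cast this)
  refine ⟨N, (N : ℝ) ^ 2 * T ^ 2, by nlinarith [one_le_pow₀ (n := 2) hT],
    fun x H hx hint hH => ⟨hmem x hint, ?_⟩⟩
  obtain ⟨ν, hν, hνint, hνle⟩ := hnorm x H hint hH
  set μ := (N' : E) * ν with hμ
  have hν0 : ν ≠ 0 := by
    rintro rfl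
    exact hx (Q.eq_zero_of_mul_iota_eq_zero (by rw [hν, map_zero]))
  have hμ0 : μ ≠ 0 := mul_ne_zero (by exact_mod_cast hN') hν0
  have hNi : ∀ N : ℤ, IsIntegral ℤ (N : E) := fun N => by
    simpa using isIntegral_algebraMap (R := ℤ) (A := E) (x := N)
  have hσμ : IsIntegral ℤ (Q.σ μ) := hνint.map (Q.σ.toAlgHom.restrictScalars ℤ)
  have hyint : ∀ k, IsIntegral ℤ (Q.coord (((N' : E) * Q.σ μ) • Q.iota x) k) := by
    intro k
    rw [map_smul, Pi.smul_apply, smul_eq_mul, coord_iota]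
    refine ((hNi N').mul hσμ).mul ?_
    fin_cases k
    · exact hint 0
    · exact (hint 1).neg
    · exact (hint 2).neg
    · exact (hint 3).neg
  -- The reduced norm lies in `E`. Multiplying by its conjugate descends to `F`, and `y = N N' σ(μ)
  -- ι(x)` provides the corresponding cofactor of `N x`.
  obtain ⟨n, hn⟩ := exists_algebraMap_eq_of_fixed hE Q.σ_ne (z := (N : E) ^ 2 * (μ * Q.σ μ)) (by
    rw [map_mul, map_mul, map_pow, map_intCast, involutive_of_finrank_eq_two hE Q.σ_ne,
      mul_comm μ])
  have hnint : IsIntegral ℤ n := by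
    rw [← isIntegral_algebraMap_iff (FaithfulSMul.algebraMap_injective F E), hn]
    exact ((hNi N).pow 2).mul (hνint.mul hσμ)
  have hn0 : n ≠ 0 := by
    rintro rfl
    rw [map_zero] at hn
    exact mul_ne_zero (pow_ne_zero 2 (Int.cast_ne_zero.mpr hN))
      (mul_ne_zero hμ0 ((map_ne_zero Q.σ).mpr hμ0)) hn.symm
  refine ⟨_, hmem _ hyint, ⟨n, hnint⟩, ?_, ?_, ?_⟩
  · intro h
    exact hn0 (congrArg Subtype.val h)
  · change _ = algebraMap F Q.B n
    have hs : ∀ (e : E) (z : Q.B), e • z = algebraMap E Q.B e * z := fun e z => Algebra.smul_def e z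
    rw [IsScalarTower.algebraMap_apply F E Q.B, hn, smul_mul_smul_comm, mul_smul_comm, hν,
      ← Int.cast_smul_eq_zsmul E, hs, hs, ← map_mul, ← map_mul, hμ]
    congr 1
    push_cast
    ring
  · change ∏ ψ : F →+* ℂ, ‖ψ n‖ ≤ _
    have h1 := NumberField.one_le_prod_norm_embedding hn0 hnint
    have h2 := NumberField.prod_norm_embedding_algebraMap hE n
    rw [NumberField.prod_norm_embedding] at h1 ⊢
    -- The norm over `F` is at least `1`, so it is at most its square, which is the product over the
    -- embeddings of `E`.
    refine (le_self_pow₀ h1 two_ne_zero).trans ?_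
    rw [← h2, ← Finset.card_univ, ← Finset.prod_const]
    refine Finset.prod_le_prod (fun _ _ => norm_nonneg _) fun ψ _ => ?_
    have h3 := hνle (ψ.comp Q.σ)
    have h4 : ‖ψ (Q.σ μ)‖ ≤ T * H ^ 2 := h3
    have h5 := mul_le_mul (hνle ψ) h4 (norm_nonneg _) (by positivity)
    rw [hn, map_mul, map_mul, map_pow, norm_mul, norm_mul, norm_pow, map_intCast,
      Complex.norm_intCast, sq_abs]
    calc _ ≤ (N : ℝ) ^ 2 * (T * H ^ 2 * (T * H ^ 2)) :=
          mul_le_mul_of_nonneg_left h5 (sq_nonneg _)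
      _ = _ := by ring

end QuatDatum

/-! ### The common solution `q` of the twisted commutation relations. -/

namespace LevelDatum

open QuatDatum

variable {F E : Type*} [Field F] [NumberField F] [Field E] [NumberField E] [Algebra F E]
  {Q : QuatDatum F E} (L : LevelDatum Q)

theorem exists_int_mul_twistRow_isIntegral : ∃ N : ℤ, N ≠ 0 ∧ ∀ (𝔫 : Ideal (𝓞 F)) (γ : (Q.B)ˣ),
    (∀ v : HeightOneSpectrum (𝓞 F),
      Units.map ((Q.toBv v : Q.B →ₐ[F] Q.Bv v) : Q.B →* Q.Bv v) γ ∈ L.Kn 𝔫 v) →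
    ∀ x ∈ 𝔫, ∀ ε k j, IsIntegral ℤ (((N : E) * algebraMap F E x) * Q.twistRow γ ε k j) := by
  obtain ⟨N₀, hN₀, h₀⟩ := Q.exists_int_mul_coord_isIntegral L.OB_maximal.1
  obtain ⟨N₁, hN₁, h₁⟩ := Q.exists_int_mul_twistRow_isIntegral
  refine ⟨N₁ * N₀, mul_ne_zero hN₁ hN₀, fun 𝔫 γ hγ x hx ε k j => ?_⟩
  have h := h₁ γ (N₀ * x) (fun k => ?_) ε k j
  · rw [map_mul, map_intCast, ← mul_assoc] at h
    rw [Int.cast_mul]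
    exact h
  · have h2 := h₀ ((x : F) • (γ : Q.B)) (fun v => by
      rw [map_smul, ← algebraMap_smul (v.adicCompletion F)]
      exact L.smul_mem_orderv_of_mem_Kn (hγ v) hx) k
    rw [← algebraMap_smul E, map_smul, Pi.smul_apply, smul_eq_mul, ← mul_assoc] at h2
    rw [map_mul, map_intCast]
    exact h2

end LevelDatum

/-- If `y` is close to a signed real matrix and `Γ = g y g⁻¹`, then `g ḡ⁻¹` is nearly a solution of
`Γ M = ε M Γ̄`. -/
theorem norm_twist_apply_le {g Γ : SL2C} {K κ : ℝ} {ε : ℤ}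
    (hg : ∀ i j, ‖g.1 i j‖ ≤ K ∧ ‖(g⁻¹).1 i j‖ ≤ K)
    (hy : ∀ i j, ‖(g⁻¹ * Γ * g).1 i j - ε * (starRingEnd ℂ) ((g⁻¹ * Γ * g).1 i j)‖ ≤ κ)
    (i j : Fin 2) : ‖(Γ.1 * (g * conjSL g⁻¹).1 -
      ε • ((g * conjSL g⁻¹).1 * Γ.1.map (starRingEnd ℂ))) i j‖ ≤ 4 * K ^ 2 * κ := by
  set y := g⁻¹ * Γ * g with hydef
  have hΓ : Γ = g * y * g⁻¹ := by rw [hydef]; group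
  have hc : ∀ h : SL2C, (conjSL h).1 = h.1.map (starRingEnd ℂ) := fun h => rfl
  have h1 : Γ * (g * conjSL g⁻¹) = g * y * conjSL g⁻¹ := by rw [hΓ]; group
  have h2 : (g * conjSL g⁻¹) * conjSL Γ = g * conjSL y * conjSL g⁻¹ := by
    rw [hΓ, map_mul, map_mul, map_inv]; group
  have h3 : Γ.1 * (g * conjSL g⁻¹).1 = g.1 * y.1 * (conjSL g⁻¹).1 :=
    congrArg Subtype.val h1
  have h4 : (g * conjSL g⁻¹).1 * Γ.1.map (starRingEnd ℂ) = g.1 * (conjSL y).1 * (conjSL g⁻¹).1 :=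
    congrArg Subtype.val h2
  -- Substituting `Γ = g y g⁻¹`, the inner factors cancel and leave `g (y - ε ȳ) ḡ⁻¹`.
  have h5 : Γ.1 * (g * conjSL g⁻¹).1 - ε • ((g * conjSL g⁻¹).1 * Γ.1.map (starRingEnd ℂ)) =
      g.1 * (y.1 - ε • (conjSL y).1) * (conjSL g⁻¹).1 := by
    rw [h3, h4, mul_sub, sub_mul, mul_smul_comm, smul_mul_assoc]
  rw [h5]
  refine (norm_mul_apply_le (b := K) (norm_mul_apply_le (a := K) (b := κ) (fun i j => (hg i j).1)
    fun i j => ?_) (fun i j => ?_) i j).trans (le_of_eq (by ring))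
  · rw [Matrix.sub_apply, Matrix.smul_apply, zsmul_eq_mul, hc, Matrix.map_apply]
    exact hy i j
  · rw [hc, Matrix.map_apply, RCLike.norm_conj]
    exact (hg i j).2

theorem norm_apply_le_of_conj {g Γ : SL2C} {K κ : ℝ}
    (hg : ∀ i j, ‖g.1 i j‖ ≤ K ∧ ‖(g⁻¹).1 i j‖ ≤ K)
    (hy : ∀ i j, ‖(g⁻¹ * Γ * g).1 i j‖ ≤ κ) (i j : Fin 2) : ‖Γ.1 i j‖ ≤ 4 * K ^ 2 * κ := by
  have hΓ : Γ = g * (g⁻¹ * Γ * g) * g⁻¹ := by group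
  have h1 : Γ.1 = g.1 * (g⁻¹ * Γ * g).1 * (g⁻¹).1 := congrArg Subtype.val hΓ
  rw [h1]
  exact (norm_mul_apply_le (norm_mul_apply_le (fun i j => (hg i j).1) hy)
    (fun i j => (hg i j).2) i j).trans (le_of_eq (by ring))

namespace LevelDatum

open QuatDatum

variable {F E : Type*} [Field F] [NumberField F] [Field E] [NumberField E] [Algebra F E]
  {Q : QuatDatum F E} (L : LevelDatum Q)

/-- The elements of the sets `M(g, δ, 𝔫)` with `δ` small and `𝔫` of bounded norm have a common
nonzero solution `q` of `γ q = ± q γ̄`, of controlled size. -/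
theorem exists_common_twist [IsTotallyReal F] (hE : Module.finrank F E = 2) {Ω : Set SL2C}
    (hΩ : IsCompact Ω) : ∃ C > (0 : ℝ), ∃ C' ≥ (1 : ℝ), ∀ g ∈ Ω, ∀ X ≥ (1 : ℝ), ∃ q : Q.B, q ≠ 0 ∧
      (∀ k, IsIntegral ℤ (Q.coord q k)) ∧
      (∀ k (ψ : E →+* ℂ), ‖ψ (Q.coord q k)‖ ≤ C' * X ^ 4) ∧
      ∀ δ < C * X ^ (-8 : ℤ), ∀ 𝔫 : Ideal (𝓞 F), 𝔫 ≠ ⊥ → (Ideal.absNorm 𝔫 : ℝ) < X →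
        ∀ γ ∈ L.M g δ 𝔫, ∃ ε : ℤ, (γ : Q.B) * q = ε • (q * Q.bar γ) := by
  obtain ⟨K, hK1, hK⟩ := exists_entry_bound hΩ
  obtain ⟨K₁, hK₁, hsign⟩ := exists_sign_of_dGSet_lt
  obtain ⟨K₂, hK₂, hcoord⟩ := Q.exists_coord_bound hE (4 * K ^ 2 * (2 * Real.exp 8 + 1))
  obtain ⟨C₁, hC₁, hrow⟩ := Q.exists_twistRow_bound K₂
  obtain ⟨N, hN, hint⟩ := L.exists_int_mul_twistRow_isIntegral
  obtain ⟨C₀, hC₀, hideal⟩ := NumberField.exists_mem_ideal_norm_le F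
  obtain ⟨c₀, hc₀, hlow⟩ := Q.exists_matCoord_lower_bound
  obtain ⟨K₃, hK₃, hmat⟩ := Q.exists_matCoord_bound
  have hN1 : 1 ≤ |(N : ℝ)| := by exact_mod_cast Int.one_le_abs hN
  obtain ⟨C₅, hC₅, hzero⟩ := exists_integral_zero_of_small Q.w₀.embedding hC₁
    (C₂ := |(N : ℝ)| ^ Fintype.card (E →+* ℂ) * C₀ ^ 2) (by positivity) (C₃ := |(N : ℝ)|) hN1
    (C₄ := K₃ * (4 * K ^ 2 * K₁)) (by positivity) hc₀
  -- The first constant gives both `η ≤ 1`, needed for closeness to `H'`, and `C₅ X^8 η ≤ 1/2`.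
  refine ⟨min 1 (1 / (2 * C₅)), by positivity, 24 * (|(N : ℝ)| * C₁) ^ 4, ?_, fun g hg X hX => ?_⟩
  · have := one_le_pow₀ (n := 4) (one_le_mul_of_one_le_of_one_le hN1 hC₁)
    linarith
  have hX0 : 0 < X := by linarith
  set η := min 1 (1 / (2 * C₅)) * X ^ (-8 : ℤ) with hη
  have hη0 : 0 < η := by positivity
  have hXinv : X ^ (-8 : ℤ) ≤ 1 := zpow_le_one_of_nonpos₀ hX (by norm_num)
  have hη1 : η ≤ 1 := mul_le_one₀ (min_le_left _ _) (by positivity) hXinv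
  have hsmall : C₅ * X ^ 8 * η < 1 := by
    have h1 : X ^ 8 * X ^ (-8 : ℤ) = 1 := by
      rw [← zpow_natCast, ← zpow_add₀ hX0.ne']; simp
    have h2 : C₅ * X ^ 8 * η = C₅ * min 1 (1 / (2 * C₅)) := by
      rw [hη]; linear_combination (C₅ * min 1 (1 / (2 * C₅))) * h1
    rw [h2]
    calc _ ≤ C₅ * (1 / (2 * C₅)) := mul_le_mul_of_nonneg_left (min_le_right _ _) hC₅.le
      _ < 1 := by field_simp; norm_num
  -- All admissible `𝔫`, `δ`, `γ` and signs are collected together, so that `q` depends only on `g`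
  -- and `X`.
  set R : Set (Fin 4 → E) := {r | ∃ 𝔫 : Ideal (𝓞 F), 𝔫 ≠ ⊥ ∧ (Ideal.absNorm 𝔫 : ℝ) < X ∧
    ∃ δ < η, ∃ γ ∈ L.M g δ 𝔫, ∃ h : γ ∈ Q.GF, ∃ ε : ℤ, (ε = 1 ∨ ε = -1) ∧
      (∀ i j, ‖(g⁻¹ * Q.toSL γ h * g).1 i j -
        ε * (starRingEnd ℂ) ((g⁻¹ * Q.toSL γ h * g).1 i j)‖ ≤ K₁ * η) ∧
      ∃ k, r = Q.twistRow γ ε k} with hR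
  obtain ⟨x, hx0, hxint, hxle, hx⟩ : ∃ x : Fin 4 → E, x ≠ 0 ∧ (∀ k, IsIntegral ℤ (x k)) ∧
      (∀ k (ψ : E →+* ℂ), ‖ψ (x k)‖ ≤ 24 * (|(N : ℝ)| * C₁) ^ 4 * X ^ 4) ∧
      ∀ r ∈ R, r ⬝ᵥ x = 0 := by
    refine hzero X η hX hη0 hsmall R ?_ ?_ ?_ ?_
    · rintro r ⟨𝔫, -, -, δ, -, γ, ⟨_, -, hd1, -⟩, h, ε, hε, -, k, rfl⟩ j ψ
      refine hrow γ ε hε (fun ψ k => hcoord γ h (fun i j => ?_) ψ k) k j ψ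
      refine norm_apply_le_of_conj (hK g hg) (Γ := Q.toSL γ h) (fun i j => ?_) i j
      have h1 := (norm_sq_le_frobSq (g⁻¹ * Q.toSL γ h * g).1 i j).trans (frobSq_le_of_dG_one hd1)
      nlinarith [norm_nonneg ((g⁻¹ * Q.toSL γ h * g).1 i j)]
    · rintro r ⟨𝔫, h𝔫, hnorm, δ, -, γ, ⟨-, hγ, -, -⟩, h, ε, hε, -, k, rfl⟩
      -- A short element of `𝔫` serves as denominator; its norm from `E` is the square of its norm
      -- from `F`, whence `X²`.
      obtain ⟨z, hz, hz0, hzle⟩ := hideal 𝔫 h𝔫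
      refine ⟨(N : E) * algebraMap F E z, mul_ne_zero (Int.cast_ne_zero.mpr hN)
        (by simpa using hz0), fun j => hint 𝔫 γ hγ z hz ε k j, ?_⟩
      simp only [map_mul, norm_mul, map_intCast, Complex.norm_intCast]
      rw [Finset.prod_mul_distrib, NumberField.prod_norm_embedding_algebraMap hE, Finset.prod_const,
        Finset.card_univ, mul_assoc]
      refine mul_le_mul_of_nonneg_left ?_ (by positivity)
      rw [← mul_pow]
      exact pow_le_pow_left₀ (abs_nonneg _)
        (hzle.trans (mul_le_mul_of_nonneg_left hnorm.le hC₀.le)) 2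
    · rintro r ⟨𝔫, h𝔫, hnorm, δ, -, γ, ⟨-, hγ, -, -⟩, h, ε, hε, -, k, rfl⟩
      have hn0 : Ideal.absNorm 𝔫 ≠ 0 := fun h0 => h𝔫 (Ideal.absNorm_eq_zero_iff.mp h0)
      -- The norm of `𝔫` is a rational integer in `𝔫` and is below `X`.
      refine ⟨N * Ideal.absNorm 𝔫, mul_ne_zero hN (by exact_mod_cast hn0), fun j => ?_, ?_⟩
      · have := hint 𝔫 γ hγ (Ideal.absNorm 𝔫 : 𝓞 F) (Ideal.absNorm_mem 𝔫) ε k j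
        simpa using this
      · push_cast
        rw [abs_mul, Nat.abs_cast]
        exact mul_le_mul_of_nonneg_left hnorm.le (abs_nonneg _)
    · obtain ⟨k₀, hk₀⟩ := hlow (g * conjSL g⁻¹).1 (g * conjSL g⁻¹).2
      refine ⟨Q.matCoord (g * conjSL g⁻¹).1, ⟨k₀, hk₀⟩, ?_⟩
      rintro r ⟨𝔫, -, -, δ, -, γ, -, h, ε, hε, hy, k, rfl⟩
      rw [sum_embedding_twistRow Q hE]
      refine (hmat _ _ (fun i j => norm_twist_apply_le (hK g hg) (Γ := Q.toSL γ h) hy i j) k).trans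
        (le_of_eq (by ring))
  refine ⟨Q.coord.symm x, by simpa using hx0, by simpa using hxint, by simpa using hxle,
    fun δ hδ 𝔫 h𝔫 hnorm γ hγ => ?_⟩
  obtain ⟨h, -, hd1, hd2⟩ := id hγ
  obtain ⟨ε, hε, hy⟩ := hsign _ η hη1 hd1 (hd2.trans_lt hδ)
  refine ⟨ε, sub_eq_zero.mp (Q.coord.injective ?_)⟩
  rw [map_zero]
  ext k
  rw [← twistRow_dotProduct, LinearEquiv.apply_symm_apply, Pi.zero_apply]
  exact hx _ ⟨𝔫, h𝔫, hnorm, δ, hδ, γ, hγ, h, ε, hε, hy, k, rfl⟩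

end LevelDatum

/-! ### Counting the excluded primes, and the conclusion. -/

theorem exists_prime_dvd_of_ne_top {F : Type*} [Field F] [NumberField F] {𝔫 : Ideal (𝓞 F)}
    (h0 : 𝔫 ≠ ⊥) (h1 : 𝔫 ≠ ⊤) : ∃ v : HeightOneSpectrum (𝓞 F), v.asIdeal ∣ 𝔫 := by
  obtain ⟨m, hm, hle⟩ := Ideal.exists_le_maximal 𝔫 h1
  exact ⟨⟨m, hm.isPrime, fun h => h0 (le_bot_iff.mp (h ▸ hle))⟩, Ideal.dvd_iff_le.mpr hle⟩

theorem natCast_le_mul_log {X T : ℝ} {a d m : ℕ} (hX : 2 ≤ X) (hT : 1 ≤ T)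
    (h : (2 : ℝ) ^ m ≤ (T * X ^ a) ^ d) :
    (m : ℝ) ≤ (d * (Real.log T / Real.log 2 + a) / Real.log 2 + 1) * max (Real.log X) 0 := by
  have h2 : 0 < Real.log 2 := Real.log_pos one_lt_two
  have hX2 : Real.log 2 ≤ Real.log X := Real.log_le_log two_pos hX
  have hT0 := Real.log_nonneg hT
  have h1 := Real.log_le_log (by positivity) h
  rw [Real.log_pow, Real.log_pow, Real.log_mul (by positivity) (by positivity), Real.log_pow] at h1
  rw [max_eq_left (h2.le.trans hX2)]
  -- Since `X ≥ 2`, the constant term is absorbed into a multiple of `log X`.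
  have h3 : Real.log T ≤ Real.log T / Real.log 2 * Real.log X := by
    rw [div_mul_eq_mul_div, le_div_iff₀ h2]
    exact mul_le_mul_of_nonneg_left hX2 hT0
  have h4 : (m : ℝ) * Real.log 2 ≤ d * (Real.log T / Real.log 2 + a) * Real.log X := by
    refine h1.trans ?_
    rw [mul_assoc]
    refine mul_le_mul_of_nonneg_left ?_ (Nat.cast_nonneg d)
    linarith
  calc (m : ℝ) ≤ d * (Real.log T / Real.log 2 + a) * Real.log X / Real.log 2 :=
        (le_div_iff₀ h2).mpr h4
    _ = d * (Real.log T / Real.log 2 + a) / Real.log 2 * Real.log X := by ring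
    _ ≤ _ := by linarith

theorem mainTheorem2 (F E : Type*) [Field F] [NumberField F] [IsTotallyReal F]
    [Field E] [NumberField E] [Algebra F E] (hE : Module.finrank F E = 2)
    (Q : QuatDatum F E) (L : LevelDatum Q) (Ω : Set SL2C) (hΩ : IsCompact Ω) :
    ∃ C > (0 : ℝ), ∃ A > (0 : ℝ), ∀ g ∈ Ω, ∀ X > (0 : ℝ),
      ∃ P₀ ⊆ L.P, (L.P \ P₀).Finite ∧ ((L.P \ P₀).ncard : ℝ) ≤ A * max (Real.log X) 0 ∧
        ∀ δ : ℝ, δ < C * X ^ (-8 : ℤ) → ∀ 𝔫 : Ideal (𝓞 F), 𝔫 ≠ ⊥ → 𝔫 ≠ ⊤ →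
          (∀ v : HeightOneSpectrum (𝓞 F), v.asIdeal ∣ 𝔫 → v ∈ P₀) →
          (Ideal.absNorm 𝔫 : ℝ) < X → L.M g δ 𝔫 = ∅ := by
  obtain ⟨C, hC, C', hC', htwist⟩ := L.exists_common_twist hE hΩ
  obtain ⟨N, T, hT, hdvd⟩ := Q.exists_mul_eq_algebraMap hE L.OB_maximal.1
  have hTC : 1 ≤ T * C' ^ 4 := one_le_mul_of_one_le_of_one_le hT (one_le_pow₀ hC')
  have hlog2 : 0 < Real.log 2 := Real.log_pos one_lt_two
  have hlogT := Real.log_nonneg hTC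
  refine ⟨C, hC, Fintype.card (E →+* ℂ) * (Real.log (T * C' ^ 4) / Real.log 2 + (16 : ℕ)) /
    Real.log 2 + 1, by positivity, fun g hg X hX0 => ?_⟩
  -- Below `2` no proper nonzero ideal has norm less than `X`, so no prime is excluded. This fits
  -- the bound even where `log X ≤ 0`.
  rcases lt_or_ge X 2 with hX | hX
  · refine ⟨L.P, subset_rfl, by simp, ?_, fun δ _ 𝔫 h0 h1 _ hlt => ?_⟩
    · rw [Set.sdiff_self, Set.ncard_empty, Nat.cast_zero]
      positivity
    · have h2 : Ideal.absNorm 𝔫 < 2 := by exact_mod_cast hlt.trans hX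
      interval_cases h : Ideal.absNorm 𝔫
      · exact absurd (Ideal.absNorm_eq_zero_iff.mp h) h0
      · exact absurd (Ideal.absNorm_eq_one_iff.mp h) h1
  obtain ⟨q, hq0, hqint, hqle, hq⟩ := htwist g hg X (by linarith)
  obtain ⟨hqO, y, hy, n, hn0, hqy, hn⟩ := hdvd q _ hq0 hqint hqle
  obtain ⟨hfin, hcard⟩ := NumberField.two_pow_ncard_le hn0
  have hsub : L.P \ {v ∈ L.P | n ∉ v.asIdeal} ⊆ {v | n ∈ v.asIdeal} := fun v hv => by
    by_contra h
    exact hv.2 ⟨hv.1, h⟩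
  refine ⟨{v ∈ L.P | n ∉ v.asIdeal}, Set.sep_subset _ _, hfin.subset hsub, ?_,
    fun δ hδ 𝔫 h0 h1 hP hlt => ?_⟩
  -- The coordinates of `q` are `O(X^4)`, and the conjugates of `n` have degree four in them, whence
  -- the exponent `16`.
  · refine natCast_le_mul_log (a := 16) (d := Fintype.card (E →+* ℂ)) hX hTC ?_
    calc _ ≤ (2 : ℝ) ^ {v : HeightOneSpectrum (𝓞 F) | n ∈ v.asIdeal}.ncard :=
          pow_le_pow_right₀ one_le_two (Set.ncard_le_ncard hsub hfin)
      _ ≤ _ := hcard.trans hn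
      _ = _ := by congr 1; ring
  · rw [Set.eq_empty_iff_forall_notMem]
    intro γ hγ
    obtain ⟨v, hv⟩ := exists_prime_dvd_of_ne_top h0 h1
    obtain ⟨ε, hε⟩ := hq δ hδ 𝔫 h0 hlt γ hγ
    refine L.false_of_mul_eq (hP v hv).1 hv (hγ.2.1 v) (ε := ε) hqO hy hqy (hP v hv).2 ?_
    rw [mul_smul_comm, hε, smul_mul_assoc, smul_comm]
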